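/- Let $G=(V,E)$ be a directed graph with $n\ge 1$ vertices, $e$ edges, strictly positive real edge weights $w$ and a source vertex $s$, given by adjacency lists. Algorithm $SP_1$ sets $D[x]:=\infty$, $fixed[x]:=\text{false}$ and $pred[x]:=$ the in-degree of $x$ for all vertices $x$, starts with empty FIFO queues $R,Q$ and an empty min-priority queue $H$, then sets $D[s]:=0$ and inserts $s$ into $H$ with key $D[s]$. While $H$ is not empty, it performs an iteration of the outer loop: it removes a vertex $j$ of minimum key from $H$ and, if $j$ is not fixed, 1. marks $j$ as fixed and inserts it into $R$; 2. while $R\neq\emptyset$, removes a vertex $z$ from $R$ and, for each edge $(z,k)\in E$ with $k$ not fixed at that moment, decreases $pred[k]$ by $1$ and replaces $D[k]$ by $D[z]+w(z,k)$ if this is smaller; then, if $pred[k]=0$, it marks $k$ as fixed and inserts it into $R$, and otherwise, if $D[k]$ was changed and $k\notin Q$, it inserts $k$ into $Q$; 3. removes every vertex $z$ from $Q$ and, if $z$ is not fixed, calls $H.\mathrm{insertOrAdjust}(z,D[z])$, which inserts $z$ with key $D[z]$ or, if $z$ is already in $H$, decreases its key to $D[z]$. Let $H$ be implemented as a Fibonacci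 heap, and measure time in steps of a unit-cost random access machine that can add and compare reals, including the time for the initialization. Then there is an absolute constant $C$ such that, for all $G,w,s$, $SP_1$ halts after at most $C\,(e+n\log n+1)$ steps. Moreover, if $G$ is acyclic and $s$ is its only vertex of in-degree zero, then it halts after at most $C\,(e+1)$ steps, performs exactly one iteration of the outer loop, and its only operations on $H$ besides tests for emptiness are the insertion of $s$ and one removal of the minimum; $\mathrm{insertOrAdjust}$ is never called. -/

import Mathlib

/-!
The algorithm `SP₁`, written out as a program for a unit-cost random access machine.  The machine
has integer registers, integer arrays and arrays of numbers in `ℝ ∪ {∞}`.  A single instruction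
touches a bounded number of cells, so that counting instructions counts time.  The priority queue
is a Fibonacci heap, implemented by pointers and run on the same machine, instruction by
instruction; no cost is postulated for its operations.
-/

namespace SP

/-! ### The machine -/

/-- Integer registers. -/
inductive Reg
  /-- input: the number of vertices, also used as the null pointer -/
  | n
  /-- input: the source vertex -/
  | src
  -- loop variables of the main program
  | i | j | fin | z | k | changed
  -- head and tail positions of the queues `R` and `Q`
  | rHead | rTail | qHead | qTail
  /-- argument of the heap insertions and result of `removeMin` -/
  | v
  -- the Fibonacci heap: its minimum node and the first node of its root list
  | hmin | roots
  -- local variables of the heap operations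
  | x | y | c | nx | pv | d | maxDeg | go
  deriving DecidableEq

/-- Integer arrays. -/
inductive Arr
  -- input, adjacency lists: the edges out of `u` sit at the positions `first u, …, last u - 1`,
  -- and `tgt p` is the head of the edge at position `p`
  | first | last | tgt
  -- the arrays `pred` and `fixed`, the queues `R` and `Q`, and the bit vector for membership in `Q`
  | pred | fixed | R | Q | inQ
  -- the Fibonacci heap: membership, links of the nodes (parent, first child, next and previous
  -- sibling), number of children, mark bit, and the table of roots by degree
  | inH | parent | child | nxt | prv | deg | mark | table
  deriving DecidableEq

/-- Arrays of numbers: edge weights (input), tentative distances, keys of the heap nodes. -/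
inductive NumArr
  | wt | D | key
  deriving DecidableEq

/-- The contents of the memory. -/
structure Mem where
  reg : Reg → ℕ
  cell : Arr → ℕ → ℕ
  num : NumArr → ℕ → WithTop ℝ

/-- Write `a` into register `r`. -/
def Mem.setReg (m : Mem) (r : Reg) (a : ℕ) : Mem :=
  { m with reg := Function.update m.reg r a }

/-- Write `b` into position `ix` of the integer array `a`. -/
def Mem.setCell (m : Mem) (a : Arr) (ix b : ℕ) : Mem :=
  { m with cell := Function.update m.cell a (Function.update (m.cell a) ix b) }

/-- Write `b` into position `ix` of the array `a` of numbers. -/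
def Mem.setNum (m : Mem) (a : NumArr) (ix : ℕ) (b : WithTop ℝ) : Mem :=
  { m with num := Function.update m.num a (Function.update (m.num a) ix b) }

/-- Integer operands: a literal, a register, an array cell addressed by a register. -/
inductive Word
  | lit (a : ℕ)
  | reg (r : Reg)
  | cell (a : Arr) (ix : Reg)

/-- The value of an integer operand. -/
def Word.eval (m : Mem) : Word → ℕ
  | .lit a => a
  | .reg r => m.reg r
  | .cell a ix => m.cell a (m.reg ix)

/-- Numerical operands: `0`, `∞`, a cell, the sum of two cells. -/
inductive Num
  | zero
  | infty
  | cell (a : NumArr) (ix : Reg)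
  | sum (a : NumArr) (ix : Reg) (b : NumArr) (jx : Reg)

/-- The value of a numerical operand. -/
noncomputable def Num.eval (m : Mem) : Num → WithTop ℝ
  | .zero => 0
  | .infty => ⊤
  | .cell a ix => m.num a (m.reg ix)
  | .sum a ix b jx => m.num a (m.reg ix) + m.num b (m.reg jx)

/-- Tests: comparisons of two operands. -/
inductive Test
  | eq (p q : Word)
  | ne (p q : Word)
  | lt (p q : Word)
  | le (p q : Word)
  | numLt (p q : Num)

/-- The truth of a test. -/
def Test.holds (m : Mem) : Test → Prop
  | .eq p q => p.eval m = q.eval m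
  | .ne p q => p.eval m ≠ q.eval m
  | .lt p q => p.eval m < q.eval m
  | .le p q => p.eval m ≤ q.eval m
  | .numLt p q => p.eval m < q.eval m

/-- Names of those parts of the program whose executions are recorded: an iteration of the outer
loop and the operations on the heap. -/
inductive Label
  | outerIteration
  | heapInsert
  | heapRemoveMin
  | heapInsertOrAdjust
  deriving DecidableEq

/-- Programs. -/
inductive Com
  | skip
  /-- register assignment -/
  | mov (r : Reg) (p : Word)
  /-- assignment to an integer array cell -/
  | put (a : Arr) (ix : Reg) (p : Word)
  /-- assignment to a numerical array cell -/
  | putNum (a : NumArr) (ix : Reg) (p : Num)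
  /-- add one to a register -/
  | inc (r : Reg)
  /-- add one to an array cell -/
  | incAt (a : Arr) (ix : Reg)
  /-- subtract one from an array cell -/
  | decAt (a : Arr) (ix : Reg)
  | seq (c₁ c₂ : Com)
  | cond (b : Test) (c₁ c₂ : Com)
  | loop (b : Test) (c : Com)
  /-- run `c` and record that this happened -/
  | call (l : Label) (c : Com)

/-- `Exec c m t l m'`: started in memory `m`, the program `c` halts after exactly `t` steps in
memory `m'`, and `l` is the list, in order of time, of the recorded calls.  Every assignment, every
evaluation of a test, every call and every `skip` is one step.  The machine is deterministic. -/
inductive Exec : Com → Mem → ℕ → List Label → Mem → Prop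
  | skip (m : Mem) : Exec .skip m 1 [] m
  | mov (m : Mem) (r : Reg) (p : Word) : Exec (.mov r p) m 1 [] (m.setReg r (p.eval m))
  | put (m : Mem) (a : Arr) (ix : Reg) (p : Word) :
      Exec (.put a ix p) m 1 [] (m.setCell a (m.reg ix) (p.eval m))
  | putNum (m : Mem) (a : NumArr) (ix : Reg) (p : Num) :
      Exec (.putNum a ix p) m 1 [] (m.setNum a (m.reg ix) (p.eval m))
  | inc (m : Mem) (r : Reg) : Exec (.inc r) m 1 [] (m.setReg r (m.reg r + 1))
  | incAt (m : Mem) (a : Arr) (ix : Reg) :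
      Exec (.incAt a ix) m 1 [] (m.setCell a (m.reg ix) (m.cell a (m.reg ix) + 1))
  | decAt (m : Mem) (a : Arr) (ix : Reg) :
      Exec (.decAt a ix) m 1 [] (m.setCell a (m.reg ix) (m.cell a (m.reg ix) - 1))
  | seq {c₁ c₂ : Com} {m m₁ m₂ : Mem} {t₁ t₂ : ℕ} {l₁ l₂ : List Label}
      (h₁ : Exec c₁ m t₁ l₁ m₁) (h₂ : Exec c₂ m₁ t₂ l₂ m₂) :
      Exec (.seq c₁ c₂) m (t₁ + t₂) (l₁ ++ l₂) m₂
  | condTrue {b : Test} {c₁ c₂ : Com} {m m₁ : Mem} {t : ℕ} {l : List Label}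
      (hb : b.holds m) (h : Exec c₁ m t l m₁) : Exec (.cond b c₁ c₂) m (1 + t) l m₁
  | condFalse {b : Test} {c₁ c₂ : Com} {m m₁ : Mem} {t : ℕ} {l : List Label}
      (hb : ¬ b.holds m) (h : Exec c₂ m t l m₁) : Exec (.cond b c₁ c₂) m (1 + t) l m₁
  | loopFalse {b : Test} {c : Com} {m : Mem} (hb : ¬ b.holds m) : Exec (.loop b c) m 1 [] m
  | loopTrue {b : Test} {c : Com} {m m₁ m₂ : Mem} {t₁ t₂ : ℕ} {l₁ l₂ : List Label}
      (hb : b.holds m) (h₁ : Exec c m t₁ l₁ m₁) (h₂ : Exec (.loop b c) m₁ t₂ l₂ m₂) :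
      Exec (.loop b c) m (1 + t₁ + t₂) (l₁ ++ l₂) m₂
  | call {k : Label} {c : Com} {m m₁ : Mem} {t : ℕ} {l : List Label}
      (h : Exec c m t l m₁) : Exec (.call k c) m (1 + t) (k :: l) m₁

infixr:60 ";;" => Com.seq

open Com

/-! ### Fibonacci heaps

A Fibonacci heap is a list of heap-ordered trees whose nodes are vertices.  The siblings below a
node form a doubly linked list that starts at the entry of `child`, the roots a list linked by
`nxt` that starts at `roots`; `hmin` is a root of minimum key.  The null pointer is `n`, which is
not a vertex. -/

/-- Put node `r` in front of the list of roots. -/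
def pushRoot (r : Reg) : Com :=
  put .parent r (.reg .n) ;;
  put .mark r (.lit 0) ;;
  put .nxt r (.reg .roots) ;;
  mov .roots (.reg r)

/-- Let `hmin` point to root `r` if the heap has no minimum yet or `r` has a smaller key. -/
def updateMin (r : Reg) : Com :=
  cond (.eq (.reg .hmin) (.reg .n))
    (mov .hmin (.reg r))
    (cond (.numLt (.cell .key r) (.cell .key .hmin)) (mov .hmin (.reg r)) skip)

/-- Insert vertex `v` with key `D[v]` as a new root. -/
def insertNode : Com :=
  put .inH .v (.lit 1) ;;
  putNum .key .v (.cell .D .v) ;;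
  put .child .v (.reg .n) ;;
  put .deg .v (.lit 0) ;;
  pushRoot .v ;;
  updateMin .v

/-- Make the root `y` a child of the root `x`. -/
def link : Com :=
  mov .c (.cell .child .x) ;;
  put .parent .y (.reg .x) ;;
  put .mark .y (.lit 0) ;;
  put .prv .y (.reg .n) ;;
  put .nxt .y (.reg .c) ;;
  cond (.ne (.reg .c) (.reg .n)) (put .prv .c (.reg .y)) skip ;;
  put .child .x (.reg .y) ;;
  incAt .deg .x

/-- Cut `x` off its parent `y` and make it a root. -/
def cut : Com :=
  mov .nx (.cell .nxt .x) ;;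
  mov .pv (.cell .prv .x) ;;
  cond (.eq (.reg .pv) (.reg .n))
    (put .child .y (.reg .nx))
    (put .nxt .pv (.reg .nx)) ;;
  cond (.ne (.reg .nx) (.reg .n)) (put .prv .nx (.reg .pv)) skip ;;
  decAt .deg .y ;;
  pushRoot .x

/-- Lower the key of the heap node `v` to `D[v]`, with cascading cuts: as soon as a node that is
not a root has lost a second child, it is cut as well. -/
def decreaseKey : Com :=
  putNum .key .v (.cell .D .v) ;;
  mov .x (.reg .v) ;;
  mov .y (.cell .parent .x) ;;
  mov .go (.lit 0) ;;
  cond (.ne (.reg .y) (.reg .n))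
    (cond (.numLt (.cell .key .x) (.cell .key .y)) (mov .go (.lit 1)) skip)
    skip ;;
  loop (.ne (.reg .go) (.lit 0))
    (cut ;;
     mov .x (.reg .y) ;;
     mov .y (.cell .parent .x) ;;
     cond (.eq (.reg .y) (.reg .n))
       (mov .go (.lit 0))
       (cond (.eq (.cell .mark .x) (.lit 0))
         (put .mark .x (.lit 1) ;; mov .go (.lit 0))
         skip)) ;;
  updateMin .v

/-- Turn the children of node `v` into roots. -/
def promoteChildren : Com :=
  mov .x (.cell .child .v) ;;
  loop (.ne (.reg .x) (.reg .n))
    (mov .nx (.cell .nxt .x) ;;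
     pushRoot .x ;;
     mov .x (.reg .nx))

/-- Enter the tree with root `x` into `table`, linking it with trees of equal degree until its
degree is new. -/
def enterTable : Com :=
  mov .d (.cell .deg .x) ;;
  loop (.ne (.cell .table .d) (.reg .n))
    (mov .y (.cell .table .d) ;;
     put .table .d (.reg .n) ;;
     cond (.numLt (.cell .key .y) (.cell .key .x))
       (mov .c (.reg .x) ;; mov .x (.reg .y) ;; mov .y (.reg .c))
       skip ;;
     link ;;
     inc .d) ;;
  put .table .d (.reg .x) ;;
  cond (.lt (.reg .maxDeg) (.reg .d)) (mov .maxDeg (.reg .d)) skip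

/-- Take all roots except `v` into `table`. -/
def consolidate : Com :=
  mov .maxDeg (.lit 0) ;;
  mov .x (.reg .roots) ;;
  loop (.ne (.reg .x) (.reg .n))
    (mov .nx (.cell .nxt .x) ;;
     cond (.ne (.reg .x) (.reg .v)) enterTable skip ;;
     mov .x (.reg .nx))

/-- Empty `table`, making its trees the new list of roots, and find the new minimum. -/
def rebuildRoots : Com :=
  mov .roots (.reg .n) ;;
  mov .hmin (.reg .n) ;;
  mov .d (.lit 0) ;;
  loop (.le (.reg .d) (.reg .maxDeg))
    (mov .x (.cell .table .d) ;;
     cond (.ne (.reg .x) (.reg .n))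
       (put .table .d (.reg .n) ;; pushRoot .x ;; updateMin .x)
       skip ;;
     inc .d)

/-- `v := H.removeMin()`. -/
def heapRemoveMin : Com :=
  call .heapRemoveMin
    (mov .v (.reg .hmin) ;;
     promoteChildren ;;
     consolidate ;;
     rebuildRoots ;;
     put .inH .v (.lit 0))

/-- `H.insert(v, D[v])`. -/
def heapInsert : Com :=
  call .heapInsert insertNode

/-- `H.insertOrAdjust(v, D[v])`. -/
def heapInsertOrAdjust : Com :=
  call .heapInsertOrAdjust (cond (.eq (.cell .inH .v) (.lit 0)) insertNode decreaseKey)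

/-! ### The algorithm -/

/-- `R.insert(r)`, at the tail. -/
def insertR (r : Reg) : Com := put .R .rTail (.reg r) ;; inc .rTail

/-- `Q.insert(r)`, at the tail. -/
def insertQ (r : Reg) : Com := put .Q .qTail (.reg r) ;; inc .qTail ;; put .inQ r (.lit 1)

/-- Initial values: `D[i] = ∞`, `fixed[i] = false`, `pred[i]` is the in-degree of `i`, and `R`, `Q`
and the heap are empty. -/
def setup : Com :=
  mov .i (.lit 0) ;;
  loop (.lt (.reg .i) (.reg .n))
    (putNum .D .i .infty ;;
     put .fixed .i (.lit 0) ;;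
     put .pred .i (.lit 0) ;;
     put .inQ .i (.lit 0) ;;
     put .inH .i (.lit 0) ;;
     put .table .i (.reg .n) ;;
     inc .i) ;;
  mov .i (.lit 0) ;;
  loop (.lt (.reg .i) (.reg .n))
    (mov .j (.cell .first .i) ;;
     mov .fin (.cell .last .i) ;;
     loop (.lt (.reg .j) (.reg .fin))
       (mov .k (.cell .tgt .j) ;;
        incAt .pred .k ;;
        inc .j) ;;
     inc .i) ;;
  mov .hmin (.reg .n) ;;
  mov .roots (.reg .n)

/-- `processEdge1(z, k)` for the edge `(z, k)` at position `j`. -/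
def processEdge : Com :=
  mov .changed (.lit 0) ;;
  decAt .pred .k ;;
  cond (.numLt (.sum .D .z .wt .j) (.cell .D .k))
    (putNum .D .k (.sum .D .z .wt .j) ;; mov .changed (.lit 1))
    skip ;;
  cond (.eq (.cell .pred .k) (.lit 0))
    (put .fixed .k (.lit 1) ;; insertR .k)
    (cond (.ne (.reg .changed) (.lit 0))
      (cond (.eq (.cell .inQ .k) (.lit 0)) (insertQ .k) skip)
      skip)

/-- The inner loop: explore the vertices in `R` until `R` is empty. -/
def exploreR : Com :=
  loop (.lt (.reg .rHead) (.reg .rTail))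
    (mov .z (.cell .R .rHead) ;;
     inc .rHead ;;
     mov .j (.cell .first .z) ;;
     mov .fin (.cell .last .z) ;;
     loop (.lt (.reg .j) (.reg .fin))
       (mov .k (.cell .tgt .j) ;;
        cond (.eq (.cell .fixed .k) (.lit 0)) processEdge skip ;;
        inc .j))

/-- Empty `Q`, handing its non-fixed vertices to the heap. -/
def flushQ : Com :=
  loop (.lt (.reg .qHead) (.reg .qTail))
    (mov .v (.cell .Q .qHead) ;;
     inc .qHead ;;
     put .inQ .v (.lit 0) ;;
     cond (.eq (.cell .fixed .v) (.lit 0)) heapInsertOrAdjust skip)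

/-- The body of the outer loop. -/
def outerIteration : Com :=
  call .outerIteration
    (heapRemoveMin ;;
     cond (.eq (.cell .fixed .v) (.lit 0))
       (mov .rHead (.lit 0) ;;
        mov .rTail (.lit 0) ;;
        mov .qHead (.lit 0) ;;
        mov .qTail (.lit 0) ;;
        insertR .v ;;
        put .fixed .v (.lit 1) ;;
        exploreR ;;
        flushQ)
       skip)

/-- The algorithm `SP₁` with a Fibonacci heap.  The heap is empty iff `hmin` is null. -/
def SP₁ : Com :=
  setup ;;
  putNum .D .src .zero ;;
  mov .v (.reg .src) ;;
  heapInsert ;;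
  loop (.ne (.reg .hmin) (.reg .n)) outerIteration

/-! ### The input -/

/-- The memory `m` holds, as input, the weighted digraph `(G, w)` and the source `s`: for every
vertex `u`, the positions `first u, …, last u - 1` of `tgt` list every out-neighbour of `u` exactly
once, in any order, and `wt` holds the weights of these edges.  All other contents of the memory
are arbitrary. -/
structure IsInput {n : ℕ} (G : Digraph (Fin n)) (w : Fin n → Fin n → ℝ) (s : Fin n) (m : Mem) :
    Prop where
  size : m.reg .n = n
  source : m.reg .src = s
  neighbours : ∀ u : Fin n, Set.BijOn (m.cell .tgt)
    (Set.Ico (m.cell .first u) (m.cell .last u)) {k | ∃ v : Fin n, G.Adj u v ∧ k = v}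
  weight : ∀ u v : Fin n, ∀ p ∈ Set.Ico (m.cell .first u) (m.cell .last u),
    m.cell .tgt p = v → m.num .wt p = (w u v : WithTop ℝ)

/-- The number of edges. -/
noncomputable def numEdges {n : ℕ} (G : Digraph (Fin n)) : ℕ :=
  {p : Fin n × Fin n | G.Adj p.1 p.2}.ncard

/-- The in-degree of a vertex. -/
noncomputable def inDegree {n : ℕ} (G : Digraph (Fin n)) (v : Fin n) : ℕ :=
  {u : Fin n | G.Adj u v}.ncard

/-- There is no directed cycle. -/
def IsAcyclic {n : ℕ} (G : Digraph (Fin n)) : Prop :=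
  ∀ v : Fin n, ¬ Relation.TransGen G.Adj v v

end SP

/-!
Time is paid for by credits.  A heap holds a constant number of credits for every root and twice as
many for every marked node, as usual for Fibonacci heaps; every vertex that has not been explored
and every edge out of it holds enough of them to pay for its exploration, and for the insertion or
decrease of a key that may result.  Since a root with `d` children has at least `fib (d + 2)`
descendants, a removal of the minimum needs `O(log n)` further credits.  It is executed at most `n`
times: no vertex returns to the heap once it has been removed from it, because it is fixed then.

Between two iterations, `pred k` counts the edges into the vertex `k`, not fixed yet, from vertices
that have not been fixed either, and it is positive unless `k` has no predecessors at all.  So if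
only `s` has in-degree zero, then each of the vertices that remain after the first iteration has a
predecessor among them, and the graph contains a cycle unless none remain.
-/

namespace SP

open Com Function

/-! ### Reading the memory -/

section Reading

variable (m : Mem)

@[simp] theorem Mem.setReg_reg (r r' : Reg) (a : ℕ) :
    (m.setReg r a).reg r' = if r' = r then a else m.reg r' :=
  update_apply ..

@[simp] theorem Mem.setReg_cell (r : Reg) (a : ℕ) : (m.setReg r a).cell = m.cell := rfl

@[simp] theorem Mem.setReg_num (r : Reg) (a : ℕ) : (m.setReg r a).num = m.num := rfl

@[simp] theorem Mem.setCell_reg (a : Arr) (ix b : ℕ) : (m.setCell a ix b).reg = m.reg := rfl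

@[simp] theorem Mem.setCell_cell (a a' : Arr) (ix b : ℕ) :
    (m.setCell a ix b).cell a' = if a' = a then update (m.cell a) ix b else m.cell a' :=
  update_apply ..

@[simp] theorem Mem.setCell_num (a : Arr) (ix b : ℕ) : (m.setCell a ix b).num = m.num := rfl

@[simp] theorem Mem.setNum_reg (a : NumArr) (ix : ℕ) (b : WithTop ℝ) :
    (m.setNum a ix b).reg = m.reg := rfl

@[simp] theorem Mem.setNum_cell (a : NumArr) (ix : ℕ) (b : WithTop ℝ) :
    (m.setNum a ix b).cell = m.cell := rfl

@[simp] theorem Mem.setNum_num (a a' : NumArr) (ix : ℕ) (b : WithTop ℝ) :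
    (m.setNum a ix b).num a' = if a' = a then update (m.num a) ix b else m.num a' :=
  update_apply ..

theorem Mem.setReg_self (r : Reg) : m.setReg r (m.reg r) = m := by
  simp only [Mem.setReg, update_eq_self]

end Reading

attribute [simp] Word.eval Num.eval Test.holds

/-! ### Frame conditions -/

/-- Does the program contain an assignment to register `r`? -/
def Com.setsReg (r : Reg) : Com → Bool
  | .mov r' _ => r = r'
  | .inc r' => r = r'
  | .seq c₁ c₂ => c₁.setsReg r || c₂.setsReg r
  | .cond _ c₁ c₂ => c₁.setsReg r || c₂.setsReg r
  | .loop _ c => c.setsReg r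
  | .call _ c => c.setsReg r
  | _ => false

/-- Does the program contain an assignment to the integer array `a`? -/
def Com.setsArr (a : Arr) : Com → Bool
  | .put a' _ _ => a = a'
  | .incAt a' _ => a = a'
  | .decAt a' _ => a = a'
  | .seq c₁ c₂ => c₁.setsArr a || c₂.setsArr a
  | .cond _ c₁ c₂ => c₁.setsArr a || c₂.setsArr a
  | .loop _ c => c.setsArr a
  | .call _ c => c.setsArr a
  | _ => false

/-- Does the program contain an assignment to the array `a` of numbers? -/
def Com.setsNum (a : NumArr) : Com → Bool
  | .putNum a' _ _ => a = a'
  | .seq c₁ c₂ => c₁.setsNum a || c₂.setsNum a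
  | .cond _ c₁ c₂ => c₁.setsNum a || c₂.setsNum a
  | .loop _ c => c.setsNum a
  | .call _ c => c.setsNum a
  | _ => false

/-- Does the program contain a recorded call? -/
def Com.hasCall : Com → Bool
  | .seq c₁ c₂ => c₁.hasCall || c₂.hasCall
  | .cond _ c₁ c₂ => c₁.hasCall || c₂.hasCall
  | .loop _ c => c.hasCall
  | .call _ _ => true
  | _ => false

section Frame

variable {c : Com} {m m' : Mem} {t : ℕ} {l : List Label}

theorem Exec.reg_eq (h : Exec c m t l m') {r : Reg} (hr : c.setsReg r = false) :
    m'.reg r = m.reg r := by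
  induction h <;> simp_all [Com.setsReg]

theorem Exec.cell_eq (h : Exec c m t l m') {a : Arr} (ha : c.setsArr a = false) :
    m'.cell a = m.cell a := by
  induction h <;> simp_all [Com.setsArr]

theorem Exec.num_eq (h : Exec c m t l m') {a : NumArr} (ha : c.setsNum a = false) :
    m'.num a = m.num a := by
  induction h <;> simp_all [Com.setsNum]

theorem Exec.labels_eq_nil (h : Exec c m t l m') (hc : c.hasCall = false) : l = [] := by
  induction h <;> simp_all [Com.hasCall]

end Frame

/-! ### Total correctness with running time -/

/-- Total correctness: started in `m`, the program halts after `t` steps, with recorded calls `l`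
and in a memory `m'` such that `Q t l m'`. -/
def Halts (c : Com) (m : Mem) (Q : ℕ → List Label → Mem → Prop) : Prop :=
  ∃ t l m', Exec c m t l m' ∧ Q t l m'

section Halts

variable {c c₁ c₂ : Com} {m : Mem} {b : Test} {P Q : ℕ → List Label → Mem → Prop}

theorem Halts.mono (h : Halts c m P) (hPQ : ∀ t l m', Exec c m t l m' → P t l m' → Q t l m') :
    Halts c m Q := by
  obtain ⟨t, l, m', exec, post⟩ := h
  exact ⟨t, l, m', exec, hPQ t l m' exec post⟩

@[simp] theorem halts_skip : Halts skip m Q ↔ Q 1 [] m :=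
  ⟨by rintro ⟨_, _, _, ⟨⟩, h⟩; exact h, fun h => ⟨_, _, _, .skip m, h⟩⟩

@[simp] theorem halts_mov {r : Reg} {p : Word} :
    Halts (mov r p) m Q ↔ Q 1 [] (m.setReg r (p.eval m)) :=
  ⟨by rintro ⟨_, _, _, ⟨⟩, h⟩; exact h, fun h => ⟨_, _, _, .mov m r p, h⟩⟩

@[simp] theorem halts_put {a : Arr} {ix : Reg} {p : Word} :
    Halts (put a ix p) m Q ↔ Q 1 [] (m.setCell a (m.reg ix) (p.eval m)) :=
  ⟨by rintro ⟨_, _, _, ⟨⟩, h⟩; exact h, fun h => ⟨_, _, _, .put m a ix p, h⟩⟩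

@[simp] theorem halts_putNum {a : NumArr} {ix : Reg} {p : Num} :
    Halts (putNum a ix p) m Q ↔ Q 1 [] (m.setNum a (m.reg ix) (p.eval m)) :=
  ⟨by rintro ⟨_, _, _, ⟨⟩, h⟩; exact h, fun h => ⟨_, _, _, .putNum m a ix p, h⟩⟩

@[simp] theorem halts_inc {r : Reg} : Halts (inc r) m Q ↔ Q 1 [] (m.setReg r (m.reg r + 1)) :=
  ⟨by rintro ⟨_, _, _, ⟨⟩, h⟩; exact h, fun h => ⟨_, _, _, .inc m r, h⟩⟩

@[simp] theorem halts_incAt {a : Arr} {ix : Reg} :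
    Halts (incAt a ix) m Q ↔ Q 1 [] (m.setCell a (m.reg ix) (m.cell a (m.reg ix) + 1)) :=
  ⟨by rintro ⟨_, _, _, ⟨⟩, h⟩; exact h, fun h => ⟨_, _, _, .incAt m a ix, h⟩⟩

@[simp] theorem halts_decAt {a : Arr} {ix : Reg} :
    Halts (decAt a ix) m Q ↔ Q 1 [] (m.setCell a (m.reg ix) (m.cell a (m.reg ix) - 1)) :=
  ⟨by rintro ⟨_, _, _, ⟨⟩, h⟩; exact h, fun h => ⟨_, _, _, .decAt m a ix, h⟩⟩

@[simp] theorem halts_seq :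
    Halts (c₁ ;; c₂) m Q ↔
      Halts c₁ m fun t₁ l₁ m₁ => Halts c₂ m₁ fun t₂ l₂ m₂ => Q (t₁ + t₂) (l₁ ++ l₂) m₂ := by
  constructor
  · rintro ⟨_, _, _, exec, h⟩
    cases exec with
    | seq exec₁ exec₂ => exact ⟨_, _, _, exec₁, _, _, _, exec₂, h⟩
  · rintro ⟨_, _, _, exec₁, _, _, _, exec₂, h⟩
    exact ⟨_, _, _, .seq exec₁ exec₂, h⟩

open scoped Classical in
@[simp] theorem halts_cond :
    Halts (cond b c₁ c₂) m Q ↔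
      if b.holds m then Halts c₁ m fun t l m' => Q (1 + t) l m'
      else Halts c₂ m fun t l m' => Q (1 + t) l m' := by
  split_ifs with hb
  · constructor
    · rintro ⟨_, _, _, exec, h⟩
      cases exec with
      | condTrue _ exec => exact ⟨_, _, _, exec, h⟩
      | condFalse hb' => exact absurd hb hb'
    · rintro ⟨_, _, _, exec, h⟩
      exact ⟨_, _, _, .condTrue hb exec, h⟩
  · constructor
    · rintro ⟨_, _, _, exec, h⟩
      cases exec with
      | condTrue hb' => exact absurd hb' hb
      | condFalse _ exec => exact ⟨_, _, _, exec, h⟩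
    · rintro ⟨_, _, _, exec, h⟩
      exact ⟨_, _, _, .condFalse hb exec, h⟩

@[simp] theorem halts_call {k : Label} :
    Halts (call k c) m Q ↔ Halts c m fun t l m' => Q (1 + t) (k :: l) m' := by
  constructor
  · rintro ⟨_, _, _, exec, h⟩
    cases exec with
    | call exec => exact ⟨_, _, _, exec, h⟩
  · rintro ⟨_, _, _, exec, h⟩
    exact ⟨_, _, _, .call exec, h⟩

theorem halts_loop_of_not (hb : ¬ b.holds m) (h : Q 1 [] m) : Halts (loop b c) m Q :=
  ⟨_, _, _, .loopFalse hb, h⟩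

theorem halts_loop_of (hb : b.holds m)
    (h : Halts c m fun t₁ l₁ m₁ =>
      Halts (loop b c) m₁ fun t₂ l₂ m₂ => Q (1 + t₁ + t₂) (l₁ ++ l₂) m₂) :
    Halts (loop b c) m Q := by
  obtain ⟨_, _, _, exec₁, _, _, _, exec₂, h⟩ := h
  exact ⟨_, _, _, .loopTrue hb exec₁ exec₂, h⟩

/-- In the invariant `I p l m`, the number `p` is a time credit, and `l` are the calls recorded so
far.  A loop halts, within its credit, if every iteration pays for itself. -/
theorem halts_loop_of_credit_of_labels {I : ℕ → List Label → Mem → Prop}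
    (step : ∀ p l m, I p l m → b.holds m →
      Halts c m fun t l' m' => ∃ q, I q (l ++ l') m' ∧ q + t + 1 ≤ p)
    {p : ℕ} {l : List Label} (h : I p l m) :
    Halts (loop b c) m fun t l' m' => ∃ q, I q (l ++ l') m' ∧ ¬ b.holds m' ∧ q + t ≤ p + 1 := by
  induction p using Nat.strong_induction_on generalizing m l with
  | _ p ih =>
    by_cases hb : b.holds m
    · refine halts_loop_of hb ((step p l m h hb).mono ?_)
      rintro t₁ l₁ m₁ - ⟨q₁, inv₁, paid₁⟩
      refine (ih q₁ (by omega) inv₁).mono ?_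
      rintro t₂ l₂ m₂ - ⟨q₂, inv₂, hb₂, paid₂⟩
      exact ⟨q₂, List.append_assoc .. ▸ inv₂, hb₂, by omega⟩
    · exact halts_loop_of_not hb ⟨p, (List.append_nil l).symm ▸ h, hb, le_rfl⟩

theorem halts_loop_of_credit {I : ℕ → Mem → Prop}
    (step : ∀ p m, I p m → b.holds m → Halts c m fun t _ m' => ∃ q, I q m' ∧ q + t + 1 ≤ p)
    {p : ℕ} (h : I p m) :
    Halts (loop b c) m fun t _ m' => ∃ q, I q m' ∧ ¬ b.holds m' ∧ q + t ≤ p + 1 :=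
  halts_loop_of_credit_of_labels (I := fun p _ m => I p m) (l := []) (fun p _ m => step p m) h

end Halts

/-! ### Linked lists -/

/-- The pointers `nxt`, followed from `a` up to `b`, visit the list. -/
def Chain (nxt : ℕ → ℕ) : ℕ → List ℕ → ℕ → Prop
  | a, [], b => a = b
  | a, c :: L, b => a = c ∧ Chain nxt (nxt c) L b

/-- The pointers `prv` lead from every entry of the list to the one before it, and from the first
entry to `p`. -/
def BackChain (prv : ℕ → ℕ) : ℕ → List ℕ → Prop
  | _, [] => True
  | p, c :: L => prv c = p ∧ BackChain prv c L

section LinkedLists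

variable {n a b p r x : ℕ} {nxt nxt' prv prv' : ℕ → ℕ} {L L₁ L₂ : List ℕ}

@[simp] theorem chain_nil : Chain nxt a [] b ↔ a = b := Iff.rfl

@[simp] theorem chain_cons : Chain nxt a (x :: L) b ↔ a = x ∧ Chain nxt (nxt x) L b := Iff.rfl

@[simp] theorem backChain_nil : BackChain prv p [] := trivial

@[simp] theorem backChain_cons : BackChain prv p (x :: L) ↔ prv x = p ∧ BackChain prv x L := Iff.rfl

theorem Chain.congr (h : Chain nxt a L b) (hnxt : ∀ c ∈ L, nxt' c = nxt c) :
    Chain nxt' a L b := by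
  induction L generalizing a with
  | nil => exact h
  | cons c L ih =>
    rw [List.forall_mem_cons] at hnxt
    exact ⟨h.1, hnxt.1 ▸ ih h.2 hnxt.2⟩

theorem BackChain.congr (h : BackChain prv p L) (hprv : ∀ c ∈ L, prv' c = prv c) :
    BackChain prv' p L := by
  induction L generalizing p with
  | nil => trivial
  | cons c L ih =>
    rw [List.forall_mem_cons] at hprv
    exact ⟨hprv.1.trans h.1, ih h.2 hprv.2⟩

theorem chain_append_cons :
    Chain nxt a (L₁ ++ x :: L₂) b ↔ Chain nxt a L₁ x ∧ Chain nxt (nxt x) L₂ b := by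
  induction L₁ generalizing a with
  | nil => rfl
  | cons c L₁ ih => simp only [List.cons_append, chain_cons, ih, and_assoc]

theorem backChain_append : BackChain prv p (L₁ ++ L₂) ↔
    BackChain prv p L₁ ∧ BackChain prv (L₁.getLastD p) L₂ := by
  induction L₁ generalizing p with
  | nil => simp only [List.nil_append, backChain_nil, List.getLastD_nil, true_and]
  | cons c L₁ ih => simp only [List.cons_append, backChain_cons, ih, List.getLastD_cons, and_assoc]

theorem Chain.append (h₁ : Chain nxt a L₁ r) (h₂ : Chain nxt r L₂ b) :
    Chain nxt a (L₁ ++ L₂) b := by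
  induction L₁ generalizing a with
  | nil => obtain rfl : a = r := h₁; exact h₂
  | cons c L₁ ih => exact ⟨h₁.1, ih h₁.2⟩

theorem Chain.eq_or_mem (h : Chain nxt a L b) : a = b ∨ a ∈ L := by
  cases L with
  | nil => exact .inl h
  | cons c L => exact .inr (h.1 ▸ List.mem_cons_self)

theorem Chain.eq_iff_eq_nil (h : Chain nxt a L b) (hb : b ∉ L) : a = b ↔ L = [] := by
  cases L with
  | nil => simpa using h
  | cons c L =>
    obtain ⟨rfl, -⟩ := h
    simp only [reduceCtorEq, iff_false]
    exact fun hab => hb (hab ▸ List.mem_cons_self)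

theorem getLastD_mem (hL : L ≠ []) : L.getLastD p ∈ L := by
  rw [List.getLastD_eq_getLast?, List.getLast?_eq_some_getLast hL]
  exact List.getLast_mem hL

theorem Chain.redirect_last (h : Chain nxt a L r) (hL : L ≠ []) (hd : L.Nodup) :
    Chain (update nxt (L.getLastD p) b) a L b := by
  induction L generalizing a p with
  | nil => contradiction
  | cons c L ih =>
    rw [List.nodup_cons] at hd
    rcases eq_or_ne L [] with rfl | hL
    · exact ⟨h.1, update_self ..⟩
    · have hc : c ≠ L.getLastD c := fun hc => hd.1 (by rw [hc]; exact getLastD_mem hL)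
      rw [List.getLastD_cons]
      exact ⟨h.1, by rw [update_of_ne hc]; exact ih h.2 hL hd.2⟩

theorem BackChain.redirect_first (h : BackChain prv r L) (hd : L.Nodup) (ha : L.head? = some a) :
    BackChain (update prv a p) p L := by
  cases L with
  | nil => trivial
  | cons c L =>
    obtain rfl : c = a := by simpa using ha
    rw [List.nodup_cons] at hd
    exact ⟨update_self .., h.2.congr fun e he => update_of_ne (ne_of_mem_of_not_mem he hd.1) ..⟩

section Removal

variable (hc : Chain nxt a (L₁ ++ x :: L₂) n) (hb : BackChain prv n (L₁ ++ x :: L₂))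
  (hn : n ∉ L₁ ++ x :: L₂) (hd : (L₁ ++ x :: L₂).Nodup)

include hb hn in
theorem BackChain.prv_eq_iff : prv x = n ↔ L₁ = [] := by
  rw [(backChain_append.1 hb).2.1]
  refine ⟨fun h => by_contra fun hL => hn ?_, fun h => h ▸ rfl⟩
  exact List.mem_append_left _ (h ▸ getLastD_mem hL)

include hb in
theorem BackChain.prv_eq_or_mem : prv x = n ∨ prv x ∈ L₁ := by
  rw [(backChain_append.1 hb).2.1]
  exact (eq_or_ne L₁ []).imp (by rintro rfl; rfl) getLastD_mem

include hc hb hn hd in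
theorem Chain.remove : Chain (if prv x = n then nxt else update nxt (prv x) (nxt x))
    (if prv x = n then nxt x else a) (L₁ ++ L₂) n := by
  obtain ⟨chain₁, chain₂⟩ := chain_append_cons.1 hc
  split_ifs with hx
  · rw [(hb.prv_eq_iff hn).1 hx]
    exact chain₂
  · have hL : L₁ ≠ [] := (hb.prv_eq_iff hn).not.1 hx
    obtain ⟨nodup₁, -, disjoint⟩ := List.nodup_append'.1 hd
    rw [(backChain_append.1 hb).2.1]
    refine (chain₁.redirect_last hL nodup₁).append (chain₂.congr fun c hc₂ => update_of_ne ?_ ..)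
    rintro rfl
    exact disjoint (getLastD_mem hL) (List.mem_cons_of_mem _ hc₂)

include hc hb hn hd in
theorem Chain.remove_prev :
    BackChain (if nxt x ≠ n then update prv (nxt x) (prv x) else prv) n (L₁ ++ L₂) := by
  obtain ⟨-, chain₂⟩ := chain_append_cons.1 hc
  obtain ⟨back₁, hprv, back₂⟩ := backChain_append.1 hb
  obtain ⟨-, nodup₂, disjoint⟩ := List.nodup_append'.1 hd
  have hn₂ : n ∉ L₂ := fun h => hn (by simp [h])
  refine backChain_append.2 ?_
  split_ifs with hx
  · have hmem : nxt x ∈ L₂ := chain₂.eq_or_mem.resolve_left hx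
    rw [← hprv]
    refine ⟨back₁.congr fun c hc₁ => update_of_ne ?_ .., back₂.redirect_first nodup₂.of_cons ?_⟩
    · rintro rfl
      exact disjoint hc₁ (List.mem_cons_of_mem _ hmem)
    · cases L₂ with
      | nil => contradiction
      | cons c L₂ => rw [chain₂.1, List.head?_cons]
  · rw [(chain₂.eq_iff_eq_nil hn₂).1 (not_not.1 hx)]
    exact ⟨back₁, trivial⟩

end Removal

end LinkedLists

/-! ### Forests in memory -/

/-- The arrays that make up the nodes of a Fibonacci heap: parent, first child, next and previous
sibling, number of children, mark bit and key. -/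
structure Links where
  par : ℕ → ℕ
  chd : ℕ → ℕ
  nxt : ℕ → ℕ
  prv : ℕ → ℕ
  deg : ℕ → ℕ
  mrk : ℕ → ℕ
  key : ℕ → WithTop ℝ

/-- The heap nodes in the memory. -/
@[simps] def Mem.links (m : Mem) : Links :=
  ⟨m.cell .parent, m.cell .child, m.cell .nxt, m.cell .prv, m.cell .deg, m.cell .mark, m.num .key⟩

/-- The nodes in `S` whose parent is not in `S`. -/
def Links.roots (H : Links) (S : Finset ℕ) : Finset ℕ := S.filter (H.par · ∉ S)

@[simp] theorem Links.mem_roots {H : Links} {S : Finset ℕ} {x : ℕ} :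
    x ∈ H.roots S ↔ x ∈ S ∧ H.par x ∉ S :=
  Finset.mem_filter

/-- The heap nodes after `v` has become a node without parent and children, with key `k`, in front
of the list of roots that starts at `a`. -/
@[simps] def Links.addNode (H : Links) (n v a : ℕ) (k : WithTop ℝ) : Links where
  par := update H.par v n
  chd := update H.chd v n
  nxt := update H.nxt v a
  prv := H.prv
  deg := update H.deg v 0
  mrk := update H.mrk v 0
  key := update H.key v k

/-- The heap nodes after `x` has been put in front of the list of roots that starts at `a`. -/
@[simps] def Links.pushRoot (H : Links) (n x a : ℕ) : Links :=
  { H with par := update H.par x n, nxt := update H.nxt x a, mrk := update H.mrk x 0 }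

/-- The heap nodes after `y` has become the latest child of `x`. -/
@[simps] def Links.link (H : Links) (n x y : ℕ) : Links where
  par := update H.par y x
  chd := update H.chd x y
  nxt := update H.nxt y (H.chd x)
  prv := if H.chd x ≠ n then update (update H.prv y n) (H.chd x) y else update H.prv y n
  deg := update H.deg x (H.deg x + 1)
  mrk := update H.mrk y 0
  key := H.key

/-- The heap nodes after `x` has been removed from the children of its parent and put in front of
the list of roots that starts at `a`. -/
@[simps] def Links.cut (H : Links) (n x a : ℕ) : Links where
  par := update H.par x n
  chd := if H.prv x = n then update H.chd (H.par x) (H.nxt x) else H.chd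
  nxt := update (if H.prv x = n then H.nxt else update H.nxt (H.prv x) (H.nxt x)) x a
  prv := if H.nxt x ≠ n then update H.prv (H.nxt x) (H.prv x) else H.prv
  deg := update H.deg (H.par x) (H.deg (H.par x) - 1)
  mrk := update H.mrk x 0
  key := H.key

/-- The heap nodes after `x` has been marked. -/
@[simps] def Links.setMark (H : Links) (x : ℕ) : Links :=
  { H with mrk := update H.mrk x 1 }

/-- The heap nodes after `x` has got the key `k`. -/
@[simps] def Links.setKey (H : Links) (x : ℕ) (k : WithTop ℝ) : Links :=
  { H with key := update H.key x k }

/-- On the nodes `S`, the arrays form a forest in which `ch x` lists the children of `x`, latest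
first.  The null pointer is `n`, and the roots are the nodes whose parent is not in `S`. -/
structure IsForest (n : ℕ) (S : Finset ℕ) (H : Links) (ch : ℕ → List ℕ) : Prop where
  lt : ∀ x ∈ S, x < n
  nodup : ∀ x ∈ S, (ch x).Nodup
  next : ∀ x ∈ S, Chain H.nxt (H.chd x) (ch x) n
  prev : ∀ x ∈ S, BackChain H.prv n (ch x)
  mem : ∀ x ∈ S, ∀ c, c ∈ ch x ↔ c ∈ S ∧ H.par c = x
  deg : ∀ x ∈ S, H.deg x = (ch x).length
  rank : ∃ h : ℕ → ℕ, ∀ c ∈ S, H.par c ∈ S → h c < h (H.par c)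

namespace IsForest

variable {n : ℕ} {S : Finset ℕ} {H H' : Links} {ch ch' : ℕ → List ℕ} {a c v x y z : ℕ}

theorem notMem (F : IsForest n S H ch) : n ∉ S := fun h => (F.lt n h).false

theorem par_ne (F : IsForest n S H ch) (hx : x ∈ S) : H.par x ≠ x := by
  obtain ⟨h, hh⟩ := F.rank
  intro hp
  have := hh x hx (by rwa [hp])
  rw [hp] at this
  exact this.false

theorem notMem_children (F : IsForest n S H ch) (hz : z ∈ S) (hx : H.par x ∉ S) : x ∉ ch z :=
  fun h => hx (((F.mem z hz x).1 h).2 ▸ hz)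

theorem null_notMem_children (F : IsForest n S H ch) (hz : z ∈ S) : n ∉ ch z :=
  fun h => F.notMem ((F.mem z hz n).1 h).1

theorem congr (F : IsForest n S H ch)
    (hroot : ∀ c ∈ S, H.par c ∉ S → H'.par c ∉ S)
    (hpar : ∀ c ∈ S, H.par c ∈ S → H'.par c = H.par c)
    (hnxt : ∀ c ∈ S, H.par c ∈ S → H'.nxt c = H.nxt c)
    (hprv : ∀ c ∈ S, H.par c ∈ S → H'.prv c = H.prv c)
    (hchd : ∀ x ∈ S, H'.chd x = H.chd x) (hdeg : ∀ x ∈ S, H'.deg x = H.deg x)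
    (hch : ∀ x ∈ S, ch' x = ch x) : IsForest n S H' ch' where
  lt := F.lt
  nodup x hx := hch x hx ▸ F.nodup x hx
  next x hx := by
    rw [hch x hx, hchd x hx]
    refine (F.next x hx).congr fun c hc => ?_
    obtain ⟨hcS, rfl⟩ := (F.mem x hx c).1 hc
    exact hnxt c hcS hx
  prev x hx := by
    rw [hch x hx]
    refine (F.prev x hx).congr fun c hc => ?_
    obtain ⟨hcS, rfl⟩ := (F.mem x hx c).1 hc
    exact hprv c hcS hx
  mem x hx c := by
    rw [hch x hx, F.mem x hx]
    grind
  deg x hx := by rw [hch x hx, hdeg x hx, F.deg x hx]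
  rank := F.rank.imp fun h hh c hc hp => by
    have hp' : H.par c ∈ S := by_contra fun h => hroot c hc h hp
    rw [hpar c hc hp']
    exact hh c hc hp'

theorem pushRoot (F : IsForest n S H ch) (hx : H.par x ∉ S) :
    IsForest n S (H.pushRoot n x a) ch := by
  have hne : ∀ c ∈ S, H.par c ∈ S → c ≠ x := by rintro c - hp rfl; exact hx hp
  refine F.congr (fun c _ hp => ?_) (fun c hc hp => update_of_ne (hne c hc hp) ..)
    (fun c hc hp => update_of_ne (hne c hc hp) ..) (fun _ _ _ => rfl) (fun _ _ => rfl)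
    (fun _ _ => rfl) fun _ _ => rfl
  rw [Links.pushRoot_par, update_apply]
  split_ifs
  exacts [F.notMem, hp]

theorem erase (F : IsForest n S H ch) (hv : H.par v ∉ S) : IsForest n (S.erase v) H ch where
  lt x hx := F.lt x (Finset.mem_of_mem_erase hx)
  nodup x hx := F.nodup x (Finset.mem_of_mem_erase hx)
  next x hx := F.next x (Finset.mem_of_mem_erase hx)
  prev x hx := F.prev x (Finset.mem_of_mem_erase hx)
  mem x hx c := by
    rw [F.mem x (Finset.mem_of_mem_erase hx)]
    grind
  deg x hx := F.deg x (Finset.mem_of_mem_erase hx)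
  rank := F.rank.imp fun _ hh c hc hp =>
    hh c (Finset.mem_of_mem_erase hc) (Finset.mem_of_mem_erase hp)

theorem insert (F : IsForest n S H ch) (hvn : v < n) (hchild : ∀ c ∈ S, H.par c ≠ v)
    (hpar : H.par v = n) (hchd : H.chd v = n) (hdeg : H.deg v = 0) (hch : ch v = []) :
    IsForest n (insert v S) H ch where
  lt := Finset.forall_mem_insert _ _ _ |>.2 ⟨hvn, F.lt⟩
  nodup := Finset.forall_mem_insert _ _ _ |>.2 ⟨hch ▸ List.nodup_nil, F.nodup⟩
  next := Finset.forall_mem_insert _ _ _ |>.2 ⟨by rw [hch, hchd]; rfl, F.next⟩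
  prev := Finset.forall_mem_insert _ _ _ |>.2 ⟨by rw [hch]; trivial, F.prev⟩
  mem := by
    have := F.notMem
    refine Finset.forall_mem_insert _ _ _ |>.2 ⟨?_, fun x hx c => ?_⟩
    · grind
    · rw [F.mem x hx]
      grind
  deg := Finset.forall_mem_insert _ _ _ |>.2 ⟨by rw [hch, hdeg]; rfl, F.deg⟩
  rank := F.rank.imp fun h hh c hc hp => by
    have := F.notMem
    grind

theorem addNode (F : IsForest n S H ch) {k : WithTop ℝ} (hv : v ∉ S) (hvn : v < n)
    (hchild : ∀ c ∈ S, H.par c ≠ v) :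
    IsForest n (Insert.insert v S) (H.addNode n v a k) (update ch v []) := by
  have hne : ∀ c ∈ S, c ≠ v := fun c hc => ne_of_mem_of_not_mem hc hv
  refine IsForest.insert (F.congr ?_ ?_ ?_ ?_ ?_ ?_ ?_) hvn ?_ ?_ ?_ ?_ ?_ <;>
    simp +contextual [hne, hchild]

theorem not_root_of_mem (F : IsForest n S H ch) (hz : z ∈ S) (hc : c ∈ ch z) : H.par c ∈ S :=
  ((F.mem z hz c).1 hc).2 ▸ hz

theorem notMem_children_of_ne (F : IsForest n S H ch) (hx : x ∈ S) (hz : z ∈ S) (hzx : z ≠ x)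
    (hc : c ∈ ch z) : c ∉ ch x :=
  fun hc' => hzx (((F.mem z hz c).1 hc).2.symm.trans ((F.mem x hx c).1 hc').2)

section Link

variable (F : IsForest n S H ch) (hx : x ∈ S) (hry : H.par y ∉ S) (hz : z ∈ S)

include F hx hry hz in
theorem link_next :
    Chain (H.link n x y).nxt ((H.link n x y).chd z) (update ch x (y :: ch x) z) n := by
  have hne : ∀ z ∈ S, ∀ c ∈ ch z, c ≠ y := fun z hz c hc =>
    ne_of_mem_of_not_mem hc (F.notMem_children hz hry)
  simp only [Links.link]
  rcases eq_or_ne z x with rfl | hzx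
  · rw [update_self, update_self, chain_cons, update_self]
    exact ⟨rfl, (F.next z hz).congr fun c hc => update_of_ne (hne z hz c hc) ..⟩
  · rw [update_of_ne hzx, update_of_ne hzx]
    exact (F.next z hz).congr fun c hc => update_of_ne (hne z hz c hc) ..

include F hx hry hz in
theorem link_prev : BackChain (H.link n x y).prv n (update ch x (y :: ch x) z) := by
  have hy : y ∉ ch z := F.notMem_children hz hry
  simp only [Links.link]
  rcases eq_or_ne z x with rfl | hzx
  · have back : BackChain (update H.prv y n) n (ch z) :=
      (F.prev z hz).congr fun c hc => update_of_ne (ne_of_mem_of_not_mem hc hy) ..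
    rw [update_self, backChain_cons]
    cases hL : ch z with
    | nil =>
      have hnull : H.chd z = n := by simpa [hL] using F.next z hz
      simp [hnull]
    | cons b L =>
      have hb : H.chd z = b := by have := F.next z hz; rw [hL] at this; exact this.1
      have hbn : b ≠ n := by rintro rfl; exact F.null_notMem_children hz (by simp [hL])
      rw [hL] at back hy
      rw [hb, if_pos hbn, update_of_ne (List.ne_of_not_mem_cons hy), update_self]
      exact ⟨rfl, back.redirect_first (hL ▸ F.nodup z hz) rfl⟩
  · rw [update_of_ne hzx]
    refine (F.prev z hz).congr fun c hc => ?_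
    have hcy : c ≠ y := ne_of_mem_of_not_mem hc hy
    split_ifs with hnull
    · have hcx : c ≠ H.chd x := by
        rintro rfl
        exact F.notMem_children_of_ne hx hz hzx hc ((F.next x hx).eq_or_mem.resolve_left hnull)
      rw [update_of_ne hcx, update_of_ne hcy]
    · rw [update_of_ne hcy]

end Link

theorem link (F : IsForest n S H ch) (hx : x ∈ S) (hy : y ∈ S) (hxy : x ≠ y)
    (hrx : H.par x ∉ S) (hry : H.par y ∉ S) :
    IsForest n S (H.link n x y) (update ch x (y :: ch x)) where
  lt := F.lt
  nodup z hz := by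
    rcases eq_or_ne z x with rfl | hzx
    · rw [update_self]
      exact (F.nodup z hz).cons (F.notMem_children hz hry)
    · rw [update_of_ne hzx]
      exact F.nodup z hz
  next _ hz := F.link_next hx hry hz
  prev _ hz := F.link_prev hx hry hz
  mem z hz c := by
    have := F.mem z hz c
    rw [Links.link_par, update_apply, update_apply]
    split_ifs <;> grind
  deg z hz := by
    rw [Links.link_deg, update_apply, update_apply]
    split_ifs with hzx
    · rw [List.length_cons, F.deg x hx]
    · exact F.deg z hz
  rank := by
    obtain ⟨h, hh⟩ := F.rank
    refine ⟨update h x (max (h x) (h y + 1)), fun c hc hp => ?_⟩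
    rcases eq_or_ne c y with rfl | hcy
    · simp [hxy.symm]
    · simp only [Links.link_par, update_of_ne hcy] at hp ⊢
      have hcx : c ≠ x := by rintro rfl; exact hrx hp
      have := hh c hc hp
      rw [update_of_ne hcx, update_apply]
      split_ifs with hpx
      · exact lt_max_of_lt_left (hpx ▸ this)
      · exact this

section Cut

variable {L₁ L₂ : List ℕ} (F : IsForest n S H ch) (hp : H.par x ∈ S)
  (hL : ch (H.par x) = L₁ ++ x :: L₂)

include F hp hL

theorem cut_next (hz : z ∈ S) :
    Chain (H.cut n x a).nxt ((H.cut n x a).chd z) (update ch (H.par x) (L₁ ++ L₂) z) n := by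
  have chain := F.next _ hp
  have back := F.prev _ hp
  have hd := F.nodup _ hp
  have hn := F.null_notMem_children hp
  rw [hL] at chain back hd hn
  simp only [Links.cut]
  rcases eq_or_ne z (H.par x) with rfl | hzp
  · have hx : x ∉ L₁ ++ L₂ := (List.nodup_cons.1 (List.nodup_middle.1 hd)).1
    rw [update_self, ite_apply, update_self]
    exact (chain.remove back hn hd).congr fun c hc => update_of_ne (ne_of_mem_of_not_mem hc hx) ..
  · rw [update_of_ne hzp, ite_apply, update_of_ne hzp, ite_self]
    refine (F.next z hz).congr fun c hc => ?_
    have hcL : c ∉ L₁ ++ x :: L₂ := hL ▸ F.notMem_children_of_ne hp hz hzp hc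
    rw [update_of_ne (by grind)]
    split_ifs with hprv
    · rfl
    · exact update_of_ne (ne_of_mem_of_not_mem
        (List.mem_append_left _ (back.prv_eq_or_mem.resolve_left hprv)) hcL).symm ..

theorem cut_prev (hz : z ∈ S) :
    BackChain (H.cut n x a).prv n (update ch (H.par x) (L₁ ++ L₂) z) := by
  have chain := F.next _ hp
  rw [hL] at chain
  simp only [Links.cut]
  rcases eq_or_ne z (H.par x) with rfl | hzp
  · rw [update_self]
    exact chain.remove_prev (hL ▸ F.prev _ hp) (hL ▸ F.null_notMem_children hp) (hL ▸ F.nodup _ hp)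
  · rw [update_of_ne hzp]
    refine (F.prev z hz).congr fun c hc => ?_
    have hcL : c ∉ L₁ ++ x :: L₂ := hL ▸ F.notMem_children_of_ne hp hz hzp hc
    split_ifs with hnxt
    · have := (chain_append_cons.1 chain).2.eq_or_mem.resolve_left hnxt
      rw [update_of_ne (by grind)]
    · rfl

theorem cut : IsForest n S (H.cut n x a) (update ch (H.par x) (L₁ ++ L₂)) where
  lt := F.lt
  nodup z hz := by
    have := F.nodup _ hp
    rw [update_apply]
    split_ifs
    · grind
    · exact F.nodup z hz
  next _ hz := F.cut_next hp hL hz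
  prev _ hz := F.cut_prev hp hL hz
  mem z hz c := by
    have hd := F.nodup _ hp
    have hn := F.notMem
    have := F.mem z hz c
    rw [Links.cut_par, update_apply, update_apply]
    split_ifs <;> grind
  deg z hz := by
    have := F.deg z hz
    rw [Links.cut_deg, update_apply, update_apply]
    split_ifs with hzp
    · rw [F.deg _ hp, hL, List.length_append, List.length_append, List.length_cons]
      omega
    · exact this
  rank := F.rank.imp fun h hh c hc hp' => by
    have hcx : c ≠ x := by
      rintro rfl
      exact F.notMem (by simpa using hp')
    rw [Links.cut_par, update_of_ne hcx] at hp' ⊢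
    exact hh c hc hp'

end Cut

end IsForest

/-! ### Degrees in a Fibonacci heap -/

/-- Every entry of the list `c :: L` satisfies `L.length ≤ b c`: a node with `i` older siblings has
bound at least `i`. -/
def AgeBound (b : ℕ → ℕ) : List ℕ → Prop
  | [] => True
  | c :: L => L.length ≤ b c ∧ AgeBound b L

/-- The invariant behind the degree bound.  When a node became the `i`-th child of its parent, it
had `i` children; since then it has lost at most one, and is marked if it has, except that `slack`
grants some nodes further losses. -/
structure IsBalanced (S : Finset ℕ) (H : Links) (ch : ℕ → List ℕ) (slack : ℕ → ℕ) : Prop where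
  mark : ∀ x ∈ S, H.mrk x ≤ 1
  age : ∀ x ∈ S, AgeBound (fun c => H.deg c + H.mrk c + slack c) (ch x)

/-- No node outside `O` has a smaller key than its parent. -/
def IsHeapOrdered (S : Finset ℕ) (H : Links) (O : Set ℕ) : Prop :=
  ∀ c ∈ S, c ∉ O → H.par c ∈ S → H.key (H.par c) ≤ H.key c

section AgeBound

variable {b b' : ℕ → ℕ} {L L₁ L₂ : List ℕ} {x : ℕ}

theorem AgeBound.mono (h : AgeBound b L) (hb : ∀ c ∈ L, b c ≤ b' c) : AgeBound b' L := by
  induction L with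
  | nil => trivial
  | cons c L ih =>
    rw [List.forall_mem_cons] at hb
    exact ⟨h.1.trans hb.1, ih h.2 hb.2⟩

theorem AgeBound.remove (h : AgeBound b (L₁ ++ x :: L₂)) : AgeBound b (L₁ ++ L₂) := by
  induction L₁ with
  | nil => exact h.2
  | cons c L₁ ih =>
    refine ⟨le_trans ?_ h.1, ih h.2⟩
    simp

theorem AgeBound.fib_le {d : ℕ → ℕ} (h : AgeBound (fun c => d c + 1) L) :
    Nat.fib (L.length + 2) ≤ (L.map fun c => Nat.fib (d c + 2)).sum + 1 := by
  induction L with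
  | nil => simp
  | cons c L ih =>
    have hc : Nat.fib (L.length + 1) ≤ Nat.fib (d c + 2) := Nat.fib_mono (Nat.succ_le_succ h.1)
    have := ih h.2
    have : Nat.fib (L.length + 1 + 2) = Nat.fib (L.length + 1) + Nat.fib (L.length + 2) :=
      Nat.fib_add_two
    simp only [List.length_cons, List.map_cons, List.sum_cons]
    omega

end AgeBound

section Operations

variable {n : ℕ} {S : Finset ℕ} {H : Links} {ch : ℕ → List ℕ} {slack slack' : ℕ → ℕ} {O O' : Set ℕ}
  {a c v x y : ℕ} {k : WithTop ℝ}

namespace IsBalanced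

theorem mono (B : IsBalanced S H ch slack) (F : IsForest n S H ch)
    (hslack : ∀ c ∈ S, H.par c ∈ S → slack c ≤ slack' c) : IsBalanced S H ch slack' where
  mark := B.mark
  age x hx := (B.age x hx).mono fun c hc =>
    Nat.add_le_add_left (hslack c ((F.mem x hx c).1 hc).1 (F.not_root_of_mem hx hc)) _

theorem erase (B : IsBalanced S H ch slack) : IsBalanced (S.erase v) H ch slack where
  mark x hx := B.mark x (Finset.mem_of_mem_erase hx)
  age x hx := B.age x (Finset.mem_of_mem_erase hx)

theorem addNode (B : IsBalanced S H ch slack) (F : IsForest n S H ch) (hv : v ∉ S) :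
    IsBalanced (insert v S) (H.addNode n v a k) (update ch v []) slack where
  mark := by
    refine (Finset.forall_mem_insert _ _ _).2 ⟨by simp, fun x hx => ?_⟩
    simpa only [Links.addNode_mrk, update_of_ne (ne_of_mem_of_not_mem hx hv)] using B.mark x hx
  age := by
    refine (Finset.forall_mem_insert _ _ _).2 ⟨by rw [update_self]; trivial, fun x hx => ?_⟩
    rw [update_of_ne (ne_of_mem_of_not_mem hx hv)]
    refine (B.age x hx).mono fun c hc => ?_
    have hcv : c ≠ v := ne_of_mem_of_not_mem ((F.mem x hx c).1 hc).1 hv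
    simp only [Links.addNode_deg, Links.addNode_mrk, update_of_ne hcv, le_rfl]

theorem pushRoot (B : IsBalanced S H ch slack) (F : IsForest n S H ch) (hx : H.par x ∉ S) :
    IsBalanced S (H.pushRoot n x a) ch slack where
  mark z hz := by
    rw [Links.pushRoot_mrk, update_apply]
    split_ifs
    exacts [zero_le_one, B.mark z hz]
  age z hz := (B.age z hz).mono fun c hc => by
    have hcx : c ≠ x := ne_of_mem_of_not_mem hc (F.notMem_children hz hx)
    simp only [Links.pushRoot_deg, Links.pushRoot_mrk, update_of_ne hcx, le_rfl]

theorem link (B : IsBalanced S H ch slack) (F : IsForest n S H ch) (hx : x ∈ S) (hxy : x ≠ y)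
    (hry : H.par y ∉ S) (hdeg : H.deg x = H.deg y) :
    IsBalanced S (H.link n x y) (update ch x (y :: ch x)) slack where
  mark z hz := by
    rw [Links.link_mrk, update_apply]
    split_ifs
    exacts [zero_le_one, B.mark z hz]
  age z hz := by
    have older : ∀ z ∈ S,
        AgeBound (fun c => (H.link n x y).deg c + (H.link n x y).mrk c + slack c) (ch z) := by
      refine fun z hz => (B.age z hz).mono fun c hc => ?_
      have hcy : c ≠ y := ne_of_mem_of_not_mem hc (F.notMem_children hz hry)
      have hle : H.deg c ≤ update H.deg x (H.deg x + 1) c := by grind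
      simp only [Links.link_deg, Links.link_mrk, update_of_ne hcy]
      gcongr
    rw [update_apply]
    split_ifs
    · refine ⟨?_, older x hx⟩
      simp only [Links.link_deg, update_of_ne hxy.symm, ← hdeg, F.deg x hx]
      omega
    · exact older z hz

theorem cut {L₁ L₂ : List ℕ} (B : IsBalanced S H ch slack) (F : IsForest n S H ch)
    (hp : H.par x ∈ S) (hL : ch (H.par x) = L₁ ++ x :: L₂) :
    IsBalanced S (H.cut n x a) (update ch (H.par x) (L₁ ++ L₂))
      (slack + Pi.single (H.par x) 1) where
  mark z hz := by
    rw [Links.cut_mrk, update_apply]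
    split_ifs
    exacts [zero_le_one, B.mark z hz]
  age z hz := by
    have bound : ∀ c ≠ x, H.deg c + H.mrk c + slack c ≤
        (H.cut n x a).deg c + (H.cut n x a).mrk c + (slack + Pi.single (H.par x) 1 : ℕ → ℕ) c := by
      intro c hcx
      rw [Links.cut_deg, Links.cut_mrk, update_of_ne hcx, Pi.add_apply, Pi.single_apply,
        update_apply]
      split_ifs with hc
      · subst hc
        omega
      · omega
    have hd := F.nodup _ hp
    rcases eq_or_ne z (H.par x) with rfl | hzp
    · rw [update_self]
      exact ((hL ▸ B.age _ hp : AgeBound _ (L₁ ++ x :: L₂)).remove).mono fun c hc =>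
        bound c (by grind)
    · rw [update_of_ne hzp]
      exact (B.age z hz).mono fun c hc => bound c fun hcx =>
        hzp (hcx ▸ ((F.mem z hz c).1 hc).2).symm

theorem setMark (B : IsBalanced S H ch (Pi.single x 1)) (hx : H.mrk x = 0) :
    IsBalanced S (H.setMark x) ch 0 where
  mark z hz := by
    rw [Links.setMark_mrk, update_apply]
    split_ifs
    exacts [le_rfl, B.mark z hz]
  age z hz := (B.age z hz).mono fun c _ => by
    simp only [Links.setMark_deg, Links.setMark_mrk, update_apply, Pi.single_apply, Pi.zero_apply]
    split_ifs with hc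
    · simp only [hc, hx, add_zero, le_rfl]
    · exact le_rfl

end IsBalanced

namespace IsHeapOrdered

theorem erase (K : IsHeapOrdered S H O) : IsHeapOrdered (S.erase v) H O :=
  fun c hc hO hp => K c (Finset.mem_of_mem_erase hc) hO (Finset.mem_of_mem_erase hp)

theorem addNode (K : IsHeapOrdered S H O) (hn : n ∉ insert v S) (hchild : ∀ c ∈ S, H.par c ≠ v) :
    IsHeapOrdered (insert v S) (H.addNode n v a k) O := by
  intro c hc hO hp
  rcases eq_or_ne c v with rfl | hcv
  · exact absurd (by simpa using hp) hn
  · have hcS : c ∈ S := Finset.mem_of_mem_insert_of_ne hc hcv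
    have hpv := hchild c hcS
    simp only [Links.addNode_par, Links.addNode_key, update_of_ne hcv, update_of_ne hpv] at hp ⊢
    exact K c hcS hO (Finset.mem_of_mem_insert_of_ne hp hpv)

theorem pushRoot (K : IsHeapOrdered S H O) (hn : n ∉ S) :
    IsHeapOrdered S (H.pushRoot n x a) O := by
  intro c hc hO hp
  have hcx : c ≠ x := by rintro rfl; exact hn (by simpa using hp)
  simp only [Links.pushRoot_par, Links.pushRoot_key, update_of_ne hcx] at hp ⊢
  exact K c hc hO hp

theorem link (K : IsHeapOrdered S H O) (hkey : H.key x ≤ H.key y) :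
    IsHeapOrdered S (H.link n x y) O := by
  intro c hc hO hp
  rw [Links.link_par, Links.link_key, update_apply] at *
  split_ifs at hp ⊢ with hcy
  exacts [hcy ▸ hkey, K c hc hO hp]

theorem cut (K : IsHeapOrdered S H O) (hn : n ∉ S) :
    IsHeapOrdered S (H.cut n x a) (O \ {x}) := by
  intro c hc hO hp
  have hcx : c ≠ x := by rintro rfl; exact hn (by simpa using hp)
  simp only [Links.cut_par, Links.cut_key, update_of_ne hcx] at hp ⊢
  exact K c hc (fun h => hO ⟨h, hcx⟩) hp

theorem lowerKey (K : IsHeapOrdered S H O) (hk : k ≤ H.key v) :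
    IsHeapOrdered S (H.setKey v k) (insert v O) := by
  intro c hc hO hp
  rw [Set.mem_insert_iff, not_or] at hO
  have := K c hc hO.2 hp
  simp only [Links.setKey_par, Links.setKey_key, update_of_ne hO.1, update_apply]
  split_ifs with hpv
  · exact hk.trans (hpv ▸ this)
  · exact this

theorem le_key (K : IsHeapOrdered S H ∅) (F : IsForest n S H ch)
    (hk : ∀ c ∈ H.roots S, k ≤ H.key c) : ∀ c ∈ S, k ≤ H.key c := by
  obtain ⟨h, hh⟩ := F.rank
  suffices ∀ d, ∀ c ∈ S, S.sup h - h c = d → k ≤ H.key c from fun c hc => this _ c hc rfl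
  intro d
  induction d using Nat.strong_induction_on with
  | _ d ih =>
    intro c hc hd
    by_cases hp : H.par c ∈ S
    · have hlt := hh c hc hp
      have hle : h (H.par c) ≤ S.sup h := Finset.le_sup hp
      exact (ih _ (by omega) _ hp rfl).trans (K c hc (Set.notMem_empty c) hp)
    · exact hk c (Links.mem_roots.2 ⟨hc, hp⟩)

end IsHeapOrdered

end Operations

section DegreeBound

variable {n : ℕ} {S : Finset ℕ} {H : Links} {ch : ℕ → List ℕ} {x : ℕ}

theorem IsForest.exists_root (F : IsForest n S H ch) (hS : S.Nonempty) : (H.roots S).Nonempty := by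
  obtain ⟨h, hh⟩ := F.rank
  obtain ⟨x, hx, hmax⟩ := S.exists_max_image h hS
  exact ⟨x, Links.mem_roots.2 ⟨hx, fun hp => (hh x hx hp).not_ge (hmax _ hp)⟩⟩

theorem IsForest.roots_erase (F : IsForest n S H ch) (hx : x ∈ H.roots S) :
    H.roots (S.erase x) = (H.roots S).erase x ∪ (ch x).toFinset := by
  rw [Links.mem_roots] at hx
  ext c
  have := F.par_ne hx.1
  simp only [Links.mem_roots, Finset.mem_union, Finset.mem_erase, List.mem_toFinset, F.mem x hx.1]
  grind

/-- Removing a root turns its children into roots, and these have large enough degrees. -/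
theorem sum_fib_roots_le_card (F : IsForest n S H ch) (B : IsBalanced S H ch 0) :
    ∑ x ∈ H.roots S, Nat.fib (H.deg x + 2) ≤ S.card := by
  induction hcard : S.card generalizing S with
  | zero => simp [Links.roots, Finset.card_eq_zero.1 hcard]
  | succ k ih =>
    obtain ⟨x, hroot⟩ := F.exists_root (Finset.card_pos.1 (by omega))
    obtain ⟨hx, hp⟩ := Links.mem_roots.1 hroot
    have sum_le := ih (F.erase hp) B.erase (by rw [Finset.card_erase_of_mem hx]; omega)
    have disjoint : Disjoint ((H.roots S).erase x) (ch x).toFinset := by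
      rw [Finset.disjoint_left]
      intro c hc hc'
      exact (Links.mem_roots.1 (Finset.mem_of_mem_erase hc)).2
        (F.not_root_of_mem hx (List.mem_toFinset.1 hc'))
    have fib_le : Nat.fib (H.deg x + 2) ≤ ((ch x).map fun c => Nat.fib (H.deg c + 2)).sum + 1 := by
      rw [F.deg x hx]
      refine ((B.age x hx).mono fun c hc => ?_).fib_le
      exact Nat.add_le_add_left (B.mark c ((F.mem x hx c).1 hc).1) _
    rw [F.roots_erase hroot, Finset.sum_union disjoint, List.sum_toFinset _ (F.nodup x hx)]
      at sum_le
    have := Finset.add_sum_erase _ (fun x => Nat.fib (H.deg x + 2)) hroot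
    omega

theorem fib_deg_le (F : IsForest n S H ch) (B : IsBalanced S H ch 0) (hx : x ∈ H.roots S) :
    Nat.fib (H.deg x + 2) ≤ n :=
  calc Nat.fib (H.deg x + 2)
    _ ≤ ∑ x ∈ H.roots S, Nat.fib (H.deg x + 2) :=
      Finset.single_le_sum (f := fun x => Nat.fib (H.deg x + 2)) (fun _ _ => Nat.zero_le _) hx
    _ ≤ S.card := sum_fib_roots_le_card F B
    _ ≤ (Finset.range n).card :=
      Finset.card_le_card fun c hc => Finset.mem_range.2 (F.lt c hc)
    _ = n := Finset.card_range n

theorem deg_lt (F : IsForest n S H ch) (B : IsBalanced S H ch 0) (hx : x ∈ H.roots S) :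
    H.deg x < n := by
  have := fib_deg_le F B hx
  have := Nat.le_fib_add_one (H.deg x + 2)
  omega

theorem two_pow_le_fib (d : ℕ) : 2 ^ d ≤ Nat.fib (2 * d + 2) := by
  induction d with
  | zero => simp
  | succ d ih =>
    have : Nat.fib (2 * (d + 1) + 2) = Nat.fib (2 * d + 2) + Nat.fib (2 * d + 3) :=
      Nat.fib_add_two
    have : Nat.fib (2 * d + 2) ≤ Nat.fib (2 * d + 3) := Nat.fib_le_fib_succ
    rw [pow_succ]
    omega

theorem deg_le_log (F : IsForest n S H ch) (B : IsBalanced S H ch 0) (hx : x ∈ H.roots S) :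
    H.deg x ≤ 2 * Nat.log 2 n + 1 := by
  have hpow : 2 ^ (H.deg x / 2) ≤ n :=
    (two_pow_le_fib _).trans ((Nat.fib_mono (by omega)).trans (fib_deg_le F B hx))
  have := Nat.le_log_of_pow_le one_lt_two hpow
  omega

end DegreeBound

/-! ### The operations on the heap -/

/-- The trees of a Fibonacci heap with the nodes `S`, in which nodes may have lost more children
than usual as far as `slack` grants it, and the nodes in `O` may have smaller keys than their
parents. -/
def IsFibForest (n : ℕ) (S : Finset ℕ) (H : Links) (slack : ℕ → ℕ) (O : Set ℕ) : Prop :=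
  ∃ ch, IsForest n S H ch ∧ IsBalanced S H ch slack ∧ IsHeapOrdered S H O

/-- `rt` is the list of roots of the forest on the nodes `S`, starting at the pointer `a`. -/
structure IsRootList (n : ℕ) (S : Finset ℕ) (H : Links) (a : ℕ) (rt : List ℕ) : Prop where
  chain : Chain H.nxt a rt n
  nodup : rt.Nodup
  mem : ∀ c, c ∈ rt ↔ c ∈ H.roots S
  par : ∀ c ∈ rt, H.par c = n
  mrk : ∀ c ∈ rt, H.mrk c = 0

/-- `b` is an entry of `rt` of minimum key, or null if `rt` is empty. -/
def IsMinRoot (n : ℕ) (H : Links) (rt : List ℕ) (b : ℕ) : Prop :=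
  rt = [] ∧ b = n ∨ b ∈ rt ∧ ∀ c ∈ rt, H.key b ≤ H.key c

/-- The memory holds a Fibonacci heap with the nodes `S` and the list `rt` of roots. -/
structure IsHeap (n : ℕ) (S : Finset ℕ) (m : Mem) (rt : List ℕ) : Prop where
  size : m.reg .n = n
  roots : IsRootList n S m.links (m.reg .roots) rt
  forest : IsFibForest n S m.links 0 ∅
  hmin : IsMinRoot n m.links rt (m.reg .hmin)
  inH : ∀ v < n, m.cell .inH v = 0 ↔ v ∉ S
  table : ∀ i < n, m.cell .table i = n
  key : ∀ v ∈ S, m.num .D v ≤ m.num .key v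

/-- The potential of the amortized analysis. -/
def potential (S : Finset ℕ) (H : Links) (rt : List ℕ) : ℕ :=
  rt.length + 2 * ∑ x ∈ S, H.mrk x

section FibForest

variable {n : ℕ} {S : Finset ℕ} {H : Links} {slack slack' : ℕ → ℕ} {O O' : Set ℕ} {rt : List ℕ}
  {a v x y : ℕ} {k : WithTop ℝ}

namespace IsFibForest

theorem notMem (F : IsFibForest n S H slack O) : n ∉ S := by
  obtain ⟨ch, F, -⟩ := F
  exact F.notMem

theorem addNode (F : IsFibForest n S H slack O) (hv : v ∉ S) (hvn : v < n)
    (hchild : ∀ c ∈ S, H.par c ≠ v) :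
    IsFibForest n (insert v S) (H.addNode n v a k) slack O := by
  obtain ⟨ch, F, B, K⟩ := F
  have F' := F.addNode hv hvn hchild (a := a) (k := k)
  exact ⟨_, F', B.addNode F hv, K.addNode F'.notMem hchild⟩

theorem cut (F : IsFibForest n S H (Pi.single x 1) {x}) (hx : x ∈ S) (hp : H.par x ∈ S) :
    IsFibForest n S (H.cut n x a) (Pi.single (H.par x) 1) ∅ := by
  obtain ⟨ch, F, B, K⟩ := F
  obtain ⟨L₁, L₂, hL⟩ := List.append_of_mem ((F.mem _ hp x).2 ⟨hx, rfl⟩)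
  have F' := F.cut (a := a) hp hL
  refine ⟨_, F', (B.cut F hp hL).mono F' fun c _ hpc => ?_, ?_⟩
  · have hcx : c ≠ x := by
      rintro rfl
      exact F.notMem (by simpa using hpc)
    simp [hcx]
  · simpa using K.cut (x := x) (a := a) F.notMem

theorem setMark (F : IsFibForest n S H (Pi.single x 1) O) (hx : H.mrk x = 0) :
    IsFibForest n S (H.setMark x) 0 O := by
  obtain ⟨ch, F, B, K⟩ := F
  exact ⟨ch, F.congr (fun _ _ h => h) (fun _ _ _ => rfl) (fun _ _ _ => rfl) (fun _ _ _ => rfl)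
    (fun _ _ => rfl) (fun _ _ => rfl) fun _ _ => rfl, B.setMark hx, K⟩

theorem setKey (F : IsFibForest n S H slack ∅) (hk : k ≤ H.key v) :
    IsFibForest n S (H.setKey v k) slack {v} := by
  obtain ⟨ch, F, B, K⟩ := F
  refine ⟨ch, F.congr (fun _ _ h => h) (fun _ _ _ => rfl) (fun _ _ _ => rfl) (fun _ _ _ => rfl)
    (fun _ _ => rfl) (fun _ _ => rfl) fun _ _ => rfl, ⟨B.mark, B.age⟩, ?_⟩
  simpa using K.lowerKey hk

theorem weaken (F : IsFibForest n S H slack O)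
    (hslack : ∀ c ∈ S, H.par c ∈ S → slack c ≤ slack' c)
    (hO : ∀ c ∈ S, c ∈ O → c ∉ O' → H.par c ∈ S → H.key (H.par c) ≤ H.key c) :
    IsFibForest n S H slack' O' := by
  obtain ⟨ch, F, B, K⟩ := F
  refine ⟨ch, F, B.mono F hslack, fun c hc hcO hp => ?_⟩
  by_cases h : c ∈ O
  exacts [hO c hc h hcO hp, K c hc h hp]

end IsFibForest

namespace IsRootList

theorem addNode (R : IsRootList n S H a rt) (hv : v ∉ S) (hn : n ∉ insert v S)
    (hchild : ∀ c ∈ S, H.par c ≠ v) :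
    IsRootList n (insert v S) (H.addNode n v a k) v (v :: rt) := by
  have hne : ∀ c ∈ rt, c ≠ v := fun c hc =>
    ne_of_mem_of_not_mem (Links.mem_roots.1 ((R.mem c).1 hc)).1 hv
  refine ⟨⟨rfl, ?_⟩, List.nodup_cons.2 ⟨fun hc => hne _ hc rfl, R.nodup⟩, fun c => ?_,
    List.forall_mem_cons.2 ⟨by simp, fun c hc => by simpa [hne c hc] using R.par c hc⟩,
    List.forall_mem_cons.2 ⟨by simp, fun c hc => by simpa [hne c hc] using R.mrk c hc⟩⟩
  · rw [Links.addNode_nxt, update_self]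
    exact R.chain.congr fun c hc => update_of_ne (hne c hc) ..
  · rcases eq_or_ne c v with rfl | hcv
    · simpa using hn
    · simp only [List.mem_cons, hcv, false_or, R.mem, Links.mem_roots, Finset.mem_insert,
        Links.addNode_par, update_of_ne hcv]
      exact and_congr_right fun hc => by simp [hchild c hc]

theorem cut {ch : ℕ → List ℕ} (R : IsRootList n S H a rt) (F : IsForest n S H ch) (hx : x ∈ S)
    (hp : H.par x ∈ S) : IsRootList n S (H.cut n x a) x (x :: rt) := by
  have hne : ∀ c ∈ rt, c ≠ x := by
    rintro c hc rfl
    exact (Links.mem_roots.1 ((R.mem c).1 hc)).2 hp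
  refine ⟨⟨rfl, ?_⟩, List.nodup_cons.2 ⟨fun hc => hne _ hc rfl, R.nodup⟩, fun c => ?_,
    List.forall_mem_cons.2 ⟨by simp, fun c hc => by simpa [hne c hc] using R.par c hc⟩,
    List.forall_mem_cons.2 ⟨by simp, fun c hc => by simpa [hne c hc] using R.mrk c hc⟩⟩
  · rw [Links.cut_nxt, update_self]
    refine R.chain.congr fun c hc => ?_
    rw [Links.cut_nxt, update_of_ne (hne c hc)]
    split_ifs with hprv
    · rfl
    · obtain ⟨L₁, L₂, hL⟩ := List.append_of_mem ((F.mem _ hp x).2 ⟨hx, rfl⟩)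
      have hmem : H.prv x ∈ ch (H.par x) := by
        have := (hL ▸ F.prev _ hp : BackChain _ _ (L₁ ++ x :: L₂)).prv_eq_or_mem
        rw [hL]
        exact List.mem_append_left _ (this.resolve_left hprv)
      refine update_of_ne ?_ ..
      rintro rfl
      exact (Links.mem_roots.1 ((R.mem _).1 hc)).2 (F.not_root_of_mem hp hmem)
  · rcases eq_or_ne c x with rfl | hcx
    · simpa [hx] using F.notMem
    · simp [hcx, R.mem]

theorem setMark (R : IsRootList n S H a rt) (hp : H.par x ∈ S) :
    IsRootList n S (H.setMark x) a rt where
  chain := R.chain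
  nodup := R.nodup
  mem := R.mem
  par := R.par
  mrk c hc := by
    have hcx : c ≠ x := by
      rintro rfl
      exact (Links.mem_roots.1 ((R.mem c).1 hc)).2 hp
    rw [Links.setMark_mrk, update_of_ne hcx, R.mrk c hc]

theorem par_eq_or_mem (R : IsRootList n S H a rt) (hx : x ∈ S) : H.par x = n ∨ H.par x ∈ S := by
  by_cases hp : H.par x ∈ S
  exacts [.inr hp, .inl (R.par x ((R.mem x).2 (Links.mem_roots.2 ⟨hx, hp⟩)))]

theorem eq_nil_iff (R : IsRootList n S H a rt) (F : IsFibForest n S H slack O) :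
    rt = [] ↔ S = ∅ := by
  obtain ⟨ch, F, -⟩ := F
  constructor
  · rintro rfl
    by_contra hS
    obtain ⟨x, hx⟩ := F.exists_root (Finset.nonempty_iff_ne_empty.2 hS)
    exact List.not_mem_nil ((R.mem x).2 hx)
  · rintro rfl
    exact List.eq_nil_iff_forall_not_mem.2 fun c hc =>
      Finset.notMem_empty c (Links.mem_roots.1 ((R.mem c).1 hc)).1

end IsRootList

theorem sum_update_add (f : ℕ → ℕ) (hx : x ∈ S) (b : ℕ) :
    ∑ c ∈ S, update f x b c + f x = ∑ c ∈ S, f c + b := by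
  rw [Finset.sum_update_of_mem hx, ← Finset.add_sum_erase S f hx, ← Finset.erase_eq]
  ring

theorem potential_addNode (hv : v ∉ S) :
    potential (insert v S) (H.addNode n v a k) (v :: rt) = potential S H rt + 1 := by
  have hsum : ∑ x ∈ S, update H.mrk v 0 x = ∑ x ∈ S, H.mrk x :=
    Finset.sum_congr rfl fun x hx => update_of_ne (ne_of_mem_of_not_mem hx hv) ..
  simp only [potential, Finset.sum_insert hv, Links.addNode_mrk, update_self, hsum,
    List.length_cons]
  ring

theorem potential_cut (hx : x ∈ S) :
    potential S (H.cut n x a) (x :: rt) + 2 * H.mrk x = potential S H rt + 1 := by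
  have := sum_update_add H.mrk hx 0
  simp only [potential, Links.cut_mrk, List.length_cons]
  omega

theorem potential_setMark (hx : x ∈ S) (hm : H.mrk x = 0) :
    potential S (H.setMark x) rt = potential S H rt + 2 := by
  have := sum_update_add H.mrk hx 1
  simp only [potential, Links.setMark_mrk]
  omega

end FibForest

section HeapOperations

variable {n : ℕ} {S : Finset ℕ} {m : Mem} {rt rt₀ : List ℕ} {r : Reg} {p : ℕ}

theorem halts_updateMin : Halts (updateMin r) m fun t _ m' => t ≤ 3 ∧
    ∃ b, m' = m.setReg .hmin b ∧
      (b = m.reg r ∧ (m.reg .hmin = m.reg .n ∨ m.num .key (m.reg r) < m.num .key (m.reg .hmin)) ∨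
        b = m.reg .hmin ∧ m.reg .hmin ≠ m.reg .n ∧
          m.num .key (m.reg .hmin) ≤ m.num .key (m.reg r)) := by
  simp only [updateMin, halts_cond, halts_mov, halts_skip, Test.holds, Word.eval, Num.eval]
  split_ifs with hnull hlt
  · exact ⟨by omega, _, rfl, .inl ⟨rfl, .inl hnull⟩⟩
  · exact ⟨by omega, _, rfl, .inl ⟨rfl, .inr hlt⟩⟩
  · exact ⟨by omega, _, (m.setReg_self _).symm, .inr ⟨rfl, hnull, not_lt.1 hlt⟩⟩

theorem IsMinRoot.halts_updateMin (h : IsMinRoot n m.links rt (m.reg .hmin)) (hn : m.reg .n = n)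
    (hnull : n ∉ rt) : Halts (updateMin r) m fun t _ m' => t ≤ 3 ∧
      ∃ b, m' = m.setReg .hmin b ∧ IsMinRoot n m.links (m.reg r :: rt) b := by
  refine SP.halts_updateMin.mono ?_
  rintro t - m' - ⟨ht, b, rfl, hb⟩
  refine ⟨ht, b, rfl, .inr ?_⟩
  simp only [hn] at hb
  simp only [IsMinRoot, Mem.links_key] at h ⊢
  rcases h with ⟨rfl, hmin⟩ | ⟨hmem, hle⟩
  · obtain ⟨rfl, -⟩ := hb.resolve_right fun h => h.2.1 hmin
    simp
  · have hne : m.reg .hmin ≠ n := ne_of_mem_of_not_mem hmem hnull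
    rcases hb with ⟨rfl, hlt⟩ | ⟨rfl, -, hle'⟩
    · exact ⟨List.mem_cons_self, List.forall_mem_cons.2
        ⟨le_rfl, fun c hc => ((hlt.resolve_left hne).le.trans (hle c hc))⟩⟩
    · exact ⟨List.mem_cons_of_mem _ hmem, List.forall_mem_cons.2 ⟨hle', hle⟩⟩

theorem halts_cut (hy : m.reg .y = m.cell .parent (m.reg .x)) : Halts cut m fun t _ m' => t ≤ 12 ∧
    m'.reg .roots = m.reg .x ∧
      m'.links = m.links.cut (m.reg .n) (m.reg .x) (m.reg .roots) := by
  by_cases hprv : m.cell .prv (m.reg .x) = m.reg .n <;>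
    by_cases hnxt : m.cell .nxt (m.reg .x) = m.reg .n <;>
    simp [cut, pushRoot, hprv, hnxt, Mem.links, Links.cut, hy]

theorem halts_link : Halts link m fun t _ m' => t ≤ 9 ∧
    m'.links = m.links.link (m.reg .n) (m.reg .x) (m.reg .y) := by
  by_cases hchild : m.cell .child (m.reg .x) = m.reg .n <;>
    simp [link, hchild, Mem.links, Links.link]

namespace IsHeap

theorem par_ne (h : IsHeap n S m rt) {v : ℕ} (hv : v ∉ S) (hvn : v < n) :
    ∀ c ∈ S, m.links.par c ≠ v := by
  rintro c hc rfl
  exact hvn.ne ((h.roots.par_eq_or_mem hc).resolve_right hv)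

theorem halts_insertNode (h : IsHeap n S m rt) (hv : m.reg .v ∉ S) (hvn : m.reg .v < n) :
    Halts insertNode m fun t _ m' => t ≤ 11 ∧
      IsHeap n (insert (m.reg .v) S) m' (m.reg .v :: rt) ∧
      potential (insert (m.reg .v) S) m'.links (m.reg .v :: rt) = potential S m.links rt + 1 := by
  have hchild := h.par_ne hv hvn
  have F := h.forest.addNode hv hvn hchild (a := m.reg .roots) (k := m.num .D (m.reg .v))
  have R := h.roots.addNode hv F.notMem hchild (k := m.num .D (m.reg .v))
  have hne : ∀ c ∈ rt, c ≠ m.reg .v := fun c hc =>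
    ne_of_mem_of_not_mem (Links.mem_roots.1 ((h.roots.mem c).1 hc)).1 hv
  have hnull : n ∉ rt := fun hc => h.forest.notMem (Links.mem_roots.1 ((h.roots.mem n).1 hc)).1
  simp only [insertNode, pushRoot, halts_seq, halts_put, halts_putNum, halts_mov]
  set m₁ := Mem.setReg _ Reg.roots _ with hm₁
  have reg₁ : ∀ r', r' ≠ .roots → m₁.reg r' = m.reg r' := fun r' h => by simp [hm₁, h]
  have roots₁ : m₁.reg .roots = m.reg .v := by simp [hm₁]
  have inH₁ : m₁.cell .inH = update (m.cell .inH) (m.reg .v) 1 := by simp [hm₁]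
  have table₁ : m₁.cell .table = m.cell .table := by simp [hm₁]
  have key₁ : m₁.num .key = update (m.num .key) (m.reg .v) (m.num .D (m.reg .v)) := by simp [hm₁]
  have dist₁ : m₁.num .D = m.num .D := by simp [hm₁]
  have links₁ : m₁.links = m.links.addNode n (m.reg .v) (m.reg .roots) (m.num .D (m.reg .v)) := by
    simp [hm₁, Mem.links, Links.addNode, h.size]
  clear_value m₁
  have size₁ : m₁.reg .n = n := (reg₁ _ (by simp)).trans h.size
  have v₁ : m₁.reg .v = m.reg .v := reg₁ _ (by simp)
  have min₁ : IsMinRoot n m₁.links rt (m₁.reg .hmin) := by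
    rw [reg₁ _ (by simp), links₁]
    refine h.hmin.imp_right fun ⟨hmem, hle⟩ => ⟨hmem, fun c hc => ?_⟩
    rw [Links.addNode_key, Links.addNode_key, update_of_ne (hne _ hmem), update_of_ne (hne c hc)]
    exact hle c hc
  refine (min₁.halts_updateMin size₁ hnull).mono ?_
  rintro t - m' - ⟨ht, b, rfl, hmin⟩
  rw [v₁] at hmin
  refine ⟨by omega, ⟨size₁, ?_, links₁ ▸ F, hmin, fun u hu => ?_,
    by simpa [table₁] using h.table, ?_⟩, ?_⟩
  · change IsRootList n _ m₁.links (m₁.reg .roots) _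
    rw [links₁, roots₁]
    exact R
  · have := h.inH u hu
    rcases eq_or_ne u (m.reg .v) with rfl | huv
    · simp [inH₁]
    · simp [inH₁, huv, this]
  · refine (Finset.forall_mem_insert _ _ _).2 ⟨by simp [key₁, dist₁], fun u hu => ?_⟩
    simpa [key₁, dist₁, ne_of_mem_of_not_mem hu hv] using h.key u hu
  · change potential _ m₁.links _ = _
    rw [links₁, potential_addNode hv]

end IsHeap

/-- The part of the loop of cascading cuts in `decreaseKey` that follows the cut: go on to the
parent `y` of the node that has been cut off. -/
def ascend : Com :=
  mov .x (.reg .y) ;;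
  mov .y (.cell .parent .x) ;;
  cond (.eq (.reg .y) (.reg .n))
    (mov .go (.lit 0))
    (cond (.eq (.cell .mark .x) (.lit 0))
      (put .mark .x (.lit 1) ;; mov .go (.lit 0))
      skip)

/-- The part of `decreaseKey` that precedes the cascading cuts. -/
def lowerKey : Com :=
  putNum .key .v (.cell .D .v) ;;
  mov .x (.reg .v) ;;
  mov .y (.cell .parent .x) ;;
  mov .go (.lit 0) ;;
  cond (.ne (.reg .y) (.reg .n))
    (cond (.numLt (.cell .key .x) (.cell .key .y)) (mov .go (.lit 1)) skip)
    skip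

theorem halts_lowerKey : Halts lowerKey m fun t _ m' => t ≤ 7 ∧
    m'.links = m.links.setKey (m.reg .v) (m.num .D (m.reg .v)) ∧
    m'.reg .x = m.reg .v ∧ m'.reg .y = m.cell .parent (m.reg .v) ∧
    (m'.reg .go ≠ 0 ↔ m'.reg .y ≠ m.reg .n ∧
      m'.num .key (m'.reg .x) < m'.num .key (m'.reg .y)) := by
  simp only [lowerKey, halts_seq, halts_putNum, halts_mov, halts_cond, halts_skip]
  split_ifs with hnull hlt <;> simp_all [Mem.links, Links.setKey]

/-- The state of the cascading cuts, with time credit `p`: while `go` is set, the node `x` has to be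
cut off its parent `y`, because its key has been lowered or because it has lost a second child. -/
structure IsCascading (n : ℕ) (S : Finset ℕ) (rt : List ℕ) (p : ℕ) (m : Mem) : Prop where
  size : m.reg .n = n
  roots : IsRootList n S m.links (m.reg .roots) rt
  active : m.reg .go ≠ 0 → m.reg .x ∈ S ∧ m.links.par (m.reg .x) ∈ S ∧
    m.reg .y = m.links.par (m.reg .x) ∧
    IsFibForest n S m.links (Pi.single (m.reg .x) 1) {m.reg .x} ∧
    30 * potential S m.links rt + 120 ≤ p + 60 * m.links.mrk (m.reg .x)
  done : m.reg .go = 0 → IsFibForest n S m.links 0 ∅ ∧ 30 * potential S m.links rt ≤ p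

theorem halts_ascend (hn : m.reg .n = n) (hgo : m.reg .go ≠ 0)
    (R : IsRootList n S m.links (m.reg .roots) rt) (hy : m.reg .y ∈ S)
    (F : IsFibForest n S m.links (Pi.single (m.reg .y) 1) ∅)
    (hp : 30 * potential S m.links rt + 90 ≤ p) :
    Halts ascend m fun t _ m' => t ≤ 6 ∧ ∃ q, IsCascading n S rt q m' ∧ q + 20 ≤ p := by
  simp only [ascend, halts_seq, halts_mov, halts_cond, halts_put, halts_skip, Test.holds, Word.eval,
    Mem.setReg_reg, Mem.setReg_cell, reduceIte, reduceCtorEq, hn]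
  rcases R.par_eq_or_mem hy with hnull | hpar
  · have hpar : m.cell .parent (m.reg .y) = n := hnull
    rw [if_pos hpar]
    have F' : IsFibForest n S m.links 0 ∅ := by
      refine F.weaken (fun c _ hc => ?_) (by simp)
      have hcy : c ≠ m.reg .y := by rintro rfl; exact F.notMem (hnull ▸ hc)
      simp [hcy]
    exact ⟨by omega, 30 * potential S m.links rt, ⟨hn, R, fun h => absurd rfl h,
      fun _ => ⟨F', le_rfl⟩⟩, by omega⟩
  · have hnull : m.cell .parent (m.reg .y) ≠ n := ne_of_mem_of_not_mem hpar F.notMem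
    rw [if_neg hnull]
    split_ifs with hmark
    · have pot := potential_setMark (H := m.links) (rt := rt) hy hmark
      refine ⟨by omega, 30 * potential S m.links rt + 60, ⟨hn, ?_, fun h => absurd rfl h,
        fun _ => ⟨?_, ?_⟩⟩, by omega⟩
      · simpa [Mem.links, Links.setMark] using R.setMark hpar
      · simpa [Mem.links, Links.setMark] using F.setMark hmark
      · simp only [Mem.links, Links.setMark] at pot ⊢
        simp
        omega
    · refine ⟨by omega, 30 * potential S m.links rt + 60, ⟨hn, R, fun _ => ⟨hy, hpar, rfl, ?_, ?_⟩,
        fun h => absurd h hgo⟩, by omega⟩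
      · exact F.weaken (fun _ _ _ => le_rfl) (by simp)
      · change _ + 120 ≤ _ + 60 * m.cell .mark (m.reg .y)
        change 30 * potential S m.links rt + 120 ≤ _
        omega

theorem IsCascading.halts_body (h : IsCascading n S rt p m) (hgo : m.reg .go ≠ 0) :
    Halts (cut ;; ascend) m fun t _ m' =>
      ∃ q, IsCascading n S (m.reg .x :: rt) q m' ∧ q + t + 1 ≤ p := by
  obtain ⟨hx, hp, hy, F, credit⟩ := h.active hgo
  rw [halts_seq]
  refine (halts_cut hy).mono ?_
  rintro t₁ _ m₁ exec₁ ⟨ht₁, roots₁, links₁⟩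
  rw [h.size] at links₁
  have y₁ : m₁.reg .y = m.reg .y := exec₁.reg_eq rfl
  have R₁ : IsRootList n S m₁.links (m₁.reg .roots) (m.reg .x :: rt) := by
    obtain ⟨ch, forest, -⟩ := F
    rw [links₁, roots₁]
    exact h.roots.cut forest hx hp
  have F₁ : IsFibForest n S m₁.links (Pi.single (m₁.reg .y) 1) ∅ := by
    rw [links₁, y₁, hy]
    exact F.cut hx hp
  have pot₁ : potential S m₁.links (m.reg .x :: rt) + 2 * m.links.mrk (m.reg .x) =
      potential S m.links rt + 1 := by
    rw [links₁, potential_cut hx]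
  refine (halts_ascend (p := p) ((exec₁.reg_eq rfl).trans h.size)
    ((exec₁.reg_eq rfl).trans_ne hgo) R₁ (by rwa [y₁, hy]) F₁ (by omega)).mono ?_
  rintro t₂ - m₂ - ⟨ht₂, q, hq, hqp⟩
  exact ⟨q, hq, by omega⟩

theorem IsCascading.halts_loop (h : IsCascading n S rt p m) :
    Halts (loop (.ne (.reg .go) (.lit 0)) (cut ;; ascend)) m fun t _ m' =>
      ∃ rt', rt ⊆ rt' ∧ IsRootList n S m'.links (m'.reg .roots) rt' ∧
        IsFibForest n S m'.links 0 ∅ ∧ 30 * potential S m'.links rt' + t ≤ p + 1 := by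
  refine (halts_loop_of_credit (I := fun p m => ∃ rt', rt ⊆ rt' ∧ IsCascading n S rt' p m) ?_
    ⟨rt, List.Subset.refl rt, h⟩).mono ?_
  · rintro p m ⟨rt', hsub, h⟩ hgo
    refine (h.halts_body hgo).mono ?_
    rintro t - m' - ⟨q, hq, hqp⟩
    exact ⟨q, ⟨_, List.subset_cons_of_subset _ hsub, hq⟩, hqp⟩
  · rintro t - m' - ⟨q, ⟨rt', hsub, h⟩, hgo, hqp⟩
    obtain ⟨F, credit⟩ := h.done (not_not.1 hgo)
    exact ⟨rt', hsub, h.roots, F, by omega⟩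

namespace IsHeap

theorem hmin_le (h : IsHeap n S m rt) (hS : S.Nonempty) :
    m.reg .hmin ∈ rt ∧ ∀ c ∈ S, m.links.key (m.reg .hmin) ≤ m.links.key c := by
  rcases h.hmin with ⟨hrt, -⟩ | ⟨hmem, hle⟩
  · exact absurd ((h.roots.eq_nil_iff h.forest).1 hrt) hS.ne_empty
  · obtain ⟨ch, F, -, K⟩ := h.forest
    exact ⟨hmem, K.le_key F fun c hc => hle c ((h.roots.mem c).2 hc)⟩

/-- `hmin` may be outdated only with respect to `v`, whose key has been lowered. -/
theorem halts_updateMin {m' : Mem} {rt' : List ℕ} (h : IsHeap n S m rt) (hv : m.reg .v ∈ S)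
    (R : IsRootList n S m'.links (m'.reg .roots) rt') (F : IsFibForest n S m'.links 0 ∅)
    (hsub : rt ⊆ rt') (hn : m'.reg .n = m.reg .n) (hv' : m'.reg .v = m.reg .v)
    (hmin : m'.reg .hmin = m.reg .hmin) (hinH : m'.cell .inH = m.cell .inH)
    (htable : m'.cell .table = m.cell .table) (hD : m'.num .D = m.num .D)
    (hkey : m'.num .key = update (m.num .key) (m.reg .v) (m.num .D (m.reg .v))) :
    Halts (updateMin .v) m' fun t _ m'' => t ≤ 3 ∧ IsHeap n S m'' rt' ∧ m''.links = m'.links := by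
  obtain ⟨hmem, hle⟩ := h.hmin_le ⟨_, hv⟩
  have hminS : m.reg .hmin ∈ S := (Links.mem_roots.1 ((h.roots.mem _).1 hmem)).1
  have key_le : ∀ c ∈ S, m'.num .key c ≤ m.num .key c := fun c hc => by
    rw [hkey, update_apply]
    split_ifs with hcv
    exacts [hcv ▸ h.key c hc, le_rfl]
  have key_hmin_le : ∀ c ∈ S, c ≠ m.reg .v → m'.num .key (m.reg .hmin) ≤ m'.num .key c := by
    intro c hc hcv
    refine (key_le _ hminS).trans ((hle c hc).trans_eq ?_)
    rw [hkey, update_of_ne hcv, Mem.links_key]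
  refine SP.halts_updateMin.mono ?_
  rintro t - m'' - ⟨ht, b, rfl, hb⟩
  rw [hv', hmin, hn, h.size] at hb
  refine ⟨ht, ⟨hn.trans h.size, R, F, .inr ?_, by simpa [hinH] using h.inH,
    by simpa [htable] using h.table, fun u hu => ?_⟩, rfl⟩
  · simp only [Mem.setReg_reg, if_true, Mem.links_key, Mem.setReg_num]
    rcases hb with ⟨rfl, hb⟩ | ⟨rfl, -, hb⟩
    · have hlt := hb.resolve_left (ne_of_mem_of_not_mem hminS F.notMem)
      refine ⟨(R.mem _).2 (Links.mem_roots.2 ⟨hv, fun hp => ?_⟩), fun c hc => ?_⟩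
      · obtain ⟨ch, forest, -, K⟩ := F
        exact (hlt.trans_le (key_hmin_le _ hp (forest.par_ne hv))).not_ge
          (K _ hv (Set.notMem_empty _) hp)
      · rcases eq_or_ne c (m.reg .v) with rfl | hcv
        exacts [le_rfl, hlt.le.trans (key_hmin_le c (Links.mem_roots.1 ((R.mem c).1 hc)).1 hcv)]
    · refine ⟨hsub hmem, fun c hc => ?_⟩
      rcases eq_or_ne c (m.reg .v) with rfl | hcv
      exacts [hb, key_hmin_le c (Links.mem_roots.1 ((R.mem c).1 hc)).1 hcv]
  · simp only [Mem.setReg_num, hD, hkey, update_apply]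
    split_ifs with huv
    exacts [huv ▸ le_rfl, h.key u hu]

theorem isCascading {v : ℕ} {k : WithTop ℝ} {m' : Mem} (h : IsHeap n S m rt) (hv : v ∈ S)
    (hk : k ≤ m.links.key v) (hlinks : m'.links = m.links.setKey v k)
    (hn : m'.reg .n = n) (hroots : m'.reg .roots = m.reg .roots)
    (hx : m'.reg .x = v) (hy : m'.reg .y = m.links.par v)
    (hgo : m'.reg .go ≠ 0 ↔ m'.reg .y ≠ n ∧ m'.links.key (m'.reg .x) < m'.links.key (m'.reg .y)) :
    IsCascading n S rt (30 * potential S m.links rt + 120) m' := by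
  have R : IsRootList n S (m.links.setKey v k) (m.reg .roots) rt :=
    ⟨h.roots.chain, h.roots.nodup, h.roots.mem, h.roots.par, h.roots.mrk⟩
  have F := h.forest.setKey hk
  rw [hx, hy] at hgo
  refine ⟨hn, by rwa [hlinks, hroots], fun go => ?_, fun go => ?_⟩ <;> rw [hlinks] at hgo ⊢
  · have hpar := (h.roots.par_eq_or_mem hv).resolve_left (hgo.1 go).1
    rw [hx, hy]
    exact ⟨hv, hpar, rfl, F.weaken (by simp) fun _ _ hcv hcv' => absurd hcv hcv',
      Nat.le_add_right _ _⟩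
  · refine ⟨F.weaken (by simp) fun c _ hcv _ hp => ?_, Nat.le_add_right _ _⟩
    obtain rfl : c = v := hcv
    exact not_lt.1 fun hlt => hgo.2 ⟨ne_of_mem_of_not_mem hp F.notMem, hlt⟩ go

theorem halts_decreaseKey (h : IsHeap n S m rt) (hv : m.reg .v ∈ S) :
    Halts decreaseKey m fun t _ m' => ∃ rt', IsHeap n S m' rt' ∧
      t + 30 * potential S m'.links rt' ≤ 30 * potential S m.links rt + 140 := by
  suffices Halts (lowerKey ;; loop (.ne (.reg .go) (.lit 0)) (cut ;; ascend) ;; updateMin .v) m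
      fun t _ m' => ∃ rt', IsHeap n S m' rt' ∧
        t + 30 * potential S m'.links rt' ≤ 30 * potential S m.links rt + 140 by
    simpa only [decreaseKey, lowerKey, ascend, halts_seq, add_assoc, List.append_assoc] using this
  simp only [halts_seq]
  refine halts_lowerKey.mono ?_
  rintro t₁ _ m₁ exec₁ ⟨ht₁, links₁, x₁, y₁, go₁⟩
  have casc : IsCascading n S rt (30 * potential S m.links rt + 120) m₁ :=
    h.isCascading hv (h.key _ hv) links₁ ((exec₁.reg_eq rfl).trans h.size) (exec₁.reg_eq rfl) x₁ y₁
      (h.size ▸ go₁)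
  refine casc.halts_loop.mono ?_
  rintro t₂ _ m₂ exec₂ ⟨rt', hsub, R, F, ht₂⟩
  have key₂ : m₂.num .key = m₁.num .key := exec₂.num_eq rfl
  refine (h.halts_updateMin hv R F hsub ((exec₂.reg_eq rfl).trans (exec₁.reg_eq rfl))
    ((exec₂.reg_eq rfl).trans (exec₁.reg_eq rfl)) ((exec₂.reg_eq rfl).trans (exec₁.reg_eq rfl))
    ((exec₂.cell_eq rfl).trans (exec₁.cell_eq rfl)) ((exec₂.cell_eq rfl).trans (exec₁.cell_eq rfl))
    ((exec₂.num_eq rfl).trans (exec₁.num_eq rfl))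
    (key₂.trans (congrArg Links.key links₁))).mono ?_
  rintro t₃ - m₃ - ⟨ht₃, heap, links₃⟩
  exact ⟨rt', heap, by rw [links₃]; omega⟩

end IsHeap

end HeapOperations

section FibForest

variable {n : ℕ} {S : Finset ℕ} {H : Links} {slack : ℕ → ℕ} {O : Set ℕ} {x y v a : ℕ}

theorem Links.roots_pushRoot (hn : n ∉ S) (hx : H.par x ∉ S) :
    (H.pushRoot n x a).roots S = H.roots S := by
  ext c
  rcases eq_or_ne c x with rfl | hcx
  · simp [hn, hx]
  · simp [hcx]

theorem Links.roots_link (hx : x ∈ S) : (H.link n x y).roots S = (H.roots S).erase y := by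
  ext c
  rcases eq_or_ne c y with rfl | hcy
  · simp [hx]
  · simp [hcy]

namespace IsFibForest

theorem pushRoot (F : IsFibForest n S H slack O) (hx : H.par x ∉ S) :
    IsFibForest n S (H.pushRoot n x a) slack O := by
  obtain ⟨ch, F, B, K⟩ := F
  exact ⟨ch, F.pushRoot hx, B.pushRoot F hx, K.pushRoot F.notMem⟩

theorem erase (F : IsFibForest n S H slack O) (hv : H.par v ∉ S) :
    IsFibForest n (S.erase v) H slack O := by
  obtain ⟨ch, F, B, K⟩ := F
  exact ⟨ch, F.erase hv, B.erase, K.erase⟩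

theorem link (F : IsFibForest n S H slack O) (hx : x ∈ H.roots S) (hy : y ∈ H.roots S)
    (hxy : x ≠ y) (hdeg : H.deg x = H.deg y) (hkey : H.key x ≤ H.key y) :
    IsFibForest n S (H.link n x y) slack O := by
  obtain ⟨ch, F, B, K⟩ := F
  rw [Links.mem_roots] at hx hy
  exact ⟨_, F.link hx.1 hy.1 hxy hx.2 hy.2, B.link F hx.1 hxy hy.2 hdeg, K.link hkey⟩

theorem deg_lt (F : IsFibForest n S H 0 O) (hx : x ∈ H.roots S) : H.deg x < n := by
  obtain ⟨ch, F, B, -⟩ := F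
  exact SP.deg_lt F B hx

theorem deg_le_log (F : IsFibForest n S H 0 O) (hx : x ∈ H.roots S) :
    H.deg x ≤ 2 * Nat.log 2 n + 1 := by
  obtain ⟨ch, F, B, -⟩ := F
  exact SP.deg_le_log F B hx

end IsFibForest

end FibForest

/-! ### Removing the minimum -/

section Promote

variable {n : ℕ} {T : Finset ℕ} {v : ℕ} {f : ℕ → ℕ} {L rt : List ℕ} {m : Mem}

/-- The state while the children of the removed root `v` are turned into roots: the children in `L`
remain, and the list `rt` of roots still holds `v`.  The marks are bounded by `f`. -/
structure IsPromoting (n : ℕ) (T : Finset ℕ) (v : ℕ) (f : ℕ → ℕ) (L rt : List ℕ) (m : Mem) :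
    Prop where
  size : m.reg .n = n
  forest : IsFibForest n T m.links 0 ∅
  marks : m.links.mrk ≤ f
  rest : Chain m.links.nxt (m.reg .x) L n
  chain : Chain m.links.nxt (m.reg .roots) rt n
  nodup : (L ++ rt).Nodup
  child : ∀ c ∈ L, c ∈ m.links.roots T
  root : ∀ c ∈ rt, c ≠ v → c ∈ m.links.roots T ∧ m.links.par c = n ∧ m.links.mrk c = 0
  mem : ∀ c ∈ m.links.roots T, c ∈ L ∨ c ∈ rt

theorem IsPromoting.halts_body {x : ℕ} (h : IsPromoting n T v f (x :: L) rt m) :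
    Halts (mov .nx (.cell .nxt .x) ;; SP.pushRoot .x ;; mov .x (.reg .nx)) m fun t _ m' =>
      t ≤ 6 ∧ IsPromoting n T v f L (x :: rt) m' := by
  obtain ⟨hx, rest⟩ := h.rest
  have hroot := h.child x List.mem_cons_self
  have hpar := (Links.mem_roots.1 hroot).2
  simp only [SP.pushRoot, halts_seq, halts_mov, halts_put]
  set m₁ := Mem.setReg _ Reg.x _ with hm₁
  have size₁ : m₁.reg .n = n := by simp [hm₁, h.size]
  have roots₁ : m₁.reg .roots = x := by simp [hm₁, hx]
  have x₁ : m₁.reg .x = m.links.nxt x := by simp [hm₁, hx]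
  have links₁ : m₁.links = m.links.pushRoot n x (m.reg .roots) := by
    simp [hm₁, hx, h.size, Mem.links, Links.pushRoot]
  clear_value m₁
  have nodup : (L ++ x :: rt).Nodup := List.perm_middle.nodup_iff.2 h.nodup
  have hne : ∀ c ∈ L ++ rt, c ≠ x := by
    rintro c hc rfl
    exact (List.nodup_cons.1 h.nodup).1 hc
  have hroots : m₁.links.roots T = m.links.roots T := by
    rw [links₁, Links.roots_pushRoot h.forest.notMem hpar]
  refine ⟨by omega, size₁, links₁ ▸ h.forest.pushRoot hpar, ?_, ?_, ⟨roots₁, ?_⟩, nodup, ?_, ?_, ?_⟩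
  · rw [links₁]
    exact (update_le_self_iff.2 zero_le).trans h.marks
  · rw [x₁, links₁]
    exact rest.congr fun c hc => update_of_ne (hne c (List.mem_append_left _ hc)) ..
  · rw [links₁, Links.pushRoot_nxt, update_self]
    exact h.chain.congr fun c hc => update_of_ne (hne c (List.mem_append_right _ hc)) ..
  · rw [hroots]
    exact fun c hc => h.child c (List.mem_cons_of_mem _ hc)
  · rw [hroots, links₁]
    rintro c hc hcv
    rcases eq_or_ne c x with rfl | hcx
    · exact ⟨hroot, update_self .., update_self ..⟩
    · rw [Links.pushRoot_par, Links.pushRoot_mrk, update_of_ne hcx, update_of_ne hcx]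
      exact h.root c (List.mem_of_ne_of_mem hcx hc) hcv
  · rw [hroots]
    intro c hc
    simpa only [List.mem_cons, or_assoc, or_left_comm] using h.mem c hc

theorem IsPromoting.halts_loop (h : IsPromoting n T v f L rt m) :
    Halts (loop (.ne (.reg .x) (.reg .n))
      (mov .nx (.cell .nxt .x) ;; SP.pushRoot .x ;; mov .x (.reg .nx))) m fun t _ m' =>
      t ≤ 7 * L.length + 1 ∧ ∃ rt', rt'.length = rt.length + L.length ∧
        IsPromoting n T v f [] rt' m' := by
  refine (halts_loop_of_credit (I := fun p m => ∃ L' rt', IsPromoting n T v f L' rt' m ∧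
    rt'.length + L'.length = rt.length + L.length ∧ 7 * L'.length ≤ p) ?_
    ⟨L, rt, h, rfl, le_rfl⟩).mono ?_
  · rintro p m ⟨L', rt', h, hlen, hp⟩ hx
    cases L' with
    | nil => exact absurd (h.rest.trans h.size.symm) hx
    | cons x L' =>
      refine h.halts_body.mono ?_
      rintro t - m' - ⟨ht, h'⟩
      rw [List.length_cons] at hlen hp
      exact ⟨7 * L'.length, ⟨L', _, h', by rw [List.length_cons]; omega, le_rfl⟩, by omega⟩
  · rintro t - m' - ⟨q, ⟨L', rt', h', hlen, hq⟩, hx, ht⟩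
    have hnil : L' = [] := by
      refine (h'.rest.eq_iff_eq_nil fun hn => ?_).1 ((not_not.1 hx).trans h'.size)
      exact h'.forest.notMem (Links.mem_roots.1 (h'.child n hn)).1
    subst hnil
    exact ⟨by omega, rt', hlen, h'⟩

end Promote

section Table

variable {n : ℕ} {T : Finset ℕ} {H : Links} {tbl : ℕ → ℕ} {k d x y a : ℕ} {W W' P : List ℕ}

/-- Every root occurs in `W` or in the table, but not in both, and the entry of the table at `d`,
unless null, has degree `d`, which is at most `k`. -/
structure IsTable (n : ℕ) (T : Finset ℕ) (H : Links) (tbl : ℕ → ℕ) (k : ℕ) (W : List ℕ) :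
    Prop where
  par : ∀ c ∈ H.roots T, H.par c = n
  mrk : ∀ c ∈ H.roots T, H.mrk c = 0
  mem : ∀ c ∈ H.roots T, c ∈ W ∨ tbl (H.deg c) = c
  entry : ∀ d < n, tbl d ≠ n → tbl d ∈ H.roots T ∧ H.deg (tbl d) = d ∧ tbl d ∉ W ∧ d ≤ k

namespace IsTable

theorem congr (h : IsTable n T H tbl k W) (hW : ∀ c ∈ H.roots T, c ∈ W' ↔ c ∈ W) :
    IsTable n T H tbl k W' where
  par := h.par
  mrk := h.mrk
  mem c hc := (h.mem c hc).imp_left (hW c hc).2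
  entry d hd hne := by
    obtain ⟨hroot, hdeg, hW', hk⟩ := h.entry d hd hne
    exact ⟨hroot, hdeg, mt (hW _ hroot).1 hW', hk⟩

theorem withdraw (h : IsTable n T H tbl k W) (hd : d < n) (hne : tbl d ≠ n) :
    IsTable n T H (update tbl d n) k (tbl d :: W) where
  par := h.par
  mrk := h.mrk
  mem c hc := by
    rw [List.mem_cons, or_assoc, or_iff_not_imp_left]
    intro hcd
    refine (h.mem c hc).imp_right fun hct => ?_
    rw [update_of_ne, hct]
    rintro rfl
    exact hcd hct.symm
  entry i hi hit := by
    have hid : i ≠ d := by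
      rintro rfl
      exact hit (update_self ..)
    rw [update_of_ne hid] at hit ⊢
    obtain ⟨hroot, hdeg, hW, hk⟩ := h.entry i hi hit
    refine ⟨hroot, hdeg, List.not_mem_cons_of_ne_of_not_mem (fun heq => hid ?_) hW, hk⟩
    rw [← hdeg, heq, (h.entry d hd hne).2.1]

theorem enter (h : IsTable n T H tbl k (x :: P)) (hn : n ∉ T) (hx : x ∈ H.roots T) (hxP : x ∉ P)
    (hfree : tbl (H.deg x) = n) :
    IsTable n T H (update tbl (H.deg x) x) (max k (H.deg x)) P where
  par := h.par
  mrk := h.mrk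
  mem c hc := by
    rcases h.mem c hc with hcW | hct
    · rcases List.mem_cons.1 hcW with rfl | hcP
      exacts [.inr (update_self ..), .inl hcP]
    · rw [update_of_ne, hct]
      · exact .inr rfl
      · intro hdeg
        rw [hdeg, hfree] at hct
        exact hn (hct ▸ (Links.mem_roots.1 hc).1)
  entry i hi hit := by
    rcases eq_or_ne i (H.deg x) with rfl | hid
    · rw [update_self]
      exact ⟨hx, rfl, hxP, le_max_right _ _⟩
    · rw [update_of_ne hid] at hit ⊢
      obtain ⟨hroot, hdeg, hW, hk⟩ := h.entry i hi hit
      exact ⟨hroot, hdeg, List.not_mem_of_not_mem_cons hW, hk.trans (le_max_left _ _)⟩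

theorem link (h : IsTable n T H tbl k (x :: y :: P)) (hx : x ∈ H.roots T) :
    IsTable n T (H.link n x y) tbl k (x :: P) := by
  have hroots : (H.link n x y).roots T = (H.roots T).erase y :=
    Links.roots_link (Links.mem_roots.1 hx).1
  constructor <;> simp only [hroots, Finset.mem_erase]
  · rintro c ⟨hcy, hc⟩
    rw [Links.link_par, update_of_ne hcy, h.par c hc]
  · rintro c ⟨hcy, hc⟩
    rw [Links.link_mrk, update_of_ne hcy, h.mrk c hc]
  · rintro c ⟨hcy, hc⟩
    rcases eq_or_ne c x with rfl | hcx
    · exact .inl List.mem_cons_self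
    · rw [Links.link_deg, update_of_ne hcx]
      simpa [hcx, hcy] using h.mem c hc
  · intro i hi hit
    obtain ⟨hroot, hdeg, hW, hk⟩ := h.entry i hi hit
    simp only [List.mem_cons, not_or] at hW ⊢
    rw [Links.link_deg, update_of_ne hW.1]
    exact ⟨⟨hW.2.1, hroot⟩, hdeg, ⟨hW.1, hW.2.2⟩, hk⟩

theorem pushRoot (h : IsTable n T H tbl k W) (hn : n ∉ T) (hx : H.par x ∉ T) :
    IsTable n T (H.pushRoot n x a) tbl k W := by
  constructor <;> simp only [Links.roots_pushRoot hn hx]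
  · intro c hc
    rw [Links.pushRoot_par, update_apply, h.par c hc, ite_self]
  · intro c hc
    rw [Links.pushRoot_mrk, update_apply, h.mrk c hc, ite_self]
  · exact h.mem
  · exact h.entry

end IsTable

end Table

section Consolidate

variable {n : ℕ} {T : Finset ℕ} {v : ℕ} {f : ℕ → ℕ} {H : Links} {tbl : ℕ → ℕ} {k a x y d : ℕ}
  {P W : List ℕ} {m : Mem}

/-- The state while the roots are entered into `tbl`: the list `P` starting at `a`, which may
contain the removed root `v`, still has to be scanned, and `W` lists the roots missing from the
table. -/
structure IsConsolidating (n : ℕ) (T : Finset ℕ) (v : ℕ) (f : ℕ → ℕ) (H : Links) (tbl : ℕ → ℕ)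
    (k a : ℕ) (P W : List ℕ) : Prop where
  forest : IsFibForest n T H 0 ∅
  marks : H.mrk ≤ f
  chain : Chain H.nxt a P n
  nodup : P.Nodup
  pending : ∀ c ∈ P, c ≠ v → c ∈ H.roots T
  table : IsTable n T H tbl k W
  maxDeg_lt : k < n
  maxDeg_le : k ≤ 2 * Nat.log 2 n + 1

namespace IsConsolidating

theorem card_roots_le (h : IsConsolidating n T v f H tbl k a P W) (empty : ∀ i < n, tbl i = n) :
    (H.roots T).card ≤ W.length := by
  refine (Finset.card_le_card fun c hc => ?_).trans W.toFinset_card_le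
  refine List.mem_toFinset.2 ((h.table.mem c hc).resolve_right fun hct => ?_)
  rw [empty _ (h.forest.deg_lt hc)] at hct
  exact h.forest.notMem (hct ▸ (Links.mem_roots.1 hc).1)

theorem link (h : IsConsolidating n T v f H tbl k a P (x :: y :: P)) (hx : x ∈ H.roots T)
    (hy : y ∈ H.roots T) (hxy : x ≠ y) (hyP : y ∉ P) (hdeg : H.deg x = H.deg y)
    (hkey : H.key x ≤ H.key y) :
    IsConsolidating n T v f (H.link n x y) tbl k a P (x :: P) where
  forest := h.forest.link hx hy hxy hdeg hkey
  marks := (update_le_self_iff.2 zero_le).trans h.marks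
  chain := h.chain.congr fun _ hc => update_of_ne (ne_of_mem_of_not_mem hc hyP) ..
  nodup := h.nodup
  pending c hc hcv := by
    rw [Links.roots_link (Links.mem_roots.1 hx).1, Finset.mem_erase]
    exact ⟨ne_of_mem_of_not_mem hc hyP, h.pending c hc hcv⟩
  table := h.table.link hx
  maxDeg_lt := h.maxDeg_lt
  maxDeg_le := h.maxDeg_le

theorem enter (h : IsConsolidating n T v f H tbl k a P (x :: P)) (hx : x ∈ H.roots T)
    (hxP : x ∉ P) (hfree : tbl (H.deg x) = n) :
    IsConsolidating n T v f H (update tbl (H.deg x) x) (max k (H.deg x)) a P P :=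
  { h with
    table := h.table.enter h.forest.notMem hx hxP hfree
    maxDeg_lt := max_lt h.maxDeg_lt (h.forest.deg_lt hx)
    maxDeg_le := max_le h.maxDeg_le (h.forest.deg_le_log hx) }

theorem null_notMem (h : IsConsolidating n T v f H tbl k a P W) (hvn : v ≠ n) : n ∉ P :=
  fun hn => h.forest.notMem (Links.mem_roots.1 (h.pending n hn hvn.symm)).1

end IsConsolidating

/-- The part of `enterTable` that withdraws the tree of the same degree as `x` from the table and
lets `x` and `y` point to the roots of the two trees, with `x` the one of smaller key. -/
def selectPair : Com :=
  mov .y (.cell .table .d) ;;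
  put .table .d (.reg .n) ;;
  cond (.numLt (.cell .key .y) (.cell .key .x))
    (mov .c (.reg .x) ;; mov .x (.reg .y) ;; mov .y (.reg .c))
    skip

/-- The body of the loop of `enterTable`. -/
def linkEqualDegree : Com :=
  mov .y (.cell .table .d) ;;
  put .table .d (.reg .n) ;;
  cond (.numLt (.cell .key .y) (.cell .key .x))
    (mov .c (.reg .x) ;; mov .x (.reg .y) ;; mov .y (.reg .c))
    skip ;;
  SP.link ;;
  inc .d

theorem halts_linkEqualDegree {Q : ℕ → List Label → Mem → Prop} :
    Halts linkEqualDegree m Q ↔ Halts (selectPair ;; SP.link ;; inc .d) m Q := by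
  simp only [linkEqualDegree, selectPair, halts_seq, add_assoc, List.append_assoc]

theorem halts_selectPair : Halts selectPair m fun t _ m' => t ≤ 6 ∧ m'.links = m.links ∧
    m'.cell .table = update (m.cell .table) (m.reg .d) (m.reg .n) ∧
    m.num .key (m'.reg .x) ≤ m.num .key (m'.reg .y) ∧
    (m'.reg .x = m.reg .x ∧ m'.reg .y = m.cell .table (m.reg .d) ∨
      m'.reg .x = m.cell .table (m.reg .d) ∧ m'.reg .y = m.reg .x) := by
  by_cases hlt : m.num .key (m.cell .table (m.reg .d)) < m.num .key (m.reg .x)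
  · simp [selectPair, hlt, hlt.le, Mem.links]
  · simp [selectPair, hlt, not_lt.1 hlt, Mem.links]

/-- The state while the root `x` is being entered into the table, after some links. -/
structure IsEntering (n : ℕ) (T : Finset ℕ) (v : ℕ) (f : ℕ → ℕ) (P : List ℕ) (m : Mem) :
    Prop where
  size : m.reg .n = n
  removed : m.reg .v = v
  state : IsConsolidating n T v f m.links (m.cell .table) (m.reg .maxDeg) (m.reg .nx) P
    (m.reg .x :: P)
  root : m.reg .x ∈ m.links.roots T
  scanned : m.reg .x ∉ P
  degree : m.reg .d = m.links.deg (m.reg .x)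

namespace IsEntering

theorem halts_selectPair (h : IsEntering n T v f P m)
    (hne : m.cell .table (m.reg .d) ≠ n) : Halts selectPair m fun t _ m' => t ≤ 6 ∧
      m'.links = m.links ∧
      IsConsolidating n T v f m.links (m'.cell .table) (m.reg .maxDeg) (m.reg .nx) P
        (m'.reg .x :: m'.reg .y :: P) ∧
      m.links.key (m'.reg .x) ≤ m.links.key (m'.reg .y) ∧ m'.reg .x ≠ m'.reg .y ∧
      ∀ c ∈ [m'.reg .x, m'.reg .y], c ∈ m.links.roots T ∧ c ∉ P ∧ m.links.deg c = m.reg .d := by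
  refine SP.halts_selectPair.mono ?_
  rintro t - m' - ⟨ht, links', table', hkey, hxy⟩
  have hd : m.reg .d < n := h.degree ▸ h.state.forest.deg_lt h.root
  obtain ⟨hroot, hdeg, hW, -⟩ := h.state.table.entry _ hd hne
  simp only [List.mem_cons, not_or] at hW
  have withdrawn := h.state.table.withdraw hd hne
  have hx : m.reg .x ∈ m.links.roots T ∧ m.reg .x ∉ P ∧ m.links.deg (m.reg .x) = m.reg .d :=
    ⟨h.root, h.scanned, h.degree.symm⟩
  rw [table', h.size]
  simp only [List.forall_mem_cons, List.not_mem_nil, false_imp_iff, implies_true, and_true]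
  rcases hxy with ⟨hx', hy'⟩ | ⟨hx', hy'⟩ <;> rw [hx', hy'] at hkey ⊢
  · exact ⟨ht, links', { h.state with table := withdrawn.congr fun c _ => by simp [or_left_comm] },
      hkey, Ne.symm hW.1, hx, hroot, hW.2, hdeg⟩
  · exact ⟨ht, links', { h.state with table := withdrawn }, hkey, hW.1, ⟨hroot, hW.2, hdeg⟩, hx⟩

theorem halts_linkEqualDegree (h : IsEntering n T v f P m) (hne : m.cell .table (m.reg .d) ≠ n) :
    Halts linkEqualDegree m fun t _ m' => t ≤ 16 ∧ IsEntering n T v f P m' ∧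
      (m'.links.roots T).card + 1 = (m.links.roots T).card := by
  simp only [SP.halts_linkEqualDegree, halts_seq, halts_inc]
  refine (h.halts_selectPair hne).mono ?_
  rintro t₁ _ m₁ exec₁ ⟨ht₁, links₁, state₁, hkey, hxy, hmem⟩
  obtain ⟨hx, hxP, hdegx⟩ := hmem _ List.mem_cons_self
  obtain ⟨hy, hyP, hdegy⟩ := hmem (m₁.reg .y) (by simp)
  have size₁ : m₁.reg .n = n := (exec₁.reg_eq rfl).trans h.size
  refine halts_link.mono ?_
  rintro t₂ _ m₂ exec₂ ⟨ht₂, links₂⟩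
  have x₂ : m₂.reg .x = m₁.reg .x := exec₂.reg_eq rfl
  have nx₂ : m₂.reg .nx = m.reg .nx := (exec₂.reg_eq rfl).trans (exec₁.reg_eq rfl)
  have maxDeg₂ : m₂.reg .maxDeg = m.reg .maxDeg := (exec₂.reg_eq rfl).trans (exec₁.reg_eq rfl)
  have d₂ : m₂.reg .d = m.reg .d := (exec₂.reg_eq rfl).trans (exec₁.reg_eq rfl)
  have table₂ : m₂.cell .table = m₁.cell .table := exec₂.cell_eq rfl
  rw [links₁, size₁] at links₂
  have roots₂ : m₂.links.roots T = (m.links.roots T).erase (m₁.reg .y) := by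
    rw [links₂, Links.roots_link (Links.mem_roots.1 hx).1]
  have state₂ := state₁.link hx hy hxy hyP (hdegx.trans hdegy.symm) hkey
  rw [← links₂, ← x₂, ← table₂, ← nx₂, ← maxDeg₂] at state₂
  refine ⟨by omega, ⟨?_, ?_, state₂, ?_, ?_, ?_⟩, ?_⟩
  · exact (exec₂.reg_eq rfl).trans size₁
  · exact (exec₂.reg_eq rfl).trans ((exec₁.reg_eq rfl).trans h.removed)
  · change m₂.reg .x ∈ m₂.links.roots T
    rw [x₂, roots₂]
    exact Finset.mem_erase.2 ⟨hxy, hx⟩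
  · change m₂.reg .x ∉ P
    rwa [x₂]
  · change m₂.reg .d + 1 = m₂.links.deg (m₂.reg .x)
    rw [x₂, links₂, Links.link_deg, update_self, d₂, hdegx]
  · change (m₂.links.roots T).card + 1 = _
    rw [roots₂, Finset.card_erase_add_one hy]

theorem halts_loop (h : IsEntering n T v f P m) :
    Halts (loop (.ne (.cell .table .d) (.reg .n)) linkEqualDegree) m fun t _ m' =>
      IsEntering n T v f P m' ∧ m'.cell .table (m'.reg .d) = n ∧
        t + 17 * (m'.links.roots T).card ≤ 17 * (m.links.roots T).card + 1 := by
  refine (halts_loop_of_credit (I := fun p m => IsEntering n T v f P m ∧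
    17 * (m.links.roots T).card ≤ p) ?_ ⟨h, le_rfl⟩).mono ?_
  · rintro p m ⟨h, hp⟩ hne
    refine (h.halts_linkEqualDegree (h.size ▸ hne)).mono ?_
    rintro t - m' - ⟨ht, h', hcard⟩
    exact ⟨_, ⟨h', le_rfl⟩, by omega⟩
  · rintro t - m' - ⟨q, ⟨h', hq⟩, hnull, ht⟩
    exact ⟨h', (not_not.1 hnull).trans h'.size, by omega⟩

end IsEntering

theorem halts_enterTable (size : m.reg .n = n) (removed : m.reg .v = v)
    (state : IsConsolidating n T v f m.links (m.cell .table) (m.reg .maxDeg) (m.reg .nx) P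
      (m.reg .x :: P)) (hx : m.reg .x ∈ m.links.roots T) (hxP : m.reg .x ∉ P) :
    Halts enterTable m fun t _ m' => m'.reg .n = n ∧ m'.reg .v = v ∧
      IsConsolidating n T v f m'.links (m'.cell .table) (m'.reg .maxDeg) (m'.reg .nx) P P ∧
      t + 17 * (m'.links.roots T).card ≤ 17 * (m.links.roots T).card + 5 := by
  rw [enterTable, halts_seq, halts_mov, halts_seq]
  have entering : IsEntering n T v f P (m.setReg .d (m.links.deg (m.reg .x))) :=
    ⟨size, removed, state, hx, hxP, rfl⟩
  refine entering.halts_loop.mono ?_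
  rintro t - m₁ - ⟨h, hfree, ht⟩
  have state' := h.state.enter h.root h.scanned (h.degree ▸ hfree)
  rw [← h.degree] at state'
  change t + 17 * (m₁.links.roots T).card ≤ 17 * (m.links.roots T).card + 1 at ht
  simp only [halts_seq, halts_put, halts_cond, halts_mov, halts_skip]
  by_cases hlt : m₁.reg .maxDeg < m₁.reg .d
  · rw [max_eq_right hlt.le] at state'
    rw [if_pos (by simpa using hlt)]
    refine ⟨h.size, h.removed, state', ?_⟩
    change 1 + (t + (1 + (1 + 1))) + 17 * (m₁.links.roots T).card ≤ _
    omega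
  · rw [max_eq_left (not_lt.1 hlt)] at state'
    rw [if_neg (by simpa using hlt)]
    refine ⟨h.size, h.removed, state', ?_⟩
    change 1 + (t + (1 + (1 + 1))) + 17 * (m₁.links.roots T).card ≤ _
    omega

theorem halts_scanRoot (hv : v ∉ T) (size : m.reg .n = n) (removed : m.reg .v = v)
    (state : IsConsolidating n T v f m.links (m.cell .table) (m.reg .maxDeg) (m.reg .x) (x :: P)
      (x :: P)) :
    Halts (mov .nx (.cell .nxt .x) ;; cond (.ne (.reg .x) (.reg .v)) enterTable skip ;;
      mov .x (.reg .nx)) m fun t _ m' => m'.reg .n = n ∧ m'.reg .v = v ∧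
        IsConsolidating n T v f m'.links (m'.cell .table) (m'.reg .maxDeg) (m'.reg .x) P P ∧
        t + 17 * (m'.links.roots T).card ≤ 17 * (m.links.roots T).card + 8 := by
  obtain ⟨rfl, chain⟩ := state.chain
  obtain ⟨hxP, nodup⟩ := List.nodup_cons.1 state.nodup
  have state' : IsConsolidating n T v f m.links (m.cell .table) (m.reg .maxDeg)
      (m.links.nxt (m.reg .x)) P (m.reg .x :: P) :=
    { state with
      chain := chain
      nodup := nodup
      pending c hc := state.pending c (List.mem_cons_of_mem _ hc) }
  simp only [halts_seq, halts_mov, halts_cond, halts_skip]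
  set m₁ := Mem.setReg _ Reg.nx _
  split_ifs with hxv
  · have hx := state.pending _ List.mem_cons_self fun h => hxv (h.trans removed.symm)
    refine (halts_enterTable (m := m₁) size removed state' hx hxP).mono ?_
    rintro t - m₂ - ⟨size₂, removed₂, state₂, ht⟩
    change t + _ ≤ 17 * (m.links.roots T).card + 5 at ht
    refine ⟨size₂, removed₂, state₂, ?_⟩
    change 1 + (1 + t + 1) + 17 * (m₂.links.roots T).card ≤ _
    omega
  · refine ⟨size, removed, { state' with table := state.table.congr fun c hc => ?_ }, ?_⟩
    · have hcx : c ≠ m.reg .x := by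
        rintro rfl
        exact hv (not_not.1 hxv |>.trans removed ▸ (Links.mem_roots.1 hc).1)
      simp [hcx]
    · change 1 + (1 + 1 + 1) + 17 * (m.links.roots T).card ≤ _
      omega

theorem halts_consolidate (hv : v ∉ T) (hvn : v ≠ n) (size : m.reg .n = n) (removed : m.reg .v = v)
    (state : IsConsolidating n T v f m.links (m.cell .table) 0 (m.reg .roots) P P) :
    Halts consolidate m fun t _ m' => m'.reg .n = n ∧ m'.reg .v = v ∧
      IsConsolidating n T v f m'.links (m'.cell .table) (m'.reg .maxDeg) n [] [] ∧
      t + 17 * (m'.links.roots T).card ≤ 17 * (m.links.roots T).card + 10 * P.length + 3 := by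
  let I (p : ℕ) (m : Mem) : Prop := m.reg .n = n ∧ m.reg .v = v ∧ ∃ P',
    IsConsolidating n T v f m.links (m.cell .table) (m.reg .maxDeg) (m.reg .x) P' P' ∧
      17 * (m.links.roots T).card + 10 * P'.length ≤ p
  have init : I (17 * (m.links.roots T).card + 10 * P.length)
      ((m.setReg .maxDeg 0).setReg .x (m.reg .roots)) :=
    ⟨size, removed, P, state, le_rfl⟩
  rw [consolidate, halts_seq, halts_mov, halts_seq, halts_mov]
  refine (halts_loop_of_credit ?_ init).mono ?_
  · rintro p m ⟨size, removed, P, state, hp⟩ hx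
    cases P with
    | nil => exact absurd (state.chain.trans size.symm) hx
    | cons x P =>
      refine (halts_scanRoot hv size removed state).mono ?_
      rintro t - m' - ⟨size', removed', state', ht⟩
      rw [List.length_cons] at hp
      exact ⟨_, ⟨size', removed', P, state', le_rfl⟩, by omega⟩
  · rintro t - m' - ⟨q, ⟨size', removed', P', state', hq⟩, hx, ht⟩
    have hxn : m'.reg .x = n := (not_not.1 hx).trans size'
    obtain rfl : P' = [] := (state'.chain.eq_iff_eq_nil (state'.null_notMem hvn)).1 hxn
    refine ⟨size', removed', hxn ▸ state', ?_⟩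
    omega

end Consolidate

section Rebuild

variable {n : ℕ} {T : Finset ℕ} {f : ℕ → ℕ} {k : ℕ} {rt : List ℕ} {m : Mem}

/-- The state while the table, whose entries have degree at most `k`, is turned into the list `rt`
of roots: its first `d` entries have been removed. -/
structure IsRebuilding (n : ℕ) (T : Finset ℕ) (f : ℕ → ℕ) (k : ℕ) (rt : List ℕ) (m : Mem) :
    Prop where
  size : m.reg .n = n
  maxDeg : m.reg .maxDeg = k
  forest : IsFibForest n T m.links 0 ∅
  marks : m.links.mrk ≤ f
  chain : Chain m.links.nxt (m.reg .roots) rt n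
  nodup : rt.Nodup
  mem : ∀ c ∈ rt, c ∈ m.links.roots T
  table : IsTable n T m.links (m.cell .table) k rt
  removed : ∀ i < m.reg .d, m.cell .table i = n
  length : rt.length ≤ m.reg .d
  d_le : m.reg .d ≤ k + 1
  hmin : IsMinRoot n m.links rt (m.reg .hmin)

namespace IsRebuilding

theorem null_notMem (h : IsRebuilding n T f k rt m) : n ∉ rt :=
  fun hn => h.forest.notMem (Links.mem_roots.1 (h.mem n hn)).1

theorem takeRoot {m' : Mem} {x : ℕ} (h : IsRebuilding n T f k rt m) (hk : k < n)
    (hd : m.reg .d ≤ k) (hx : x = m.cell .table (m.reg .d)) (hxn : x ≠ n)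
    (size' : m'.reg .n = n) (maxDeg' : m'.reg .maxDeg = k)
    (links' : m'.links = m.links.pushRoot n x (m.reg .roots)) (roots' : m'.reg .roots = x)
    (table' : m'.cell .table = update (m.cell .table) (m.reg .d) n)
    (d' : m'.reg .d = m.reg .d + 1) (hmin' : IsMinRoot n m.links (x :: rt) (m'.reg .hmin)) :
    IsRebuilding n T f k (x :: rt) m' := by
  have hdn : m.reg .d < n := by omega
  have withdrawn := h.table.withdraw hdn (hx ▸ hxn)
  obtain ⟨hroot, -, hrt, -⟩ := h.table.entry _ hdn (hx ▸ hxn)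
  rw [← hx] at hroot hrt withdrawn
  have hpar := (Links.mem_roots.1 hroot).2
  constructor
  · exact size'
  · exact maxDeg'
  · exact links' ▸ h.forest.pushRoot hpar
  · rw [links']
    exact (update_le_self_iff.2 zero_le).trans h.marks
  · rw [roots', links', chain_cons, Links.pushRoot_nxt, update_self]
    exact ⟨rfl, h.chain.congr fun c hc => update_of_ne (ne_of_mem_of_not_mem hc hrt) ..⟩
  · exact List.nodup_cons.2 ⟨hrt, h.nodup⟩
  · rw [links', Links.roots_pushRoot h.forest.notMem hpar]
    exact List.forall_mem_cons.2 ⟨hroot, h.mem⟩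
  · rw [links', table']
    exact withdrawn.pushRoot h.forest.notMem hpar
  · intro i hi
    rw [table', update_apply]
    split_ifs with hid
    exacts [rfl, h.removed i (by omega)]
  · rw [d', List.length_cons]
    exact Nat.succ_le_succ h.length
  · rw [d']
    exact Nat.succ_le_succ hd
  · rw [links']
    exact hmin'

theorem halts_body (h : IsRebuilding n T f k rt m) (hk : k < n) (hd : m.reg .d ≤ k) :
    Halts (mov .x (.cell .table .d) ;;
      cond (.ne (.reg .x) (.reg .n))
        (put .table .d (.reg .n) ;; SP.pushRoot .x ;; updateMin .x)
        skip ;;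
      inc .d) m fun t _ m' => t ≤ 11 ∧ m'.reg .d = m.reg .d + 1 ∧
        ∃ rt', IsRebuilding n T f k rt' m' := by
  simp only [SP.pushRoot, halts_seq, halts_put, halts_mov, halts_cond, halts_skip, halts_inc]
  split_ifs with hxn
  · replace hxn : m.cell .table (m.reg .d) ≠ n := h.size ▸ hxn
    set m₁ := Mem.setReg _ Reg.roots _ with hm₁
    have links₁ : m₁.links = m.links.pushRoot n (m.cell .table (m.reg .d)) (m.reg .roots) := by
      simp [hm₁, h.size, Mem.links, Links.pushRoot]
    have table₁ : m₁.cell .table = update (m.cell .table) (m.reg .d) n := by simp [hm₁, h.size]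
    have x₁ : m₁.reg .x = m.cell .table (m.reg .d) := by simp [hm₁]
    have roots₁ : m₁.reg .roots = m₁.reg .x := by simp [hm₁]
    have reg₁ : ∀ r ≠ .roots, r ≠ .x → m₁.reg r = m.reg r := fun r hr hrx => by simp [hm₁, hr, hrx]
    clear_value m₁
    have hmin₁ : IsMinRoot n m₁.links rt (m₁.reg .hmin) := by
      rw [links₁, reg₁ _ (by decide) (by decide)]
      exact h.hmin
    have size₁ : m₁.reg .n = n := (reg₁ _ (by decide) (by decide)).trans h.size
    refine (hmin₁.halts_updateMin (r := .x) size₁ h.null_notMem).mono ?_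
    rintro t - _ - ⟨ht, b, rfl, hmin⟩
    have d' : m₁.reg .d + 1 = m.reg .d + 1 := by rw [reg₁ _ (by decide) (by decide)]
    rw [links₁, x₁] at hmin
    exact ⟨by omega, d', _, h.takeRoot hk hd rfl hxn size₁
      ((reg₁ _ (by decide) (by decide)).trans h.maxDeg) links₁ (roots₁.trans x₁) table₁ d' hmin⟩
  · refine ⟨by omega, rfl, rt, { h with
      removed := fun i hi => ?_
      length := h.length.trans (Nat.le_succ _)
      d_le := Nat.succ_le_succ hd }⟩
    rcases Nat.lt_succ_iff_lt_or_eq.1 hi with hi | rfl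
    exacts [h.removed i hi, (not_not.1 hxn).trans h.size]

theorem halts_loop (h : IsRebuilding n T f k rt m) (hk : k < n) :
    Halts (loop (.le (.reg .d) (.reg .maxDeg))
      (mov .x (.cell .table .d) ;;
       cond (.ne (.reg .x) (.reg .n))
         (put .table .d (.reg .n) ;; SP.pushRoot .x ;; updateMin .x)
         skip ;;
       inc .d)) m fun t _ m' => t + 12 * m.reg .d ≤ 12 * (k + 1) + 1 ∧
         ∃ rt', IsRebuilding n T f k rt' m' ∧ k < m'.reg .d := by
  refine (halts_loop_of_credit (I := fun p m => (∃ rt', IsRebuilding n T f k rt' m) ∧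
    12 * (k + 1) ≤ p + 12 * m.reg .d) (p := 12 * (k + 1) - 12 * m.reg .d) ?_
    ⟨⟨rt, h⟩, by omega⟩).mono ?_
  · rintro p m ⟨⟨rt', h⟩, hp⟩ hd
    replace hd : m.reg .d ≤ k := h.maxDeg ▸ hd
    refine (h.halts_body hk hd).mono ?_
    rintro t - m' - ⟨ht, d', h'⟩
    exact ⟨p - 12, ⟨h', by omega⟩, by omega⟩
  · rintro t - m' - ⟨q, ⟨⟨rt', h'⟩, -⟩, hd, ht⟩
    have := h.d_le
    exact ⟨by omega, rt', h', by simpa [h'.maxDeg] using hd⟩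

theorem table_eq_null (h : IsRebuilding n T f k rt m) (hd : k < m.reg .d) {i : ℕ} (hi : i < n) :
    m.cell .table i = n := by
  by_contra hne
  exact hne (h.removed i ((h.table.entry i hi hne).2.2.2.trans_lt hd))

theorem isRootList (h : IsRebuilding n T f k rt m) (hd : k < m.reg .d) :
    IsRootList n T m.links (m.reg .roots) rt where
  chain := h.chain
  nodup := h.nodup
  mem c := by
    refine ⟨h.mem c, fun hc => (h.table.mem c hc).resolve_right fun hct => ?_⟩
    rw [h.table_eq_null hd (h.forest.deg_lt hc)] at hct
    exact h.forest.notMem (hct ▸ (Links.mem_roots.1 hc).1)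
  par c hc := h.table.par c (h.mem c hc)
  mrk c hc := h.table.mrk c (h.mem c hc)

end IsRebuilding

theorem IsConsolidating.halts_rebuildRoots {v a : ℕ} (size : m.reg .n = n)
    (h : IsConsolidating n T v f m.links (m.cell .table) (m.reg .maxDeg) a [] []) :
    Halts rebuildRoots m fun t _ m' => t ≤ 12 * (m.reg .maxDeg + 1) + 4 ∧ ∃ rt,
      IsRootList n T m'.links (m'.reg .roots) rt ∧ rt.length ≤ m.reg .maxDeg + 1 ∧
      IsFibForest n T m'.links 0 ∅ ∧ m'.links.mrk ≤ f ∧ (∀ i < n, m'.cell .table i = n) ∧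
      IsMinRoot n m'.links rt (m'.reg .hmin) := by
  have init : IsRebuilding n T f (m.reg .maxDeg) []
      (((m.setReg .roots n).setReg .hmin n).setReg .d 0) :=
    { size := size
      maxDeg := rfl
      forest := h.forest
      marks := h.marks
      chain := rfl
      nodup := List.nodup_nil
      mem := by simp
      table := h.table
      removed := by simp
      length := Nat.zero_le _
      d_le := Nat.zero_le _
      hmin := .inl ⟨rfl, rfl⟩ }
  simp only [rebuildRoots, halts_seq, halts_mov, Word.eval, Mem.setReg_reg, size, reduceCtorEq,
    if_false]
  refine (init.halts_loop h.maxDeg_lt).mono ?_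
  rintro t - m' - ⟨ht, rt, h', hd⟩
  have hlen := h'.length
  have hle := h'.d_le
  exact ⟨by omega, rt, h'.isRootList hd, by omega, h'.forest, h'.marks,
    fun i hi => h'.table_eq_null hd hi, h'.hmin⟩

end Rebuild

theorem potential_erase_le {S : Finset ℕ} {H H' : Links} {rt : List ℕ} {v : ℕ}
    (h : H'.mrk ≤ H.mrk) :
    potential (S.erase v) H' rt ≤ rt.length + 2 * ∑ x ∈ S, H.mrk x := by
  have hsum := (Finset.sum_le_sum fun x _ => h x).trans
    (Finset.sum_le_sum_of_subset (f := H.mrk) (Finset.erase_subset v S))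
  exact Nat.add_le_add_left (Nat.mul_le_mul_left 2 hsum) _

namespace IsHeap

variable {n : ℕ} {S : Finset ℕ} {rt : List ℕ} {m : Mem}

theorem isPromoting (h : IsHeap n S m rt) {v : ℕ} (hv : v ∈ rt) : ∃ L, L.length = m.links.deg v ∧
    IsPromoting n (S.erase v) v m.links.mrk L rt (m.setReg .x (m.links.chd v)) := by
  obtain ⟨ch, F, -⟩ := h.forest
  obtain ⟨hvS, hpar⟩ := Links.mem_roots.1 ((h.roots.mem v).1 hv)
  refine ⟨ch v, (F.deg v hvS).symm, h.size, h.forest.erase hpar, le_rfl, F.next v hvS,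
    h.roots.chain, ?_, fun c hc => ?_, fun c hc hcv => ?_, fun c hc => ?_⟩
  · refine (F.nodup v hvS).append h.roots.nodup fun c hc hcrt => ?_
    exact (Links.mem_roots.1 ((h.roots.mem c).1 hcrt)).2 (F.not_root_of_mem hvS hc)
  · obtain ⟨hcS, rfl⟩ := (F.mem v hvS c).1 hc
    exact Links.mem_roots.2 ⟨Finset.mem_erase.2 ⟨(F.par_ne hcS).symm, hcS⟩,
      Finset.notMem_erase _ _⟩
  · obtain ⟨hcS, hp⟩ := Links.mem_roots.1 ((h.roots.mem c).1 hc)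
    exact ⟨Links.mem_roots.2
      ⟨Finset.mem_erase.2 ⟨hcv, hcS⟩, fun hp' => hp (Finset.mem_of_mem_erase hp')⟩,
      h.roots.par c hc, h.roots.mrk c hc⟩
  · obtain ⟨hcT, hp⟩ := Links.mem_roots.1 hc
    have hcS := Finset.mem_of_mem_erase hcT
    rw [F.mem v hvS, h.roots.mem]
    rcases eq_or_ne (m.links.par c) v with heq | hne
    · exact .inl ⟨hcS, heq⟩
    · exact .inr (Links.mem_roots.2 ⟨hcS, fun hp' => hp (Finset.mem_erase.2 ⟨hne, hp'⟩)⟩)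

theorem halts_promoteChildren (h : IsHeap n S m rt) (hv : m.reg .v ∈ rt) :
    Halts promoteChildren m fun t _ m' => t ≤ 7 * m.links.deg (m.reg .v) + 2 ∧ ∃ rt',
      rt'.length = rt.length + m.links.deg (m.reg .v) ∧
      IsConsolidating n (S.erase (m.reg .v)) (m.reg .v) m.links.mrk m'.links (m'.cell .table) 0
        (m'.reg .roots) rt' rt' := by
  obtain ⟨L, hL, init⟩ := h.isPromoting hv
  rw [promoteChildren, halts_seq, halts_mov]
  refine init.halts_loop.mono ?_
  rintro t _ m' exec ⟨ht, rt', hlen, h'⟩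
  have hvn : m.reg .v < n := by
    obtain ⟨ch, F, -⟩ := h.forest
    exact F.lt _ (Links.mem_roots.1 ((h.roots.mem _).1 hv)).1
  have hroots : ∀ c ∈ m'.links.roots (S.erase (m.reg .v)), c ∈ rt' ∧ c ≠ m.reg .v := fun c hc =>
    ⟨(h'.mem c hc).resolve_left List.not_mem_nil,
      Finset.ne_of_mem_erase (Links.mem_roots.1 hc).1⟩
  refine ⟨by omega, rt', hlen.trans (by rw [hL]), h'.forest, h'.marks, h'.chain, h'.nodup,
    fun c hc hcv => (h'.root c hc hcv).1, ⟨?_, ?_, ?_, ?_⟩, by omega, by omega⟩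
  · exact fun c hc => (h'.root c (hroots c hc).1 (hroots c hc).2).2.1
  · exact fun c hc => (h'.root c (hroots c hc).1 (hroots c hc).2).2.2
  · exact fun c hc => .inl (hroots c hc).1
  · intro i hi hne
    rw [exec.cell_eq rfl] at hne
    exact absurd (h.table i hi) hne

theorem inH_erase (h : IsHeap n S m rt) (v : ℕ) :
    ∀ w < n, update (m.cell .inH) v 0 w = 0 ↔ w ∉ S.erase v := by
  intro w hw
  rcases eq_or_ne w v with rfl | hwv
  · simp only [update_self, Finset.notMem_erase, not_false_eq_true]
  · rw [update_of_ne hwv, h.inH w hw, Finset.mem_erase, and_iff_right hwv]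

theorem halts_removeMin (h : IsHeap n S m rt) (hS : S.Nonempty) :
    Halts (mov .v (.reg .hmin) ;; promoteChildren ;; consolidate ;; rebuildRoots ;;
      put .inH .v (.lit 0)) m fun t _ m' => m'.reg .v = m.reg .hmin ∧ ∃ rt',
        IsHeap n (S.erase (m.reg .hmin)) m' rt' ∧
        t + 30 * potential (S.erase (m.reg .hmin)) m'.links rt' ≤
          30 * potential S m.links rt + 160 * (Nat.log 2 n + 1) := by
  have hv := (h.hmin_le hS).1
  have hroot := (h.roots.mem _).1 hv
  have hvS := (Links.mem_roots.1 hroot).1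
  have hvn : m.reg .hmin ≠ n := ne_of_mem_of_not_mem hvS h.forest.notMem
  have h₀ : IsHeap n S (m.setReg .v (m.reg .hmin)) rt :=
    ⟨h.size, h.roots, h.forest, h.hmin, h.inH, h.table, h.key⟩
  simp only [halts_seq, halts_mov, halts_put]
  have hdeg := h.forest.deg_le_log hroot
  refine (h₀.halts_promoteChildren hv).mono ?_
  rintro t₁ _ m₁ exec₁ ⟨ht₁, rt₁, hlen₁, h₁⟩
  change t₁ ≤ 7 * m.links.deg (m.reg .hmin) + 2 at ht₁
  change rt₁.length = rt.length + m.links.deg (m.reg .hmin) at hlen₁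
  have v₁ : m₁.reg .v = m.reg .hmin := exec₁.reg_eq rfl
  have size₁ : m₁.reg .n = n := (exec₁.reg_eq rfl).trans h.size
  refine (halts_consolidate (Finset.notMem_erase _ _) hvn size₁ v₁ h₁).mono ?_
  rintro t₂ _ m₂ exec₂ ⟨size₂, v₂, h₂, ht₂⟩
  refine (h₂.halts_rebuildRoots size₂).mono ?_
  rintro t₃ _ m₃ exec₃ ⟨ht₃, rt', R, hlen, F, (hmrk : _ ≤ m.links.mrk), table, hmin⟩
  have v₃ : m₃.reg .v = m.reg .hmin := (exec₃.reg_eq rfl).trans v₂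
  refine ⟨v₃, rt', ⟨?_, R, F, hmin, ?_, table, ?_⟩, ?_⟩
  · exact (exec₃.reg_eq rfl).trans size₂
  · have inH : m₃.cell .inH = m.cell .inH :=
      (exec₃.cell_eq rfl).trans ((exec₂.cell_eq rfl).trans (exec₁.cell_eq rfl))
    rw [v₃, Mem.setCell_cell, inH]
    exact h.inH_erase (m.reg .hmin)
  · have num (a : NumArr) : m₃.num a = m.num a :=
      (exec₃.num_eq rfl).trans ((exec₂.num_eq rfl).trans (exec₁.num_eq rfl))
    simpa only [Mem.setCell_num, num] using fun w hw => h.key w (Finset.mem_of_mem_erase hw)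
  · have hcard : (m₁.links.roots (S.erase (m.reg .hmin))).card ≤ rt₁.length :=
      h₁.card_roots_le fun i hi =>
        (congrFun (exec₁.cell_eq (a := .table) rfl) i).trans (h.table i hi)
    have hpot := potential_erase_le (S := S) (H := m.links) (v := m.reg .hmin) (rt := rt') hmrk
    have hk := h₂.maxDeg_le
    change _ + 30 * potential (S.erase (m.reg .hmin)) m₃.links rt' ≤
      30 * (rt.length + 2 * ∑ x ∈ S, m.links.mrk x) + _
    omega

end IsHeap

/-! ### Exploring the graph -/

/-- Adjacency lists: the edges out of `u` sit at the positions `first u, …, last u - 1` of `tgt`. -/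
structure AdjLists where
  first : ℕ → ℕ
  last : ℕ → ℕ
  tgt : ℕ → ℕ

/-- The adjacency lists in the memory. -/
def Mem.adj (m : Mem) : AdjLists := ⟨m.cell .first, m.cell .last, m.cell .tgt⟩

theorem Exec.adj_eq {c : Com} {m m' : Mem} {t : ℕ} {l : List Label} (exec : Exec c m t l m')
    (first : c.setsArr .first = false) (last : c.setsArr .last = false)
    (tgt : c.setsArr .tgt = false) : m'.adj = m.adj := by
  rw [Mem.adj, exec.cell_eq first, exec.cell_eq last, exec.cell_eq tgt]
  rfl

namespace AdjLists

variable (A : AdjLists)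

/-- The out-degree of `u`. -/
def out (u : ℕ) : ℕ := A.last u - A.first u

/-- The number of edges to `k` among the positions in `[j, l)`. -/
def count (j l k : ℕ) : ℕ := ((Finset.Ico j l).filter (A.tgt · = k)).card

/-- The number of edges from `u` to `k`. -/
def mult (u k : ℕ) : ℕ := A.count (A.first u) (A.last u) k

/-- The edges out of the vertices `0, …, n - 1` lead to such vertices. -/
def Valid (n : ℕ) : Prop :=
  ∀ u < n, ∀ p ∈ Finset.Ico (A.first u) (A.last u), A.tgt p < n

/-- The edges out of the vertices in `U`, and these vertices themselves, are counted. -/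
def work (U : Finset ℕ) : ℕ := ∑ u ∈ U, (1 + A.out u)

variable {A} {j l : ℕ}

theorem count_of_lt (hjl : j < l) (k : ℕ) :
    A.count j l k = (if A.tgt j = k then 1 else 0) + A.count (j + 1) l k := by
  rw [count, ← Finset.insert_Ico_add_one_left_eq_Ico hjl, Finset.filter_insert]
  split_ifs with h
  · rw [Finset.card_insert_of_notMem (by simp), count, add_comm]
  · rw [count, zero_add]

theorem count_of_le (hlj : l ≤ j) (k : ℕ) : A.count j l k = 0 := by
  simp [count, Finset.Ico_eq_empty_of_le hlj]

theorem work_erase {U : Finset ℕ} {z : ℕ} (hz : z ∈ U) :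
    A.work (U.erase z) + (1 + A.out z) = A.work U :=
  Finset.sum_erase_add U _ hz

end AdjLists

/-- The state of an exploration: the vertices in `U` have not been explored yet, those in the list
`P` are fixed already and wait to be explored, the others in `U` are not fixed and belong to `W`;
the edges at the positions `[j, l)` remain from the vertex that is being explored. -/
structure Exploration (n : ℕ) (A : AdjLists) (U W : Finset ℕ) (P : List ℕ) (fixed pred : ℕ → ℕ)
    (j l : ℕ) : Prop where
  nodup : P.Nodup
  lt : ∀ u ∈ U, u < n
  subset : ∀ u ∈ P, u ∈ U
  fixed_eq_zero_iff : ∀ u < n, fixed u = 0 ↔ u ∈ U ∧ u ∉ P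
  mem_of_notMem : ∀ u ∈ U, u ∉ P → u ∈ W
  tgt_lt : ∀ p ∈ Finset.Ico j l, A.tgt p < n
  pred_eq : ∀ k < n, fixed k = 0 → pred k = ∑ u ∈ U, A.mult u k + A.count j l k
  mult_eq_zero : ∀ k < n, fixed k = 0 → pred k = 0 → ∀ u < n, A.mult u k = 0

namespace Exploration

variable {n : ℕ} {A : AdjLists} {U W : Finset ℕ} {P : List ℕ} {fixed pred pred' : ℕ → ℕ}
  {j l k z : ℕ}

theorem skip (h : Exploration n A U W P fixed pred j l) (hjl : j < l)
    (hf : fixed (A.tgt j) ≠ 0) : Exploration n A U W P fixed pred (j + 1) l where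
  __ := h
  tgt_lt p hp := h.tgt_lt p (Finset.Ico_subset_Ico_left j.le_succ hp)
  pred_eq k hk hfk := by
    have : A.tgt j ≠ k := by rintro rfl; exact hf hfk
    rw [h.pred_eq k hk hfk, AdjLists.count_of_lt hjl, if_neg this, zero_add]

theorem relax (h : Exploration n A U W P fixed pred j l) (hjl : j < l)
    (hp : pred (A.tgt j) - 1 ≠ 0) :
    Exploration n A U W P fixed (update pred (A.tgt j) (pred (A.tgt j) - 1)) (j + 1) l where
  __ := h
  tgt_lt p hp := h.tgt_lt p (Finset.Ico_subset_Ico_left j.le_succ hp)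
  pred_eq k hk hfk := by
    have eq := h.pred_eq k hk hfk
    rw [AdjLists.count_of_lt hjl] at eq
    rcases eq_or_ne k (A.tgt j) with rfl | hkj
    · rw [if_pos rfl] at eq
      rw [update_self]
      omega
    · rw [if_neg hkj.symm] at eq
      rw [update_of_ne hkj]
      omega
  mult_eq_zero k hk hfk := by
    rcases eq_or_ne k (A.tgt j) with rfl | hkj
    · rw [update_self]
      exact fun hp' => absurd hp' hp
    · rw [update_of_ne hkj]
      exact h.mult_eq_zero k hk hfk

theorem fix (h : Exploration n A U W P fixed pred j l) (hk : k < n) (hf : fixed k = 0)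
    (hpred : ∀ i ≠ k, pred' i = pred i) :
    Exploration n A U W (P ++ [k]) (update fixed k 1) pred' j l := by
  obtain ⟨hkU, hkP⟩ := (h.fixed_eq_zero_iff k hk).1 hf
  have unfixed : ∀ i, update fixed k 1 i = 0 → i ≠ k ∧ fixed i = 0 := by
    intro i hi
    have hik : i ≠ k := by rintro rfl; simp at hi
    exact ⟨hik, by rwa [update_of_ne hik] at hi⟩
  refine
    { nodup := List.nodup_append.2 ⟨h.nodup, List.nodup_singleton k, by grind⟩
      lt := h.lt
      subset := by grind [h.subset]
      fixed_eq_zero_iff := ?_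
      mem_of_notMem := by grind [h.mem_of_notMem]
      tgt_lt := h.tgt_lt
      pred_eq := ?_
      mult_eq_zero := ?_ }
  · intro u hu
    have := h.fixed_eq_zero_iff u hu
    grind [update_apply]
  · intro i hi hfi
    obtain ⟨hik, hfi⟩ := unfixed i hfi
    rw [hpred i hik, h.pred_eq i hi hfi]
  · intro i hi hfi
    obtain ⟨hik, hfi⟩ := unfixed i hfi
    rw [hpred i hik]
    exact h.mult_eq_zero i hi hfi

theorem finish (h : Exploration n A U W P fixed pred j l) (hlj : l ≤ j) :
    Exploration n A U W P fixed pred 0 0 where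
  __ := h
  tgt_lt := by simp
  pred_eq k hk hfk := by
    rw [h.pred_eq k hk hfk, AdjLists.count_of_le hlj, AdjLists.count_of_le le_rfl]

theorem pop (h : Exploration n A U W (z :: P) fixed pred 0 0) (hA : A.Valid n) :
    Exploration n A (U.erase z) W P fixed pred (A.first z) (A.last z) := by
  obtain ⟨hzP, nodup⟩ := List.nodup_cons.1 h.nodup
  have hz : z ∈ U := h.subset z List.mem_cons_self
  refine
    { nodup
      lt := fun u hu => h.lt u (Finset.mem_of_mem_erase hu)
      subset := by grind [h.subset]
      fixed_eq_zero_iff := by grind [h.fixed_eq_zero_iff]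
      mem_of_notMem := by grind [h.mem_of_notMem]
      tgt_lt := hA z (h.lt z hz)
      pred_eq := ?_
      mult_eq_zero := h.mult_eq_zero }
  intro k hk hfk
  rw [h.pred_eq k hk hfk, AdjLists.count_of_le le_rfl, add_zero, ← Finset.sum_erase_add U _ hz]
  rfl

end Exploration

/-- The memory holds an exploration; `D₀` is an earlier value of `D`. -/
structure IsExploring (n : ℕ) (A : AdjLists) (W : Finset ℕ) (D₀ : ℕ → WithTop ℝ) (U : Finset ℕ)
    (P : List ℕ) (j l : ℕ) (m : Mem) : Prop where
  adj : m.adj = A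
  state : Exploration n A U W P (m.cell .fixed) (m.cell .pred) j l
  le : m.reg .rHead ≤ m.reg .rTail
  queueR : (List.Ico (m.reg .rHead) (m.reg .rTail)).map (m.cell .R) = P
  queueQ : ∀ p < m.reg .qTail, m.cell .Q p < n
  dist_le : ∀ u, m.num .D u ≤ D₀ u

/-- The first half of `processEdge`. -/
def relaxEdge : Com :=
  mov .changed (.lit 0) ;;
  decAt .pred .k ;;
  cond (.numLt (.sum .D .z .wt .j) (.cell .D .k))
    (putNum .D .k (.sum .D .z .wt .j) ;; mov .changed (.lit 1))
    skip

/-- The second half of `processEdge`. -/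
def enqueueTarget : Com :=
  cond (.eq (.cell .pred .k) (.lit 0))
    (put .fixed .k (.lit 1) ;; insertR .k)
    (cond (.ne (.reg .changed) (.lit 0))
      (cond (.eq (.cell .inQ .k) (.lit 0)) (insertQ .k) skip)
      skip)

theorem halts_processEdge {m : Mem} {Q : ℕ → List Label → Mem → Prop} :
    Halts processEdge m Q ↔ Halts (relaxEdge ;; enqueueTarget) m Q := by
  simp only [processEdge, relaxEdge, enqueueTarget, halts_seq, add_assoc, List.append_assoc]

theorem halts_relaxEdge (m : Mem) : Halts relaxEdge m fun t _ m' => t ≤ 5 ∧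
    m'.cell = (m.setCell .pred (m.reg .k) (m.cell .pred (m.reg .k) - 1)).cell ∧
    ∀ u, m'.num .D u ≤ m.num .D u := by
  simp only [relaxEdge, halts_seq, halts_mov, halts_decAt, halts_cond, halts_putNum, halts_skip,
    Test.holds, Num.eval, Mem.setReg_reg, Mem.setReg_num, Mem.setCell_reg, Mem.setCell_num,
    reduceCtorEq, if_false]
  split_ifs with hlt
  · refine ⟨by omega, rfl, fun u => ?_⟩
    simp only [Mem.setReg_num, Mem.setNum_num, if_true, update_apply, Mem.setCell_num]
    split_ifs with huk
    · exact huk ▸ hlt.le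
    · exact le_rfl
  · exact ⟨by omega, rfl, fun u => le_rfl⟩

theorem map_Ico_succ_update {a b : ℕ} (hab : a ≤ b) (f : ℕ → ℕ) (x : ℕ) :
    (List.Ico a (b + 1)).map (update f b x) = (List.Ico a b).map f ++ [x] := by
  rw [List.Ico.succ_top hab, List.map_append, List.map_singleton, update_self]
  congr 1
  exact List.map_congr_left fun i hi => update_of_ne (List.Ico.mem.1 hi).2.ne x f

namespace IsExploring

variable {n : ℕ} {A : AdjLists} {W : Finset ℕ} {D₀ : ℕ → WithTop ℝ} {U : Finset ℕ} {P : List ℕ}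
  {j l : ℕ} {m m' : Mem}

theorem insertQ {k : ℕ} (h : IsExploring n A W D₀ U P j l m) (hk : k < n) :
    IsExploring n A W D₀ U P j l (((m.setCell .Q (m.reg .qTail) k).setReg .qTail
      (m.reg .qTail + 1)).setCell .inQ k 1) where
  adj := h.adj
  state := h.state
  le := h.le
  queueR := h.queueR
  queueQ p hp := by
    change update (m.cell .Q) (m.reg .qTail) k p < n
    change p < m.reg .qTail + 1 at hp
    rw [update_apply]
    split_ifs
    · exact hk
    · exact h.queueQ p (by omega)
  dist_le := h.dist_le

theorem halts_enqueueTarget (h : IsExploring n A W D₀ U P j l m) (hk : m.reg .k < n)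
    (hp : m.cell .pred (m.reg .k) ≠ 0) :
    Halts enqueueTarget m fun t _ m' => t ≤ 6 ∧ m'.reg .qTail ≤ m.reg .qTail + 1 ∧
      IsExploring n A W D₀ U P j l m' := by
  simp only [enqueueTarget, SP.insertQ, halts_cond, halts_seq, halts_put, halts_inc, halts_skip,
    Test.holds, Word.eval, hp, if_false]
  split_ifs
  · exact ⟨by omega, le_rfl, h.insertQ hk⟩
  · exact ⟨by omega, by omega, h⟩
  · exact ⟨by omega, by omega, h⟩

theorem skip (h : IsExploring n A W D₀ U P j l m) (hjl : j < l)
    (hf : m.cell .fixed (A.tgt j) ≠ 0) : IsExploring n A W D₀ U P (j + 1) l m :=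
  { h with state := h.state.skip hjl hf }

theorem relax (h : IsExploring n A W D₀ U P j l m) (hjl : j < l)
    (exec_reg : ∀ r ≠ .changed, m'.reg r = m.reg r)
    (exec_cell : m'.cell = (m.setCell .pred (A.tgt j) (m.cell .pred (A.tgt j) - 1)).cell)
    (exec_num : ∀ u, m'.num .D u ≤ m.num .D u) (hp : m'.cell .pred (A.tgt j) ≠ 0) :
    IsExploring n A W D₀ U P (j + 1) l m' := by
  have hpred : m'.cell .pred = update (m.cell .pred) (A.tgt j) (m.cell .pred (A.tgt j) - 1) := by
    simp [exec_cell]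
  refine
    { adj := by simpa [Mem.adj, exec_cell] using h.adj
      state := ?_
      le := by simpa [exec_reg] using h.le
      queueR := by simpa [exec_reg, exec_cell] using h.queueR
      queueQ := by simpa [exec_reg, exec_cell] using h.queueQ
      dist_le := fun u => (exec_num u).trans (h.dist_le u) }
  rw [hpred, update_self] at hp
  rw [hpred, exec_cell]
  exact h.state.relax hjl hp

theorem fix {k b : ℕ} (h : IsExploring n A W D₀ U P j l m) (hk : k < n) (hf : m.cell .fixed k = 0)
    (exec_reg : ∀ r ≠ .changed, m'.reg r = m.reg r)
    (exec_cell : m'.cell = (m.setCell .pred k b).cell)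
    (exec_num : ∀ u, m'.num .D u ≤ m.num .D u) :
    IsExploring n A W D₀ U (P ++ [k]) j l (((m'.setCell .fixed k 1).setCell .R (m'.reg .rTail)
      k).setReg .rTail (m'.reg .rTail + 1)) := by
  have hR : m'.cell .R = m.cell .R := by simp [exec_cell]
  refine
    { adj := by simpa [Mem.adj, exec_cell] using h.adj
      state := ?_
      le := ?_
      queueR := ?_
      queueQ := by simpa [exec_reg, exec_cell] using h.queueQ
      dist_le := fun u => (exec_num u).trans (h.dist_le u) }
  · have := h.state.fix (pred' := m'.cell .pred) hk hf fun i hi => by simp [exec_cell, hi]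
    simpa [exec_cell] using this
  · have := h.le
    simp only [Mem.setReg_reg, Mem.setCell_reg, reduceCtorEq, if_false, if_true, exec_reg, ne_eq,
      not_false_eq_true]
    omega
  · rw [← h.queueR, ← map_Ico_succ_update h.le]
    simp [hR, exec_reg]

theorem halts_processEdge (h : IsExploring n A W D₀ U P j l m) (hjl : j < l)
    (hf : m.cell .fixed (A.tgt j) = 0) (hk : m.reg .k = A.tgt j) :
    Halts processEdge m fun t _ m' => t ≤ 11 ∧ m'.reg .qTail ≤ m.reg .qTail + 1 ∧
      ∃ P', IsExploring n A W D₀ U P' (j + 1) l m' := by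
  have hkn : A.tgt j < n := h.state.tgt_lt j (Finset.left_mem_Ico.2 hjl)
  rw [SP.halts_processEdge, halts_seq]
  refine (halts_relaxEdge m).mono ?_
  rintro t₁ l₁ m₁ exec ⟨time, cells, dist⟩
  rw [hk] at cells
  have regs : ∀ r ≠ .changed, m₁.reg r = m.reg r := fun r hr =>
    exec.reg_eq (by simp [relaxEdge, Com.setsReg, hr])
  have hk₁ : m₁.reg .k = A.tgt j := (regs _ (by simp)).trans hk
  by_cases hp : m₁.cell .pred (A.tgt j) = 0
  · have fixed := (h.fix hkn hf regs cells dist).skip hjl (by simp)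
    simp only [enqueueTarget, insertR, halts_cond, halts_seq, halts_put, halts_inc, Test.holds,
      Word.eval, Mem.setCell_reg, hk₁, hp, if_true]
    exact ⟨by omega, (regs .qTail (by simp)).trans_le (by omega), _, fixed⟩
  · refine ((h.relax hjl regs cells dist hp).halts_enqueueTarget (by rwa [hk₁])
      (by rwa [hk₁])).mono ?_
    rintro t₂ - m₂ - ⟨time₂, queue, inv⟩
    rw [regs .qTail (by simp)] at queue
    exact ⟨by omega, queue, P, inv⟩

/-- The loop over the edges out of a vertex. -/
def exploreEdges : Com :=
  loop (.lt (.reg .j) (.reg .fin))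
    (mov .k (.cell .tgt .j) ;;
     cond (.eq (.cell .fixed .k) (.lit 0)) processEdge Com.skip ;;
     inc .j)

theorem halts_exploreEdge (h : IsExploring n A W D₀ U P (m.reg .j) (m.reg .fin) m)
    (hjl : m.reg .j < m.reg .fin) :
    Halts (mov .k (.cell .tgt .j) ;;
      cond (.eq (.cell .fixed .k) (.lit 0)) processEdge Com.skip ;;
      inc .j) m fun t _ m' => t ≤ 14 ∧ m'.reg .j = m.reg .j + 1 ∧ m'.reg .fin = m.reg .fin ∧
        m'.reg .qTail ≤ m.reg .qTail + 1 ∧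
        ∃ P', IsExploring n A W D₀ U P' (m'.reg .j) (m'.reg .fin) m' := by
  have htgt : m.cell .tgt = A.tgt := congrArg AdjLists.tgt h.adj
  simp only [halts_seq, halts_mov, halts_cond, halts_skip, halts_inc, Test.holds, Word.eval,
    Mem.setReg_reg, Mem.setReg_cell, if_true, reduceCtorEq, if_false, htgt]
  have inv : IsExploring n A W D₀ U P (m.reg .j) (m.reg .fin)
      (m.setReg .k (A.tgt (m.reg .j))) := ⟨h.adj, h.state, h.le, h.queueR, h.queueQ, h.dist_le⟩
  split_ifs with hf
  · refine (inv.halts_processEdge hjl hf rfl).mono ?_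
    rintro t₁ _ m₁ exec ⟨time, queue, P', inv'⟩
    have hj : m₁.reg .j = m.reg .j := exec.reg_eq rfl
    have hfin : m₁.reg .fin = m.reg .fin := exec.reg_eq rfl
    rw [hj, hfin]
    exact ⟨by omega, rfl, rfl, queue, P',
      ⟨inv'.adj, inv'.state, inv'.le, inv'.queueR, inv'.queueQ, inv'.dist_le⟩⟩
  · have inv' := inv.skip hjl hf
    exact ⟨by omega, trivial, trivial, by omega, P,
      ⟨inv'.adj, inv'.state, inv'.le, inv'.queueR, inv'.queueQ, inv'.dist_le⟩⟩

theorem halts_exploreEdges (h : IsExploring n A W D₀ U P (m.reg .j) (m.reg .fin) m) :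
    Halts exploreEdges m fun t _ m' => t ≤ 15 * (m.reg .fin - m.reg .j) + 1 ∧
      m'.reg .qTail ≤ m.reg .qTail + (m.reg .fin - m.reg .j) ∧
      ∃ P', IsExploring n A W D₀ U P' 0 0 m' := by
  refine (halts_loop_of_credit (I := fun p m' => p = 15 * (m'.reg .fin - m'.reg .j) ∧
    m'.reg .qTail + (m'.reg .fin - m'.reg .j) ≤ m.reg .qTail + (m.reg .fin - m.reg .j) ∧
    ∃ P', IsExploring n A W D₀ U P' (m'.reg .j) (m'.reg .fin) m') ?_ ⟨rfl, le_rfl, P, h⟩).mono ?_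
  · rintro p m₁ ⟨rfl, queue, P₁, inv⟩ (hjl : m₁.reg .j < m₁.reg .fin)
    refine (inv.halts_exploreEdge hjl).mono ?_
    rintro t - m₂ - ⟨time, hj, hfin, queue', P₂, inv'⟩
    exact ⟨_, ⟨rfl, by omega, P₂, inv'⟩, by omega⟩
  · rintro t - m' - ⟨q, ⟨-, queue, P', inv⟩, hjl : ¬ m'.reg .j < m'.reg .fin, time⟩
    exact ⟨by omega, by omega, P', { inv with state := inv.state.finish (not_lt.1 hjl) }⟩

/-- One round of the inner loop. -/
def exploreVertex : Com :=
  mov .z (.cell .R .rHead) ;;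
  inc .rHead ;;
  mov .j (.cell .first .z) ;;
  mov .fin (.cell .last .z) ;;
  exploreEdges

theorem halts_exploreVertex (h : IsExploring n A W D₀ U P 0 0 m) (hA : A.Valid n)
    (hlt : m.reg .rHead < m.reg .rTail) :
    Halts exploreVertex m fun t _ m' => ∃ U' P', IsExploring n A W D₀ U' P' 0 0 m' ∧
      20 * A.work U' + t + 1 ≤ 20 * A.work U ∧
      m'.reg .qTail + A.work U' ≤ m.reg .qTail + A.work U := by
  set z := m.cell .R (m.reg .rHead) with hz
  obtain ⟨P', rfl⟩ : ∃ P', P = z :: P' := by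
    rw [← h.queueR, List.Ico.eq_cons hlt]
    exact ⟨_, rfl⟩
  have work : A.work (U.erase z) + (1 + A.out z) = A.work U :=
    AdjLists.work_erase (h.state.subset z List.mem_cons_self)
  have hfirst : m.cell .first = A.first := congrArg AdjLists.first h.adj
  have hlast : m.cell .last = A.last := congrArg AdjLists.last h.adj
  simp only [exploreVertex, halts_seq, halts_mov, halts_inc, Word.eval, Mem.setReg_reg,
    Mem.setReg_cell, if_true, reduceCtorEq, if_false, hfirst, hlast, ← hz]
  have init : IsExploring n A W D₀ (U.erase z) P' (A.first z) (A.last z)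
      ((((m.setReg .z z).setReg .rHead (m.reg .rHead + 1)).setReg .j (A.first z)).setReg .fin
        (A.last z)) := by
    refine ⟨h.adj, h.state.pop hA, hlt, ?_, h.queueQ, h.dist_le⟩
    have queue := h.queueR
    rw [List.Ico.eq_cons hlt, List.map_cons] at queue
    exact (List.cons.inj queue).2
  refine init.halts_exploreEdges.mono ?_
  rintro t - m₁ - ⟨time, queue, P₁, inv⟩
  change t ≤ 15 * A.out z + 1 at time
  change m₁.reg .qTail ≤ m.reg .qTail + A.out z at queue
  exact ⟨_, P₁, inv, by omega, by omega⟩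

theorem halts_exploreR (h : IsExploring n A W D₀ U P 0 0 m) (hA : A.Valid n) :
    Halts exploreR m fun t _ m' => ∃ U', IsExploring n A W D₀ U' [] 0 0 m' ∧
      t + 20 * A.work U' ≤ 20 * A.work U + 1 ∧
      m'.reg .qTail + A.work U' ≤ m.reg .qTail + A.work U := by
  refine (halts_loop_of_credit (I := fun p m' => ∃ U' P', IsExploring n A W D₀ U' P' 0 0 m' ∧
    p = 20 * A.work U' ∧ m'.reg .qTail + A.work U' ≤ m.reg .qTail + A.work U) ?_
    ⟨U, P, h, rfl, le_rfl⟩).mono ?_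
  · rintro p m₁ ⟨U₁, P₁, inv, rfl, queue⟩ hlt
    refine (inv.halts_exploreVertex hA hlt).mono ?_
    rintro t - m₂ - ⟨U₂, P₂, inv', time, queue'⟩
    exact ⟨_, ⟨U₂, P₂, inv', rfl, by omega⟩, time⟩
  · rintro t - m' - ⟨q, ⟨U', P', inv, rfl, queue⟩, hlt : ¬ m'.reg .rHead < m'.reg .rTail, time⟩
    obtain rfl : P' = [] := by rw [← inv.queueR, List.Ico.eq_nil_of_le (not_lt.1 hlt), List.map_nil]
    exact ⟨U', inv, by omega, queue⟩

end IsExploring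

/-! ### The outer loop -/

/-- One round of the loop of `flushQ`. -/
def flushVertex : Com :=
  mov .v (.cell .Q .qHead) ;;
  inc .qHead ;;
  put .inQ .v (.lit 0) ;;
  cond (.eq (.cell .fixed .v) (.lit 0)) heapInsertOrAdjust Com.skip

namespace IsHeap

variable {n : ℕ} {S : Finset ℕ} {rt : List ℕ} {m m' : Mem}

theorem lt (h : IsHeap n S m rt) {v : ℕ} (hv : v ∈ S) : v < n := by
  obtain ⟨ch, F, -⟩ := h.forest
  exact F.lt v hv

theorem hmin_mem (h : IsHeap n S m rt) (hS : S.Nonempty) : m.reg .hmin ∈ S :=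
  (Links.mem_roots.1 ((h.roots.mem _).1 (h.hmin_le hS).1)).1

theorem hmin_ne_iff (h : IsHeap n S m rt) : m.reg .hmin ≠ m.reg .n ↔ S.Nonempty := by
  rw [h.size]
  refine ⟨fun hne => ?_, fun hS => (h.lt (h.hmin_mem hS)).ne⟩
  rcases h.hmin with ⟨-, hmin⟩ | ⟨hmem, -⟩
  · exact absurd hmin hne
  · exact ⟨_, (Links.mem_roots.1 ((h.roots.mem _).1 hmem)).1⟩

theorem congr (h : IsHeap n S m rt) (size : m'.reg .n = m.reg .n)
    (roots : m'.reg .roots = m.reg .roots) (hmin : m'.reg .hmin = m.reg .hmin)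
    (links : m'.links = m.links) (inH : m'.cell .inH = m.cell .inH)
    (table : m'.cell .table = m.cell .table) (dist_le : ∀ u, m'.num .D u ≤ m.num .D u) :
    IsHeap n S m' rt where
  size := size.trans h.size
  roots := by rw [links, roots]; exact h.roots
  forest := by rw [links]; exact h.forest
  hmin := by rw [links, hmin]; exact h.hmin
  inH := by rw [inH]; exact h.inH
  table := by rw [table]; exact h.table
  key v hv := (dist_le v).trans ((h.key v hv).trans_eq (congrFun (congrArg Links.key links) v).symm)

theorem halts_heapInsertOrAdjust (h : IsHeap n S m rt) (hv : m.reg .v < n) :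
    Halts heapInsertOrAdjust m fun t l m' => l = [.heapInsertOrAdjust] ∧ ∃ rt',
      IsHeap n (insert (m.reg .v) S) m' rt' ∧
      t + 30 * potential (insert (m.reg .v) S) m'.links rt' ≤
        30 * potential S m.links rt + 142 := by
  simp only [heapInsertOrAdjust, halts_call, halts_cond, Test.holds, Word.eval, h.inH _ hv]
  split_ifs with hvS
  · refine (h.halts_decreaseKey hvS).mono ?_
    rintro t l m' exec ⟨rt', heap, time⟩
    rw [Finset.insert_eq_of_mem hvS]
    exact ⟨by rw [exec.labels_eq_nil rfl], rt', heap, by omega⟩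
  · refine (h.halts_insertNode hvS hv).mono ?_
    rintro t l m' exec ⟨time, heap, pot⟩
    exact ⟨by rw [exec.labels_eq_nil rfl], _, heap, by omega⟩

theorem halts_flushVertex {U : Finset ℕ} (h : IsHeap n S m rt)
    (hQ : m.cell .Q (m.reg .qHead) < n) (hU : ∀ v < n, m.cell .fixed v = 0 ↔ v ∈ U) :
    Halts flushVertex m fun t l m' => m'.reg .qHead = m.reg .qHead + 1 ∧ (U = ∅ → l = []) ∧
      ∃ S' ⊆ S ∪ U, ∃ rt', IsHeap n S' m' rt' ∧
        t + 30 * potential S' m'.links rt' ≤ 30 * potential S m.links rt + 146 := by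
  set v := m.cell .Q (m.reg .qHead) with hv
  have init : IsHeap n S (((m.setReg .v v).setReg .qHead (m.reg .qHead + 1)).setCell .inQ v 0) rt :=
    ⟨h.size, h.roots, h.forest, h.hmin, h.inH, h.table, h.key⟩
  simp only [flushVertex, halts_seq, halts_mov, halts_inc, halts_put, halts_cond, halts_skip,
    Test.holds, Word.eval, Mem.setReg_reg, Mem.setReg_cell, Mem.setCell_reg, Mem.setCell_cell,
    if_true, reduceCtorEq, if_false, ← hv, hU v hQ]
  split_ifs with hvU
  · refine (init.halts_heapInsertOrAdjust hQ).mono ?_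
    rintro t l m' exec ⟨-, rt', heap, time⟩
    change t + 30 * potential (insert v S) _ _ ≤ 30 * potential S m.links rt + 142 at time
    refine ⟨exec.reg_eq rfl, fun hU => absurd hvU (hU ▸ Finset.notMem_empty v), _,
      Finset.insert_subset (Finset.mem_union_right S hvU) Finset.subset_union_left, rt', heap, ?_⟩
    omega
  · exact ⟨trivial, fun _ => rfl, S, Finset.subset_union_left, rt, init,
      by change _ + 30 * potential S m.links rt ≤ _; omega⟩

theorem halts_flushQ {U : Finset ℕ} (h : IsHeap n S m rt)
    (hQ : ∀ i < m.reg .qTail, m.cell .Q i < n) (hU : ∀ v < n, m.cell .fixed v = 0 ↔ v ∈ U) :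
    Halts flushQ m fun t l m' => (U = ∅ → l = []) ∧
      ∃ S' ⊆ S ∪ U, ∃ rt', IsHeap n S' m' rt' ∧ t + 30 * potential S' m'.links rt' ≤
        30 * potential S m.links rt + 150 * m.reg .qTail + 1 := by
  refine (halts_loop_of_credit_of_labels (l := []) (I := fun p l m' =>
    (∀ i < m'.reg .qTail, m'.cell .Q i < n) ∧ (∀ v < n, m'.cell .fixed v = 0 ↔ v ∈ U) ∧
    (U = ∅ → l = []) ∧ ∃ S' ⊆ S ∪ U, ∃ rt', IsHeap n S' m' rt' ∧
      p = 30 * potential S' m'.links rt' + 150 * (m'.reg .qTail - m'.reg .qHead)) ?_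
    ⟨hQ, hU, fun _ => rfl, S, Finset.subset_union_left, rt, h, rfl⟩).mono ?_
  · rintro p l m₁ ⟨hQ₁, hU₁, labels, S₁, hS₁, rt₁, h₁, rfl⟩ (hlt : m₁.reg .qHead < m₁.reg .qTail)
    refine (h₁.halts_flushVertex (hQ₁ _ hlt) hU₁).mono ?_
    rintro t l' m₂ exec ⟨qHead, labels', S₂, hS₂, rt₂, h₂, time⟩
    have qTail : m₂.reg .qTail = m₁.reg .qTail := exec.reg_eq rfl
    have Q : m₂.cell .Q = m₁.cell .Q := exec.cell_eq rfl
    have fixed : m₂.cell .fixed = m₁.cell .fixed := exec.cell_eq rfl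
    refine ⟨_, ⟨by rwa [qTail, Q], by rwa [fixed], fun hU => by rw [labels hU, labels' hU]; rfl, S₂,
      hS₂.trans (Finset.union_subset hS₁ Finset.subset_union_right), rt₂, h₂, rfl⟩, ?_⟩
    omega
  · rintro t l m' - ⟨q, ⟨-, -, labels, S', hS', rt', h', rfl⟩, -, time⟩
    exact ⟨labels, S', hS', rt', h', by omega⟩

end IsHeap

/-- Between two iterations of the outer loop, the heap has the nodes `S`, and the vertices in `U`
are not fixed. -/
structure IsSearching (n : ℕ) (A : AdjLists) (S : Finset ℕ) (rt : List ℕ) (U : Finset ℕ)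
    (m : Mem) : Prop where
  heap : IsHeap n S m rt
  adj : m.adj = A
  state : Exploration n A U U [] (m.cell .fixed) (m.cell .pred) 0 0

/-- The part of the outer iteration that makes the new vertex ready for exploration. -/
def startExploring : Com :=
  mov .rHead (.lit 0) ;;
  mov .rTail (.lit 0) ;;
  mov .qHead (.lit 0) ;;
  mov .qTail (.lit 0) ;;
  insertR .v ;;
  put .fixed .v (.lit 1)

/-- The part of the outer iteration that is executed if the new vertex is not fixed. -/
def search : Com :=
  startExploring ;; exploreR ;; flushQ

namespace IsSearching

variable {n : ℕ} {A : AdjLists} {S : Finset ℕ} {rt : List ℕ} {U : Finset ℕ} {m : Mem}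

theorem fixed_eq_zero_iff (h : IsSearching n A S rt U m) :
    ∀ v < n, m.cell .fixed v = 0 ↔ v ∈ U := fun v hv => by
  simpa using h.state.fixed_eq_zero_iff v hv

theorem halts_startExploring (h : IsSearching n A S rt U m) (hv : m.reg .v ∈ U) :
    Halts startExploring m fun t _ m' => t = 7 ∧ m'.reg .qTail = 0 ∧ m'.links = m.links ∧
      IsHeap n S m' rt ∧
      IsExploring n A (U.erase (m.reg .v)) (m'.num .D) U [m.reg .v] 0 0 m' := by
  have hvn : m.reg .v < n := h.state.lt _ hv
  have state := h.state.fix (pred' := m.cell .pred) hvn ((h.fixed_eq_zero_iff _ hvn).2 hv)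
    fun _ _ => rfl
  simp only [startExploring, insertR, halts_seq, halts_mov, halts_put, halts_inc, Word.eval]
  refine ⟨trivial, rfl, rfl, ⟨h.heap.size, h.heap.roots, h.heap.forest, h.heap.hmin, h.heap.inH,
    h.heap.table, h.heap.key⟩, ⟨h.adj, { state with mem_of_notMem := by grind }, Nat.zero_le _,
    ?_, fun p hp => absurd hp p.not_lt_zero, fun _ => le_rfl⟩⟩
  simp [List.Ico.succ_singleton]

theorem halts_search (h : IsSearching n A S rt U m) (hA : A.Valid n) (hv : m.reg .v ∈ U) :
    Halts search m fun t l m' => ∃ S' rt' U', IsSearching n A S' rt' U' m' ∧ S' ⊆ S ∪ U' ∧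
      U' ⊆ U.erase (m.reg .v) ∧ (U' = ∅ → l = []) ∧
      t + 30 * potential S' m'.links rt' + 170 * A.work U' ≤
        30 * potential S m.links rt + 170 * A.work U + 9 := by
  simp only [search, halts_seq]
  refine (h.halts_startExploring hv).mono ?_
  rintro t₁ l₁ m₁ exec₁ ⟨time₁, qTail₁, links₁, heap₁, exploring₁⟩
  refine (exploring₁.halts_exploreR hA).mono ?_
  rintro t₂ l₂ m₂ exec₂ ⟨U', exploring₂, time₂, qTail₂⟩
  have links₂ : m₂.links = m₁.links := by
    simp only [Mem.links, exec₂.cell_eq (a := .parent) rfl, exec₂.cell_eq (a := .child) rfl,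
      exec₂.cell_eq (a := .nxt) rfl, exec₂.cell_eq (a := .prv) rfl, exec₂.cell_eq (a := .deg) rfl,
      exec₂.cell_eq (a := .mark) rfl, exec₂.num_eq (a := .key) rfl]
  have heap₂ : IsHeap n S m₂ rt := heap₁.congr (exec₂.reg_eq rfl) (exec₂.reg_eq rfl)
    (exec₂.reg_eq rfl) links₂ (exec₂.cell_eq rfl) (exec₂.cell_eq rfl) exploring₂.dist_le
  have fixed₂ : ∀ v < n, m₂.cell .fixed v = 0 ↔ v ∈ U' := fun v hv => by
    simpa using exploring₂.state.fixed_eq_zero_iff v hv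
  refine (heap₂.halts_flushQ exploring₂.queueQ fixed₂).mono ?_
  rintro t₃ l₃ m₃ exec₃ ⟨labels₃, S', hS', rt', heap₃, time₃⟩
  rw [links₂, links₁] at time₃
  refine ⟨S', rt', U', ⟨heap₃, ?_, ?_⟩, hS', fun u hu => exploring₂.state.mem_of_notMem u hu
    List.not_mem_nil, fun hU => ?_, by omega⟩
  · exact (exec₃.adj_eq rfl rfl rfl).trans exploring₂.adj
  · rw [exec₃.cell_eq rfl, exec₃.cell_eq rfl]
    exact { exploring₂.state with mem_of_notMem := fun u hu _ => hu }
  · rw [exec₁.labels_eq_nil rfl, exec₂.labels_eq_nil rfl, labels₃ hU]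
    rfl

theorem halts_outerIteration_iff {Q : ℕ → List Label → Mem → Prop} :
    Halts outerIteration m Q ↔ Halts (call .outerIteration
      (heapRemoveMin ;; cond (.eq (.cell .fixed .v) (.lit 0)) search skip)) m Q := by
  simp only [outerIteration, search, startExploring, insertR, halts_call, halts_cond, halts_seq,
    add_assoc, List.append_assoc]

theorem halts_heapRemoveMin (h : IsSearching n A S rt U m) (hS : S.Nonempty) :
    Halts heapRemoveMin m fun t l m' => l = [.heapRemoveMin] ∧ m'.reg .v = m.reg .hmin ∧
      ∃ rt', IsSearching n A (S.erase (m.reg .hmin)) rt' U m' ∧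
        t + 30 * potential (S.erase (m.reg .hmin)) m'.links rt' ≤
          30 * potential S m.links rt + 161 * (Nat.log 2 n + 1) := by
  simp only [heapRemoveMin, halts_call]
  refine (h.heap.halts_removeMin hS).mono ?_
  rintro t l m' exec ⟨v, rt', heap, time⟩
  refine ⟨by rw [exec.labels_eq_nil rfl], v, rt', ⟨heap, (exec.adj_eq rfl rfl rfl).trans h.adj, ?_⟩,
    by omega⟩
  rw [exec.cell_eq rfl, exec.cell_eq rfl]
  exact h.state

theorem halts_outerIteration (h : IsSearching n A S rt U m) (hA : A.Valid n) (hS : S.Nonempty) :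
    Halts outerIteration m fun t l m' => ∃ S' rt' U', IsSearching n A S' rt' U' m' ∧
      S' ⊆ S.erase (m.reg .hmin) ∪ U' ∧ U' ⊆ U.erase (m.reg .hmin) ∧
      (U' = ∅ → l = [.outerIteration, .heapRemoveMin]) ∧
      t + 30 * potential S' m'.links rt' + 170 * A.work U' ≤
        30 * potential S m.links rt + 170 * A.work U + 172 * (Nat.log 2 n + 1) := by
  rw [halts_outerIteration_iff]
  simp only [halts_call, halts_seq, halts_cond, halts_skip, Test.holds, Word.eval]
  refine (h.halts_heapRemoveMin hS).mono ?_
  rintro t₁ _ m₁ - ⟨rfl, v, rt₁, h₁, time₁⟩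
  have hvn : m.reg .hmin < n := h.heap.lt (h.heap.hmin_mem hS)
  simp only [v, h₁.fixed_eq_zero_iff _ hvn]
  split_ifs with hvU
  · refine (h₁.halts_search hA (v ▸ hvU)).mono ?_
    rintro t₂ l₂ m₂ - ⟨S', rt', U', h', hS', hU', labels, time₂⟩
    exact ⟨S', rt', U', h', hS', v ▸ hU', fun hU => by rw [labels hU]; rfl, by omega⟩
  · exact ⟨_, rt₁, U, h₁, Finset.subset_union_left, (Finset.erase_eq_of_notMem hvU).ge,
      fun _ => rfl, by omega⟩

theorem halts_outerLoop (h : IsSearching n A S rt U m) (hA : A.Valid n) :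
    Halts (loop (.ne (.reg .hmin) (.reg .n)) outerIteration) m fun t _ _ =>
      t ≤ 30 * potential S m.links rt + 170 * A.work U +
        173 * (Nat.log 2 n + 1) * (S ∪ U).card + 1 := by
  refine (halts_loop_of_credit (I := fun p m' => ∃ S' rt' U', IsSearching n A S' rt' U' m' ∧
    p = 30 * potential S' m'.links rt' + 170 * A.work U' +
      173 * (Nat.log 2 n + 1) * (S' ∪ U').card) ?_ ⟨S, rt, U, h, rfl⟩).mono ?_
  · rintro p m₁ ⟨S₁, rt₁, U₁, h₁, rfl⟩ (hne : m₁.reg .hmin ≠ m₁.reg .n)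
    have hS := h₁.heap.hmin_ne_iff.1 hne
    refine (h₁.halts_outerIteration hA hS).mono ?_
    rintro t - m₂ - ⟨S₂, rt₂, U₂, h₂, hS₂, hU₂, -, time⟩
    refine ⟨_, ⟨S₂, rt₂, U₂, h₂, rfl⟩, ?_⟩
    have sub : S₂ ∪ U₂ ⊆ (S₁ ∪ U₁).erase (m₁.reg .hmin) := by
      rw [Finset.erase_union_distrib]
      exact Finset.union_subset (hS₂.trans (Finset.union_subset_union_right hU₂))
        (hU₂.trans Finset.subset_union_right)
    have card : (S₂ ∪ U₂).card + 1 ≤ (S₁ ∪ U₁).card :=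
      (Finset.card_le_card sub).trans_lt
        (Finset.card_erase_lt_of_mem (Finset.mem_union_left _ (h₁.heap.hmin_mem hS)))
    have := Nat.mul_le_mul_left (173 * (Nat.log 2 n + 1)) card
    rw [mul_add_one] at this
    omega
  · rintro t - m' - ⟨q, -, -, time⟩
    omega

end IsSearching

/-! ### The initialization -/

/-- The loop of `setup` that gives the vertices their initial values. -/
def clearLoop : Com :=
  loop (.lt (.reg .i) (.reg .n))
    (putNum .D .i .infty ;;
     put .fixed .i (.lit 0) ;;
     put .pred .i (.lit 0) ;;
     put .inQ .i (.lit 0) ;;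
     put .inH .i (.lit 0) ;;
     put .table .i (.reg .n) ;;
     inc .i)

/-- The loop of `setup` over the edges out of a vertex. -/
def countEdges : Com :=
  loop (.lt (.reg .j) (.reg .fin))
    (mov .k (.cell .tgt .j) ;;
     incAt .pred .k ;;
     inc .j)

/-- The loop of `setup` over all edges. -/
def countLoop : Com :=
  loop (.lt (.reg .i) (.reg .n))
    (mov .j (.cell .first .i) ;;
     mov .fin (.cell .last .i) ;;
     countEdges ;;
     inc .i)

/-- The initial values of vertex `u` have been set, except that the edges into `u` have not been
counted yet. -/
def IsCleared (n : ℕ) (m : Mem) (u : ℕ) : Prop :=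
  m.cell .fixed u = 0 ∧ m.cell .pred u = 0 ∧ m.cell .inH u = 0 ∧ m.cell .table u = n

section Setup

variable {n : ℕ} {A : AdjLists} {m : Mem}

theorem halts_clearLoop (hi : m.reg .i = 0) :
    Halts clearLoop m fun t _ m' => t ≤ 8 * m.reg .n + 1 ∧
      ∀ u < m.reg .n, IsCleared (m.reg .n) m' u := by
  refine (halts_loop_of_credit (I := fun p m' => m'.reg .n = m.reg .n ∧
    (∀ u < m'.reg .i, IsCleared (m.reg .n) m' u) ∧ p = 8 * (m.reg .n - m'.reg .i)) ?_
    ⟨rfl, by simp [hi], by rw [hi]⟩).mono ?_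
  · rintro p m₁ ⟨size, cleared, rfl⟩ (hlt : m₁.reg .i < m₁.reg .n)
    simp only [halts_seq, halts_putNum, halts_put, halts_inc]
    refine ⟨_, ⟨size, fun u (hu : u < m₁.reg .i + 1) => ?_, rfl⟩, ?_⟩
    · rcases eq_or_ne u (m₁.reg .i) with rfl | hui
      · simp [IsCleared, size]
      · simpa [IsCleared, hui] using cleared u (by omega)
    · change 8 * (_ - (m₁.reg .i + 1)) + _ + _ ≤ _
      omega
  · rintro t - m' - ⟨q, ⟨size, cleared, -⟩, hge, time⟩
    simp only [Test.holds, Word.eval, not_lt] at hge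
    exact ⟨by omega, fun u hu => cleared u (by omega)⟩

theorem halts_countEdges (htgt : m.cell .tgt = A.tgt) :
    Halts countEdges m fun t _ m' => t ≤ 4 * (m.reg .fin - m.reg .j) + 1 ∧
      ∀ k, m'.cell .pred k = m.cell .pred k + A.count (m.reg .j) (m.reg .fin) k := by
  refine (halts_loop_of_credit (I := fun p m' => m'.cell .tgt = A.tgt ∧
    (∀ k, m'.cell .pred k + A.count (m'.reg .j) (m'.reg .fin) k =
      m.cell .pred k + A.count (m.reg .j) (m.reg .fin) k) ∧
    p = 4 * (m'.reg .fin - m'.reg .j)) ?_ ⟨htgt, fun _ => rfl, rfl⟩).mono ?_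
  · rintro p m₁ ⟨htgt₁, pred, rfl⟩ (hlt : m₁.reg .j < m₁.reg .fin)
    simp only [halts_seq, halts_mov, halts_incAt, halts_inc, Word.eval]
    refine ⟨_, ⟨htgt₁, fun k => ?_, rfl⟩, ?_⟩
    · rw [← pred k, AdjLists.count_of_lt hlt, ← htgt₁]
      rcases eq_or_ne k (m₁.cell .tgt (m₁.reg .j)) with rfl | hk
      · simp [add_assoc]
      · simp [hk, hk.symm]
    · change 4 * (m₁.reg .fin - (m₁.reg .j + 1)) + _ + _ ≤ _
      omega
  · rintro t - m' - ⟨q, ⟨-, pred, -⟩, hge, time⟩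
    refine ⟨by omega, fun k => ?_⟩
    rw [← pred k, AdjLists.count_of_le (show m'.reg .fin ≤ m'.reg .j from not_lt.1 hge),
      add_zero]

theorem halts_countLoop (hi : m.reg .i = 0) (hA : m.adj = A) :
    Halts countLoop m fun t _ m' => t ≤ 5 * A.work (Finset.range (m.reg .n)) + 1 ∧
      ∀ k, m'.cell .pred k = m.cell .pred k + ∑ u ∈ Finset.range (m.reg .n), A.mult u k := by
  rw [Finset.range_eq_Ico, ← hi]
  refine (halts_loop_of_credit (I := fun p m' => m'.reg .n = m.reg .n ∧ m'.adj = A ∧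
    (∀ k, m'.cell .pred k + ∑ u ∈ Finset.Ico (m'.reg .i) (m.reg .n), A.mult u k =
      m.cell .pred k + ∑ u ∈ Finset.Ico (m.reg .i) (m.reg .n), A.mult u k) ∧
    p = 5 * A.work (Finset.Ico (m'.reg .i) (m.reg .n))) ?_ ⟨rfl, hA, fun _ => rfl, rfl⟩).mono ?_
  · rintro p m₁ ⟨size, rfl, pred, rfl⟩ (hlt : m₁.reg .i < m₁.reg .n)
    rw [size] at hlt
    simp only [halts_seq, halts_mov, halts_inc, Word.eval]
    refine Halts.mono (halts_countEdges (A := m₁.adj) (by rfl)) ?_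
    rintro t l m₂ exec ⟨time, pred₂⟩
    have size₂ : m₂.reg .n = m₁.reg .n := exec.reg_eq rfl
    have i₂ : m₂.reg .i = m₁.reg .i := exec.reg_eq rfl
    have adj₂ : m₂.adj = m₁.adj := exec.adj_eq rfl rfl rfl
    have pred₂ : ∀ k, m₂.cell .pred k = m₁.cell .pred k + m₁.adj.mult (m₁.reg .i) k := pred₂
    have time : t ≤ 4 * m₁.adj.out (m₁.reg .i) + 1 := time
    refine ⟨_, ⟨size₂.trans size, adj₂, fun k => ?_, rfl⟩, ?_⟩
    · rw [← pred k, Finset.sum_eq_sum_Ico_succ_bot hlt, ← add_assoc, ← pred₂ k, ← i₂]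
      rfl
    · change 5 * m₁.adj.work (Finset.Ico (m₂.reg .i + 1) _) + _ + _ ≤ _
      rw [i₂, AdjLists.work, AdjLists.work, Finset.sum_eq_sum_Ico_succ_bot hlt]
      omega
  · rintro t - m' - ⟨q, ⟨size, -, pred, -⟩, hge, time⟩
    simp only [Test.holds, Word.eval, not_lt, size] at hge
    refine ⟨by omega, fun k => ?_⟩
    rw [← pred k, Finset.Ico_eq_empty_of_le hge, Finset.sum_empty, add_zero]

theorem isHeap_empty (size : m.reg .n = n) (hmin : m.reg .hmin = n) (roots : m.reg .roots = n)
    (inH : ∀ v < n, m.cell .inH v = 0) (table : ∀ i < n, m.cell .table i = n) :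
    IsHeap n ∅ m [] where
  size := size
  roots := ⟨roots, List.nodup_nil, by simp, by simp, by simp⟩
  forest := ⟨fun _ => [], ⟨by simp, by simp, by simp, by simp, by simp, by simp, 0, by simp⟩,
    ⟨by simp, by simp⟩, by simp [IsHeapOrdered]⟩
  hmin := .inl ⟨rfl, hmin⟩
  inH := by simpa using inH
  table := table
  key := by simp

theorem isSearching_empty (heap : IsHeap n ∅ m []) (adj : m.adj = A)
    (fixed : ∀ u < n, m.cell .fixed u = 0)
    (pred : ∀ u < n, m.cell .pred u = ∑ v ∈ Finset.range n, A.mult v u) :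
    IsSearching n A ∅ [] (Finset.range n) m where
  heap := heap
  adj := adj
  state :=
  { nodup := List.nodup_nil
    lt := by simp
    subset := by simp
    fixed_eq_zero_iff u hu := by simp [fixed u hu, hu]
    mem_of_notMem u hu _ := hu
    tgt_lt := by simp
    pred_eq u hu _ := by simp [pred u hu, AdjLists.count_of_le]
    mult_eq_zero u hu _ hpred v hv := by
      rw [pred u hu, Finset.sum_eq_zero_iff] at hpred
      exact hpred v (Finset.mem_range.2 hv) }

theorem halts_setup (size : m.reg .n = n) :
    Halts setup m fun t _ m' => t ≤ 13 * m.adj.work (Finset.range n) + 6 ∧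
      IsSearching n m.adj ∅ [] (Finset.range n) m' := by
  change Halts (mov .i (.lit 0) ;; clearLoop ;; mov .i (.lit 0) ;; countLoop ;;
    mov .hmin (.reg .n) ;; mov .roots (.reg .n)) m _
  simp only [halts_seq, halts_mov, Word.eval]
  refine (halts_clearLoop rfl).mono ?_
  rintro t₁ l₁ m₁ exec₁ ⟨time₁, cleared⟩
  have size₁ : m₁.reg .n = n := (exec₁.reg_eq rfl).trans size
  have adj₁ : (m₁.setReg .i 0).adj = m.adj := exec₁.adj_eq rfl rfl rfl
  refine (halts_countLoop rfl adj₁).mono ?_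
  rintro t₂ l₂ m₂ exec₂ ⟨time₂, pred⟩
  have size₂ : m₂.reg .n = n := (exec₂.reg_eq rfl).trans size₁
  have adj₂ : m₂.adj = m.adj := (exec₂.adj_eq rfl rfl rfl).trans adj₁
  have work : n ≤ m.adj.work (Finset.range n) := by
    simp [AdjLists.work, Finset.sum_add_distrib]
  simp only [Mem.setReg_reg, reduceCtorEq, if_false, size] at time₁ cleared
  simp only [Mem.setReg_reg, Mem.setReg_cell, reduceCtorEq, if_false, size₁] at time₂ pred
  refine ⟨by omega, isSearching_empty (isHeap_empty size₂ size₂ size₂ (fun u hu => ?_)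
    fun u hu => ?_) adj₂ (fun u hu => ?_) fun u hu => ?_⟩
  · exact (congrFun (exec₂.cell_eq rfl) u).trans (cleared u hu).2.2.1
  · exact (congrFun (exec₂.cell_eq rfl) u).trans (cleared u hu).2.2.2
  · exact (congrFun (exec₂.cell_eq rfl) u).trans (cleared u hu).1
  · exact (pred u).trans (by rw [(cleared u hu).2.1, zero_add])

/-- The part of `SP₁` before the outer loop. -/
def prepare : Com :=
  setup ;;
  putNum .D .src .zero ;;
  mov .v (.reg .src) ;;
  heapInsert

theorem halts_SP₁_iff {Q : ℕ → List Label → Mem → Prop} :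
    Halts SP₁ m Q ↔
      Halts (prepare ;; loop (.ne (.reg .hmin) (.reg .n)) outerIteration) m Q := by
  simp only [SP₁, prepare, halts_seq, add_assoc, List.append_assoc]

theorem halts_prepare (size : m.reg .n = n) (hs : m.reg .src < n) :
    Halts prepare m fun t l m' => l = [.heapInsert] ∧
      t ≤ 13 * m.adj.work (Finset.range n) + 20 ∧ ∃ rt,
        IsSearching n m.adj {m.reg .src} rt (Finset.range n) m' ∧
        potential {m.reg .src} m'.links rt = 1 := by
  simp only [prepare, heapInsert, halts_seq, halts_call, halts_putNum, halts_mov]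
  refine (halts_setup size).mono ?_
  rintro t₁ l₁ m₁ exec₁ ⟨time₁, searching₁⟩
  have src₁ : m₁.reg .src = m.reg .src := exec₁.reg_eq rfl
  have heap₁ := searching₁.heap
  have heap₂ : IsHeap n ∅ ((m₁.setNum .D (m₁.reg .src) 0).setReg .v (m₁.reg .src)) [] :=
    ⟨heap₁.size, heap₁.roots, heap₁.forest, heap₁.hmin, heap₁.inH, heap₁.table, by simp⟩
  refine Halts.mono (heap₂.halts_insertNode (Finset.notMem_empty _) (src₁.trans_lt hs)) ?_
  rintro t₂ l₂ m₂ exec₂ ⟨time₂, heap, pot⟩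
  change IsHeap n (insert (m₁.reg .src) ∅) m₂ [m₁.reg .src] at heap
  change potential (insert (m₁.reg .src) ∅) _ [m₁.reg .src] = _ at pot
  rw [src₁, insert_empty_eq] at heap pot
  refine ⟨?_, by omega, _, ⟨heap, (exec₂.adj_eq rfl rfl rfl).trans searching₁.adj, ?_⟩, pot⟩
  · rw [exec₁.labels_eq_nil rfl, exec₂.labels_eq_nil rfl]
    rfl
  · rw [exec₂.cell_eq rfl, exec₂.cell_eq rfl]
    exact searching₁.state

end Setup

/-! ### The input graph -/

section Graph

variable {n : ℕ} {G : Digraph (Fin n)}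

theorem numEdges_eq_sum (G : Digraph (Fin n)) :
    numEdges G = ∑ u, {v | G.Adj u v}.ncard := by
  classical
  simp only [numEdges, Set.ncard_eq_toFinset_card', Set.toFinset_ofPred, Finset.card_filter]
  rw [← Finset.univ_product_univ, Finset.sum_product]

theorem exists_adj_of_inDegree_ne_zero {v : Fin n} (hv : inDegree G v ≠ 0) : ∃ u, G.Adj u v :=
  Set.nonempty_of_ncard_ne_zero hv

theorem le_numEdges_add_one {s : Fin n} (hs : ∀ v ≠ s, ∃ u, G.Adj u v) : n ≤ numEdges G + 1 := by
  choose! f hf using hs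
  have card : ({s}ᶜ : Set (Fin n)).ncard ≤ numEdges G :=
    Set.ncard_le_ncard_of_injOn (fun v => (f v, v)) hf fun _ _ _ _ h => (Prod.mk.inj h).2
  rw [Set.ncard_compl, Set.ncard_singleton, Nat.card_fin] at card
  exact Nat.sub_le_iff_le_add.1 card

theorem IsAcyclic.eq_empty (hG : IsAcyclic G) {U : Set (Fin n)}
    (hU : ∀ v ∈ U, ∃ u ∈ U, G.Adj u v) : U = ∅ := by
  have : IsTrans (Fin n) (Relation.TransGen G.Adj) := ⟨fun _ _ _ => Relation.TransGen.trans⟩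
  have : Std.Irrefl (Relation.TransGen G.Adj) := ⟨hG⟩
  have wf := Finite.wellFounded_of_trans_of_irrefl (Relation.TransGen G.Adj)
  refine Set.eq_empty_of_forall_notMem fun v =>
    wf.induction (C := (· ∉ U)) v fun v ih hv => ?_
  obtain ⟨u, hu, adj⟩ := hU v hv
  exact ih u (.single adj) hu

end Graph

namespace IsInput

variable {n : ℕ} {G : Digraph (Fin n)} {w : Fin n → Fin n → ℝ} {s : Fin n} {m : Mem}

theorem valid (h : IsInput G w s m) : m.adj.Valid n := by
  intro u hu p hp
  obtain ⟨v, -, hv⟩ := (h.neighbours ⟨u, hu⟩).mapsTo (Finset.mem_Ico.1 hp)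
  exact (show m.adj.tgt p = v from hv) ▸ v.2

theorem mult_ne_zero_iff (h : IsInput G w s m) (u v : Fin n) :
    m.adj.mult u v ≠ 0 ↔ G.Adj u v := by
  rw [AdjLists.mult, AdjLists.count, Finset.card_ne_zero]
  constructor
  · rintro ⟨p, hp⟩
    obtain ⟨mem, tgt⟩ := Finset.mem_filter.1 hp
    obtain ⟨v', adj, tgt'⟩ := (h.neighbours u).mapsTo (Finset.mem_Ico.1 mem)
    rwa [Fin.ext (tgt.symm.trans tgt')]
  · intro adj
    obtain ⟨p, mem, tgt⟩ := (h.neighbours u).surjOn ⟨v, adj, rfl⟩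
    exact ⟨p, Finset.mem_filter.2 ⟨Finset.mem_Ico.2 mem, tgt⟩⟩

theorem out_eq (h : IsInput G w s m) (u : Fin n) :
    m.adj.out u = {v | G.Adj u v}.ncard := by
  have image : {k : ℕ | ∃ v : Fin n, G.Adj u v ∧ k = v} = Fin.val '' {v | G.Adj u v} := by
    ext k
    simp [eq_comm]
  rw [← Set.ncard_image_of_injective _ Fin.val_injective, ← image, ← (h.neighbours u).ncard_eq,
    ← Finset.coe_Ico, Set.ncard_coe_finset, Nat.card_Ico]
  rfl

theorem work_eq (h : IsInput G w s m) : m.adj.work (Finset.range n) = n + numEdges G := by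
  simp [AdjLists.work, Finset.sum_add_distrib, Finset.sum_range, h.out_eq, numEdges_eq_sum]

theorem halts_SP₁ (h : IsInput G w s m) :
    Halts SP₁ m fun t _ _ =>
      t ≤ 183 * (n + numEdges G) + 173 * (Nat.log 2 n + 1) * n + 60 := by
  rw [halts_SP₁_iff, halts_seq]
  refine (halts_prepare h.size (h.source ▸ s.2)).mono ?_
  rintro t₁ l₁ m₁ - ⟨-, time₁, rt, searching, pot⟩
  refine (searching.halts_outerLoop h.valid).mono ?_
  rintro t₂ l₂ m₂ - time₂
  rw [h.source, Finset.union_eq_right.2 (by simp), Finset.card_range] at time₂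
  rw [h.source] at pot
  rw [h.work_eq] at time₁ time₂
  omega

theorem eq_empty_of_isSearching (h : IsInput G w s m) (hG : IsAcyclic G)
    (hs : ∀ v ≠ s, ∃ u, G.Adj u v) {S U : Finset ℕ} {rt : List ℕ} {m' : Mem}
    (searching : IsSearching n m.adj S rt U m') (hsU : ↑s ∉ U) : U = ∅ := by
  have empty : {v : Fin n | ↑v ∈ U} = ∅ := by
    refine hG.eq_empty fun v (hv : ↑v ∈ U) => ?_
    have fixed := (searching.fixed_eq_zero_iff v v.2).2 hv
    obtain ⟨z, adj⟩ := hs v fun hvs => hsU (hvs ▸ hv)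
    have pred : m'.cell .pred v ≠ 0 := fun hp => (h.mult_ne_zero_iff z v).2 adj
      (searching.state.mult_eq_zero v v.2 fixed hp z z.2)
    rw [searching.state.pred_eq v v.2 fixed, AdjLists.count_of_le le_rfl, add_zero] at pred
    obtain ⟨u, hu, mult⟩ := Finset.exists_ne_zero_of_sum_ne_zero pred
    exact ⟨⟨u, searching.state.lt u hu⟩, hu, (h.mult_ne_zero_iff ⟨u, _⟩ v).1 mult⟩
  refine Finset.eq_empty_of_forall_notMem fun u hu => ?_
  exact empty.subset (show (⟨u, searching.state.lt u hu⟩ : Fin n) ∈ {v : Fin n | ↑v ∈ U} from hu)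

theorem halts_SP₁_of_isAcyclic (h : IsInput G w s m) (hG : IsAcyclic G)
    (hs : ∀ v ≠ s, ∃ u, G.Adj u v) :
    Halts SP₁ m fun t l _ => l = [.heapInsert, .outerIteration, .heapRemoveMin] ∧
      t ≤ 183 * (n + numEdges G) + 172 * (Nat.log 2 n + 1) + 60 := by
  rw [halts_SP₁_iff, halts_seq]
  refine (halts_prepare h.size (h.source ▸ s.2)).mono ?_
  rintro t₁ _ m₁ - ⟨rfl, time₁, rt, searching, pot⟩
  rw [h.source] at searching pot
  rw [h.work_eq] at time₁
  have hmin : m₁.reg .hmin = s :=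
    Finset.mem_singleton.1 (searching.heap.hmin_mem (Finset.singleton_nonempty _))
  refine halts_loop_of (searching.heap.hmin_ne_iff.2 (Finset.singleton_nonempty _)) ?_
  refine (searching.halts_outerIteration h.valid (Finset.singleton_nonempty _)).mono ?_
  rintro t₂ l₂ m₂ - ⟨S, rt', U, searching', hS, hU, labels, time₂⟩
  obtain rfl : U = ∅ := h.eq_empty_of_isSearching hG hs searching' fun hsU =>
    Finset.notMem_erase _ _ (hmin ▸ hU hsU)
  obtain rfl : S = ∅ := by simpa [hmin] using hS
  refine halts_loop_of_not (mt searching'.heap.hmin_ne_iff.1 Finset.not_nonempty_empty) ⟨?_, ?_⟩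
  · rw [labels rfl]
    rfl
  · rw [h.work_eq] at time₂
    omega

end IsInput

/-! ### The bounds -/

theorem natLog_le (n : ℕ) : (Nat.log 2 n : ℝ) ≤ 2 * Real.log n := by
  have logb := Real.natLog_le_logb n 2
  have log_two := Real.log_two_gt_d9
  rw [Nat.cast_ofNat, Real.logb, le_div_iff₀ (by linarith)] at logb
  nlinarith [(Nat.log 2 n).cast_nonneg (α := ℝ)]

theorem le_mul_log (n : ℕ) : (n : ℝ) ≤ 2 * (n * Real.log n) + 1 := by
  rcases lt_or_ge n 2 with hn | hn
  · interval_cases n <;> simp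
  have log_le : Real.log 2 ≤ Real.log n := Real.log_le_log two_pos (by exact_mod_cast hn)
  have log_two := Real.log_two_gt_d9
  nlinarith [n.cast_nonneg (α := ℝ)]

end SP

theorem mainTheorem2_general :
    ∃ C : ℝ, ∀ (n : ℕ) (G : Digraph (Fin n)) (w : Fin n → Fin n → ℝ) (s : Fin n) (m : SP.Mem),
      SP.IsInput G w s m →
      ∃ (t : ℕ) (l : List SP.Label) (m' : SP.Mem),
        SP.Exec SP.SP₁ m t l m' ∧
        (t : ℝ) ≤ C * (SP.numEdges G + n * Real.log n + 1) ∧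
        (SP.IsAcyclic G → (∀ v : Fin n, SP.inDegree G v = 0 → v = s) →
          (t : ℝ) ≤ C * (SP.numEdges G + 1) ∧
          l.count .outerIteration = 1 ∧
          l.count .heapInsert = 1 ∧
          l.count .heapRemoveMin = 1 ∧
          l.count .heapInsertOrAdjust = 0) := by
  refine ⟨2000, fun n G w s m hm => ?_⟩
  have log_nonneg : (0 : ℝ) ≤ n * Real.log n :=
    mul_nonneg n.cast_nonneg (Real.log_natCast_nonneg n)
  by_cases hG : SP.IsAcyclic G ∧ ∀ v : Fin n, SP.inDegree G v = 0 → v = s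
  · have hs : ∀ v ≠ s, ∃ u, G.Adj u v := fun v hv =>
      SP.exists_adj_of_inDegree_ne_zero (mt (hG.2 v) hv)
    obtain ⟨t, _, m', exec, rfl, time⟩ := hm.halts_SP₁_of_isAcyclic hG.1 hs
    have linear : (t : ℝ) ≤ 2000 * (SP.numEdges G + 1) := by
      have := SP.le_numEdges_add_one hs
      have := Nat.log_le_self 2 n
      exact_mod_cast show t ≤ 2000 * (SP.numEdges G + 1) by omega
    exact ⟨t, _, m', exec, by linarith, fun _ _ => ⟨linear, by decide⟩⟩
  · obtain ⟨t, l, m', exec, time⟩ := hm.halts_SP₁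
    refine ⟨t, l, m', exec, ?_, fun acyclic hs => absurd ⟨acyclic, hs⟩ hG⟩
    rify at time
    have log_le := mul_le_mul_of_nonneg_left (SP.natLog_le n) n.cast_nonneg
    have size_le := SP.le_mul_log n
    linarith [(SP.numEdges G).cast_nonneg (α := ℝ)]

theorem mainTheorem2 :
    ∃ C : ℝ, ∀ (n : ℕ) (G : Digraph (Fin n)) (w : Fin n → Fin n → ℝ) (s : Fin n) (m : SP.Mem),
      (∀ u v : Fin n, G.Adj u v → 0 < w u v) →
      SP.IsInput G w s m →
      ∃ (t : ℕ) (l : List SP.Label) (m' : SP.Mem),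
        SP.Exec SP.SP₁ m t l m' ∧
        (t : ℝ) ≤ C * (SP.numEdges G + n * Real.log n + 1) ∧
        (SP.IsAcyclic G → (∀ v : Fin n, SP.inDegree G v = 0 ↔ v = s) →
          (t : ℝ) ≤ C * (SP.numEdges G + 1) ∧
          l.count .outerIteration = 1 ∧
          l.count .heapInsert = 1 ∧
          l.count .heapRemoveMin = 1 ∧
          l.count .heapInsertOrAdjust = 0) :=
  let ⟨C, hC⟩ := mainTheorem2_general
  ⟨C, fun n G w s m _ hm => let ⟨t, l, m', exec, time, acyclic⟩ := hC n G w s m hm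
    ⟨t, l, m', exec, time, fun hG hs => acyclic hG fun v => (hs v).1⟩⟩
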